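/- A finite partially ordered set $S$ is *tree-like* if it has a least element and its undirected Hasse diagram $T_S$ is a tree. Its width $w$ is the largest size of a set of pairwise incomparable elements, and $n=|S|$. A *(dynamic) edge query* $(x,y)$, $x,y\in S$, with respect to $u\in S$ is answered as follows: delete the first and the last edge of the path from $x$ to $y$ in $T_S$; the answer is $x$, $y$ or HERE according to whether $u$ lies in the component of $x$, in the component of $y$, or in neither. A *search tree* for $S$ is a ternary decision tree of edge queries whose leaves are elements of $S$ or empty and in which the search for any $u\in S$ ends in $u$; its height is the largest number of queries on a root-to-leaf path, and $\mathrm{OPT}$ is the minimum height of a search tree for $S$. A *Line-Leaf Tree* of $S$ is obtained by contracting $T_S$. Initially $LST(x)$ consists of $x$ alone for every node $x$, and $BST(x,y)$ is empty for every edge $xy$. While more than one node is left, do the following two steps. (1) Line contraction: each maximal path $x_2,\dots,x_{t-1}$ of degree-two nodes, bounded by nodes $x_1,x_t$ of other degrees, is replaced by an edge $x_1x_t$, and $BST(x_1,x_t)$ is a height-balanced binary search tree whose keys are the edge queries $(x_i,x_{i+1})$, $1\le i<t$; the answer HERE to $(x_i,x_{i+1})$ leads to $BST(x_i,x_{i+1})$,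 and the leaf $x_i$, $1<i<t$, leads to $LST(x_i)$ (the leaves $x_1$ and $x_t$ are impossible and empty). (2) Leaf contraction: each degree-one node $y$, with neighbour $x$, is removed, and the query $(x,y)$ is put at the front of $LST(x)$ (in any order for the nodes $y$ removed together); its answers $x$, HERE, $y$ lead to the rest of $LST(x)$, to $BST(x,y)$ and to $LST(y)$. If only one edge is left, either of its ends is kept as the root. The Line-Leaf Tree is $LST(r)$ for the last remaining node $r$. **Theorem.** (a) There is a constant $C$ such that for every tree-like $S$, every Line-Leaf Tree of $S$ has height at most $C\cdot\max(1,\log_2 w)\cdot\mathrm{OPT}$. (b) This is tight in the worst case: there is a constant $c>0$ such that there are tree-like sets $S$ of arbitrarily large width $w$ all of whose Line-Leaf Trees have height at least $c\cdot\log_2 w\cdot\mathrm{OPT}$. (c) Given the Hasse diagram of $S$, a Line-Leaf Tree of $S$ can be built in $O(n)$ time and space: there are one program for a unit-cost random access machine and a constant $C'$ such that, for every tree-like $S$ with $n$ elements, given as the list of the edges of its Hasse diagram (for any numbering of the elements and any order of the edges), the program halts after at most $C'n$ steps, using only memory addresses and numbers of size at most $C'n$, with a Line-Leaf Tree of $S$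 stored in memory as a linked structure. -/

import Mathlib

namespace LineLeaf

/-! ## Tree-like posets, edge queries, search trees -/

/-- A finite poset `S` is tree-like if its undirected Hasse diagram is a tree and it has a least
element `ν` (so the Hasse diagram is a tree rooted at `ν`, oriented away from the root). -/
structure TreeLike (S : Type*) [PartialOrder S] : Prop where
  finite : Finite S
  isTree : (SimpleGraph.hasse S).IsTree
  exists_least : ∃ ν : S, ∀ x : S, ν ≤ x

/-- The width of a poset: the largest size of a set of mutually incomparable elements. -/
noncomputable def width (S : Type*) [PartialOrder S] : ℕ :=
  sSup {k | ∃ A : Finset S, IsAntichain (· ≤ ·) (A : Set S) ∧ A.card = k}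

/-- The three possible answers to an edge query `(x, y)`: `X`, `Y` or `HERE`. -/
inductive Answer
  | atFst
  | here
  | atSnd

/-- `u` lies in the component of `x` once the first and the last edge of the path from `x` to `y`
have been removed from the undirected Hasse diagram. -/
def OnSideOf {S : Type*} [PartialOrder S] (x y u : S) : Prop :=
  ∃ p : (SimpleGraph.hasse S).Walk x y, p.IsPath ∧
    ((SimpleGraph.hasse S).deleteEdges {s(x, p.snd), s(p.penultimate, y)}).Reachable x u

open Classical in
/-- The answer to the dynamic edge query `(x, y)` with respect to `u`. -/
noncomputable def answer {S : Type*} [PartialOrder S] (x y u : S) : Answer :=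
  if OnSideOf x y u then Answer.atFst
  else if OnSideOf y x u then Answer.atSnd
  else Answer.here

/-- Search trees built from dynamic edge queries. A `query x y` node has one subtree for each of
the three answers `X`, `HERE`, `Y` (in this order). A leaf is either an element of `S` or empty;
empty leaves stand both for an unsuccessful search and for impossible answers. -/
inductive SearchTree (S : Type*)
  | nil : SearchTree S
  | found (x : S) : SearchTree S
  | query (x y : S) (tx there ty : SearchTree S) : SearchTree S

namespace SearchTree

/-- The largest number of edge queries on a root-to-leaf path. -/
def height {S : Type*} : SearchTree S → ℕ
  | nil => 0
  | found _ => 0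
  | query _ _ tx there ty => max tx.height (max there.height ty.height) + 1

/-- The result of searching for `u`. -/
noncomputable def search {S : Type*} [PartialOrder S] (u : S) : SearchTree S → Option S
  | nil => none
  | found x => some x
  | query x y tx there ty =>
    match answer x y u with
    | Answer.atFst => tx.search u
    | Answer.here => there.search u
    | Answer.atSnd => ty.search u

end SearchTree

/-- `T` is a search tree for `S`: every element of `S` is found. -/
def IsSearchTree {S : Type*} [PartialOrder S] (T : SearchTree S) : Prop :=
  ∀ u : S, T.search u = some u

/-- `OPT`, the minimum height of a search tree for `S`. -/
noncomputable def opt (S : Type*) [PartialOrder S] : ℕ :=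
  sInf {h | ∃ T : SearchTree S, IsSearchTree T ∧ T.height = h}

/-! ## The contraction process -/

/-- A stage of the contraction process: the nodes that are still present, the current tree on them,
the linear search tree `LST(x)` of each node `x`, and the binary search tree `BST(x, y)` of each
(undirected) edge. -/
structure Stage (S : Type*) where
  live : Set S
  graph : SimpleGraph S
  lst : S → SearchTree S
  bst : Sym2 S → SearchTree S

/-- The stage before the first iteration: the tree is the Hasse diagram, `LST(x)` is just `x`, and
all binary search trees are empty. -/
def initial (S : Type*) [PartialOrder S] : Stage S where
  live := Set.univ
  graph := SimpleGraph.hasse S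
  lst := SearchTree.found
  bst := fun _ => SearchTree.nil

/-- The degree of a node. -/
noncomputable def deg {S : Type*} (G : SimpleGraph S) (x : S) : ℕ := (G.neighborSet x).ncard

/-- `p` is a path between two distinct nodes of degree other than two all of whose interior nodes
have degree two. (A single edge between two nodes of degree other than two is allowed.) -/
def IsLine {S : Type*} (G : SimpleGraph S) {x y : S} (p : G.Walk x y) : Prop :=
  p.IsPath ∧ x ≠ y ∧ deg G x ≠ 2 ∧ deg G y ≠ 2 ∧
    ∀ z ∈ p.support, z ≠ x → z ≠ y → deg G z = 2

/-- `IsBalancedBST leaf here path h t`: the tree `t` is a balanced (height-balanced) binary search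
tree of height `h` over the sequence of nodes `path`. Its keys are edge queries `(a, b)` for
consecutive nodes `a, b`; its leaves are the nodes of `path`, at which the search goes on in `leaf`;
if a query `(a, b)` answers `HERE`, then the search goes on in `here s(a, b)`. The height `h` and
the balance condition concern only the keys of this binary search tree. -/
inductive IsBalancedBST {S : Type*} (leaf : S → SearchTree S) (here : Sym2 S → SearchTree S) :
    List S → ℕ → SearchTree S → Prop
  | single (x : S) : IsBalancedBST leaf here [x] 0 (leaf x)
  | node (l r : List S) (a b : S) (h₁ h₂ : ℕ) (t₁ t₂ : SearchTree S)
      (left : IsBalancedBST leaf here (l ++ [a]) h₁ t₁)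
      (right : IsBalancedBST leaf here (b :: r) h₂ t₂)
      (bal₁ : h₁ ≤ h₂ + 1) (bal₂ : h₂ ≤ h₁ + 1) :
      IsBalancedBST leaf here (l ++ a :: b :: r) (max h₁ h₂ + 1)
        (SearchTree.query a b t₁ (here s(a, b)) t₂)

open Classical in
/-- `t` is a balanced binary search tree for the path `x, …, y` with node sequence `path`. At an
interior node `z` the search goes on in `LST(z)`; the answers `x` and `y` are impossible. -/
def IsPathBST {S : Type*} (st : Stage S) (x y : S) (path : List S) (t : SearchTree S) : Prop :=
  ∃ h, IsBalancedBST (fun z => if z = x ∨ z = y then SearchTree.nil else st.lst z) st.bst path h t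

/-- Line contraction: each maximal path of degree-two nodes is replaced by one edge, whose `BST` is
a balanced binary search tree over the path (read in either direction). Other edges are kept. -/
structure LineContraction {S : Type*} (st st' : Stage S) : Prop where
  live_eq : st'.live = {x ∈ st.live | deg st.graph x ≠ 2}
  adj_iff : ∀ x y, st'.graph.Adj x y ↔ ∃ p : st.graph.Walk x y, IsLine st.graph p
  lst_eq : st'.lst = st.lst
  bst_edge : ∀ (x y : S) (p : st.graph.Walk x y), IsLine st.graph p → p.length = 1 →
    st'.bst s(x, y) = st.bst s(x, y)
  bst_path : ∀ (x y : S) (p : st.graph.Walk x y), IsLine st.graph p → 2 ≤ p.length →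
    IsPathBST st x y p.support (st'.bst s(x, y)) ∨
      IsPathBST st x y p.support.reverse (st'.bst s(x, y))

/-- Put the edge queries `(x, y)`, for `y` in the list, in front of `LST(x)`. Such a query leads to
the rest of the list, to `BST(x, y)` or to `LST(y)`. -/
def addQueries {S : Type*} (st : Stage S) (x : S) (ys : List S) : SearchTree S :=
  ys.foldr (fun y rest => SearchTree.query x y rest (st.bst s(x, y)) (st.lst y)) (st.lst x)

/-- Leaf contraction: all nodes of degree one are contracted into the linear search trees of their
neighbours, those of one neighbour in any order. If the tree is a single edge, so that all its nodes
have degree one, then an arbitrary one of them is kept as the root. -/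
structure LeafContraction {S : Type*} (st st' : Stage S) : Prop where
  live_eq : {x ∈ st.live | deg st.graph x ≠ 1}.Nonempty →
    st'.live = {x ∈ st.live | deg st.graph x ≠ 1}
  live_root : ¬ {x ∈ st.live | deg st.graph x ≠ 1}.Nonempty → ∃ r ∈ st.live, st'.live = {r}
  adj_iff : ∀ x y, st'.graph.Adj x y ↔ st.graph.Adj x y ∧ x ∈ st'.live ∧ y ∈ st'.live
  bst_eq : st'.bst = st.bst
  lst_live : ∀ x ∈ st'.live, ∃ ys : List S, ys.Nodup ∧
    (∀ y, y ∈ ys ↔ st.graph.Adj x y ∧ y ∉ st'.live) ∧ st'.lst x = addQueries st x ys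
  lst_dead : ∀ x ∉ st'.live, st'.lst x = st.lst x

/-- One iteration: a line contraction followed by a leaf contraction, as long as more than one node
is left. -/
def Iteration {S : Type*} (st st'' : Stage S) : Prop :=
  st.live.Nontrivial ∧ ∃ st', LineContraction st st' ∧ LeafContraction st' st''

/-- `T` is a Line-Leaf Tree of `S`: the linear search tree of the last remaining node. -/
def IsLineLeafTree {S : Type*} [PartialOrder S] (T : SearchTree S) : Prop :=
  ∃ (st : Stage S) (r : S), Relation.ReflTransGen Iteration (initial S) st ∧
    st.live = {r} ∧ T = st.lst r

/-! ## A random access machine with words of bounded size -/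

/-- Expressions over the registers. -/
inductive Expr
  | const (k : ℕ)
  | reg (i : ℕ)
  | add (a b : Expr)
  | sub (a b : Expr)
  | half (a : Expr)
  | eq (a b : Expr)
  | lt (a b : Expr)

/-- The value of an expression; truth values are `1` and `0`, subtraction is truncated. -/
def Expr.eval (ρ : ℕ → ℕ) : Expr → ℕ
  | const k => k
  | reg i => ρ i
  | add a b => a.eval ρ + b.eval ρ
  | sub a b => a.eval ρ - b.eval ρ
  | half a => a.eval ρ / 2
  | eq a b => if a.eval ρ = b.eval ρ then 1 else 0
  | lt a b => if a.eval ρ < b.eval ρ then 1 else 0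

/-- Programs of the random access machine: `assign i a` puts the value of `a` into register `i`,
`load i a` puts the content of the memory cell with address `a` into register `i`, and `store a b`
puts the value of `b` into the memory cell with address `a`. -/
inductive Program
  | nop
  | assign (i : ℕ) (a : Expr)
  | load (i : ℕ) (a : Expr)
  | store (a b : Expr)
  | seq (p q : Program)
  | ite (a : Expr) (p q : Program)
  | loop (a : Expr) (p : Program)

/-- A configuration: the contents of the registers and of the memory cells. -/
structure Config where
  reg : ℕ → ℕ
  mem : ℕ → ℕ

/-- `Exec B p c t c'`: on a machine with memory cells `0, …, B` and with registers and cells that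
hold numbers `0, …, B`, the program `p`, started in `c`, halts in `c'` after `t` steps. A step is an
instruction or the evaluation of a test. (A program contains finitely many expressions, so counting
each evaluation as one step changes the time by at most a constant factor.) Execution gets stuck if
an address or a value exceeds `B`. -/
inductive Exec (B : ℕ) : Program → Config → ℕ → Config → Prop
  | nop (c : Config) : Exec B Program.nop c 1 c
  | assign (i : ℕ) (a : Expr) (c : Config) (hv : a.eval c.reg ≤ B) :
      Exec B (Program.assign i a) c 1 ⟨Function.update c.reg i (a.eval c.reg), c.mem⟩
  | load (i : ℕ) (a : Expr) (c : Config) (ha : a.eval c.reg ≤ B)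
      (hv : c.mem (a.eval c.reg) ≤ B) :
      Exec B (Program.load i a) c 1 ⟨Function.update c.reg i (c.mem (a.eval c.reg)), c.mem⟩
  | store (a b : Expr) (c : Config) (ha : a.eval c.reg ≤ B) (hv : b.eval c.reg ≤ B) :
      Exec B (Program.store a b) c 1 ⟨c.reg, Function.update c.mem (a.eval c.reg) (b.eval c.reg)⟩
  | seq (p q : Program) (c c' c'' : Config) (t t' : ℕ) (hp : Exec B p c t c')
      (hq : Exec B q c' t' c'') : Exec B (Program.seq p q) c (t + t') c''
  | iteTrue (a : Expr) (p q : Program) (c c' : Config) (t : ℕ) (ha : a.eval c.reg ≠ 0)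
      (hp : Exec B p c t c') : Exec B (Program.ite a p q) c (t + 1) c'
  | iteFalse (a : Expr) (p q : Program) (c c' : Config) (t : ℕ) (ha : a.eval c.reg = 0)
      (hq : Exec B q c t c') : Exec B (Program.ite a p q) c (t + 1) c'
  | loopTrue (a : Expr) (p : Program) (c c' c'' : Config) (t t' : ℕ) (ha : a.eval c.reg ≠ 0)
      (hp : Exec B p c t c') (hl : Exec B (Program.loop a p) c' t' c'') :
      Exec B (Program.loop a p) c (t + t' + 1) c''
  | loopFalse (a : Expr) (p : Program) (c : Config) (ha : a.eval c.reg = 0) :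
      Exec B (Program.loop a p) c 1 c

/-- `L` lists the edges `(x, y)` of the directed Hasse diagram of `S`, in any order. -/
def IsEdgeList {S : Type*} [PartialOrder S] (L : List (S × S)) : Prop :=
  L.Nodup ∧ ∀ x y : S, (x, y) ∈ L ↔ x ⋖ y

/-- The input configuration: register `0` holds the number `n` of nodes, and the cells `2 j` and
`2 j + 1` hold the names of the two ends of the `j`-th edge; everything else is `0`. -/
def input {S : Type*} (n : ℕ) (name : S → ℕ) (L : List (S × S)) : Config where
  reg := fun i => if i = 0 then n else 0
  mem := fun i => (L.flatMap fun e => [name e.1, name e.2]).getD i 0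

/-- The tree `T` is stored at address `p`: an empty leaf is a record `0`, a leaf `x` is a record
`1, x`, and a query is a record `2, x, y` followed by the addresses of its three subtrees. -/
inductive StoredAt {S : Type*} (name : S → ℕ) (mem : ℕ → ℕ) : ℕ → SearchTree S → Prop
  | nil (p : ℕ) (h₀ : mem p = 0) : StoredAt name mem p SearchTree.nil
  | found (p : ℕ) (x : S) (h₀ : mem p = 1) (h₁ : mem (p + 1) = name x) :
      StoredAt name mem p (SearchTree.found x)
  | query (p : ℕ) (x y : S) (tx there ty : SearchTree S) (h₀ : mem p = 2)
      (h₁ : mem (p + 1) = name x) (h₂ : mem (p + 2) = name y)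
      (hx : StoredAt name mem (mem (p + 3)) tx)
      (hh : StoredAt name mem (mem (p + 4)) there)
      (hy : StoredAt name mem (mem (p + 5)) ty) :
      StoredAt name mem p (SearchTree.query x y tx there ty)

/-- The program `P` builds Line-Leaf Trees with time and space bound `C * n`: for every tree-like
`S` with `n` elements, given the Hasse diagram of `S` (with any numbering of the elements by
`0, …, n - 1` and any order of the edges), `P` halts after at most `C * n` steps on a machine with
cells `0, …, C * n` that hold numbers up to `C * n`, and register `1` then holds the address of a
Line-Leaf Tree of `S`. -/
def BuildsLineLeafTrees.{u} (P : Program) (C : ℕ) : Prop :=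
  ∀ (S : Type u) [PartialOrder S], TreeLike S →
    ∀ (e : S ≃ Fin (Nat.card S)) (L : List (S × S)), IsEdgeList L →
      ∃ (t : ℕ) (c : Config) (T : SearchTree S),
        Exec (C * Nat.card S) P (input (Nat.card S) (fun x => (e x : ℕ)) L) t c ∧
        t ≤ C * Nat.card S ∧
        IsLineLeafTree T ∧
        StoredAt (fun x => (e x : ℕ)) c.mem (c.reg 1) T

end LineLeaf

/-! ### Trees, lines and the stages of the contraction. -/

namespace LineLeaf

/-! ## Trees on a set of live nodes -/

/-! (a) Two lower bounds on OPT carry the estimate. A ternary tree of height `h` has at most `3 ^ h`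
leaves, so `n ≤ 3 ^ OPT` (`TreeLike.card_le`). Moreover the answer to a query changes across at most
two edges of the Hasse diagram, so each query on the search path of `x` separates `x` from at most
two of its neighbours, whence `deg x ≤ 2 * OPT` (`TreeLike.deg_le`). A height-balanced tree over a
path has height at most `2 * log₂ n ≤ 4 * OPT`, a leaf contraction adds at most the maximal degree,
and degrees never grow: one iteration raises all attached trees by at most `6 * OPT`. A line
contraction leaves no nodes of degree two, so a node that becomes a leaf in the following leaf
contraction has just absorbed at least two leaves; the number of leaves is therefore at least
halved. Initially it is at most `w + 1`, because the leaves other than the least element form an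
antichain. So there are at most `2 + log₂ w` iterations (`exists_iterations_bound`).

(b) Take a chain of nodes `c_k, …, c_0` where `c_(j+1)` has, besides the child `c_j`, the roots of
`d` complete binary trees as children, and these roots are contracted one iteration later than
`c_j`. No nodes of degree two ever arise before the end, and the nodes disappear in the order of
their `rank`. The `d` queries for the binary trees are put in front of the query that leads to the
tree of `c_j`, so every link of the chain adds at least `d` and the height is at least `k * d`
(`Node.mul_le_height`). Asking for the chain edge before the other edges pays for the `d` siblings
only once, so OPT is at most `d + 5 * k` (`Node.opt_le`). For `d = k` the height is at least `k ^
2`, while OPT and `log₂ w ≤ log₂ n ≤ 2 * OPT` are both linear in `k`.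

(c) An iteration takes time and space linear in the number `m` of present edges. Lines are followed
from their ends, and the walks use pairwise different darts, hence have total length at most `2 *
m`; the balanced trees get the shape of a binary heap and are built bottom-up. In a tree without
nodes of degree two more than half of the nodes are leaves, so an iteration at least halves the
number of nodes (`ncard_iteration`) and the costs form a geometric series. Correctness and cost are
derived together, by weakest preconditions for commands on disjoint arrays that also count steps
(`Cmd.exec_of_vc`). -/

/-- `G` is a tree on the nodes in `live`, and the other nodes are isolated. -/
structure TreeOn {S : Type*} (live : Set S) (G : SimpleGraph S) : Prop where
  acyclic : G.IsAcyclic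
  left_mem : ∀ {x y}, G.Adj x y → x ∈ live
  reachable : ∀ {x y}, x ∈ live → y ∈ live → G.Reachable x y
  nonempty : live.Nonempty

section Degree

variable {S : Type*} {G : SimpleGraph S}

theorem deg_eq_degree [Fintype S] [DecidableRel G.Adj] (x : S) : deg G x = G.degree x := by
  rw [deg, Set.ncard_eq_toFinset_card', ← SimpleGraph.card_neighborSet_eq_degree,
    Set.toFinset_card]

theorem deg_pos_iff [Finite S] {x : S} : 0 < deg G x ↔ ∃ y, G.Adj x y := by
  rw [deg, Set.ncard_pos]; rfl

/-- A node of degree two has no three pairwise different neighbours. -/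
theorem eq_of_deg_two {v a b c : S} (h : deg G v = 2) (ha : G.Adj v a) (hb : G.Adj v b)
    (hc : G.Adj v c) (hab : a ≠ b) (hcb : c ≠ b) : a = c := by
  obtain ⟨p, q, hpq, hs⟩ := Set.ncard_eq_two.1 h
  have ha' : a ∈ G.neighborSet v := ha
  have hb' : b ∈ G.neighborSet v := hb
  have hc' : c ∈ G.neighborSet v := hc
  rw [hs] at ha' hb' hc'
  simp only [Set.mem_insert_iff, Set.mem_singleton_iff] at ha' hb' hc'
  grind

theorem exists_other_of_deg_two {v b : S} (h : deg G v = 2) (hb : G.Adj v b) :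
    ∃ w, G.Adj v w ∧ w ≠ b := by
  obtain ⟨p, q, hpq, hs⟩ := Set.ncard_eq_two.1 h
  have hp : p ∈ G.neighborSet v := by rw [hs]; simp
  have hq : q ∈ G.neighborSet v := by rw [hs]; simp
  by_cases hpb : p = b
  · exact ⟨q, hq, by rintro rfl; exact hpq hpb⟩
  · exact ⟨p, hp, hpb⟩

theorem two_le_deg [Finite S] {v a b : S} (ha : G.Adj v a) (hb : G.Adj v b) (hab : a ≠ b) :
    2 ≤ deg G v := by
  rw [← Set.ncard_pair hab]
  exact Set.ncard_le_ncard (by rintro x (rfl | rfl) <;> assumption)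

theorem eq_of_deg_one {v a b : S} (h : deg G v = 1) (ha : G.Adj v a) (hb : G.Adj v b) : a = b := by
  obtain ⟨p, hs⟩ := Set.ncard_eq_one.1 h
  have ha' : a ∈ G.neighborSet v := ha
  have hb' : b ∈ G.neighborSet v := hb
  rw [hs] at ha' hb'
  exact ha'.trans hb'.symm

theorem two_le_deg_of_interior [Finite S] {x y z : S} {p : G.Walk x y} (hp : p.IsPath)
    (hz : z ∈ p.support) (hx : z ≠ x) (hy : z ≠ y) : 2 ≤ deg G z := by
  obtain ⟨i, rfl, hi⟩ := SimpleGraph.Walk.mem_support_iff_exists_getVert.1 hz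
  have h0 : i ≠ 0 := by rintro rfl; simp at hx
  have hl : i ≠ p.length := by rintro rfl; simp at hy
  have h1 : G.Adj (p.getVert i) (p.getVert (i + 1)) := p.adj_getVert_succ (by omega)
  have h2 : G.Adj (p.getVert (i - 1)) (p.getVert i) := by
    have := p.adj_getVert_succ (i := i - 1) (by omega)
    rwa [Nat.sub_add_cancel (by omega)] at this
  refine two_le_deg h1 h2.symm fun h => ?_
  have := hp.getVert_injOn (by simp; omega) (by simp; omega) h
  omega

end Degree

namespace TreeOn

variable {S : Type*} {live : Set S} {G : SimpleGraph S}

theorem right_mem (h : TreeOn live G) {x y : S} (hxy : G.Adj x y) : y ∈ live := h.left_mem hxy.symm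

theorem path_unique (h : TreeOn live G) {x y : S} {p q : G.Walk x y} (hp : p.IsPath)
    (hq : q.IsPath) : p = q :=
  congrArg Subtype.val ((SimpleGraph.isAcyclic_iff_subsingleton_path.1 h.acyclic x y).elim
    ⟨p, hp⟩ ⟨q, hq⟩)

theorem support_subset (h : TreeOn live G) {x y : S} (hx : x ∈ live) (p : G.Walk x y) :
    ∀ z ∈ p.support, z ∈ live := by
  induction p with
  | nil => simpa using hx
  | cons hadj p ih =>
    intro z hz
    rcases List.mem_cons.1 (by simpa using hz) with rfl | hz
    · exact hx
    · exact ih (h.right_mem hadj) z hz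

theorem isTree_induce (h : TreeOn live G) : (G.induce live).IsTree := by
  have := h.nonempty.to_subtype
  refine ⟨⟨fun x y => ?_⟩, h.acyclic.induce live⟩
  obtain ⟨p⟩ := h.reachable x.2 y.2
  exact ⟨p.induce live (h.support_subset x.2 p)⟩

theorem deg_induce (h : TreeOn live G) (x : live) : deg (G.induce live) x = deg G x := by
  have : G.neighborSet x = Subtype.val '' (G.induce live).neighborSet x := by
    ext y
    constructor
    · intro hy
      exact ⟨⟨y, h.right_mem hy⟩, hy, rfl⟩
    · rintro ⟨y, hy, rfl⟩
      exact hy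
  rw [deg, deg, this, Set.ncard_image_of_injective _ Subtype.val_injective]

theorem deg_eq_zero (h : TreeOn live G) [Finite S] {x : S} (hx : x ∉ live) : deg G x = 0 := by
  by_contra h0
  obtain ⟨y, hy⟩ := deg_pos_iff.1 (Nat.pos_of_ne_zero h0)
  exact hx (h.left_mem hy)

theorem deg_pos (h : TreeOn live G) [Finite S] (hn : live.Nontrivial) {x : S} (hx : x ∈ live) :
    0 < deg G x := by
  obtain ⟨y, hy, hne⟩ := hn.exists_ne x
  obtain ⟨p⟩ := h.reachable hx hy
  cases p with
  | nil => exact absurd rfl hne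
  | cons hadj p => exact deg_pos_iff.2 ⟨_, hadj⟩

-- Handshake lemma together with the edge count of a tree; the summand 2 stands on the left to avoid
-- truncated subtraction.
open Classical in
theorem sum_deg (h : TreeOn live G) [Fintype S] :
    ∑ x ∈ live.toFinset, deg G x + 2 = 2 * live.ncard := by
  have h1 := (G.induce live).sum_degrees_eq_twice_card_edges
  have h2 := h.isTree_induce.card_edgeFinset
  have h3 : ∑ x ∈ live.toFinset, deg G x = ∑ x : live, (G.induce live).degree x := by
    rw [Finset.sum_subtype (p := fun x => x ∈ live) live.toFinset (by simp) (fun x => deg G x)]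
    exact Finset.sum_congr (by congr) fun x _ => by rw [← h.deg_induce, deg_eq_degree]
  have h4 : Fintype.card live = live.ncard := (Set.ncard_eq_toFinset_card' live).symm ▸
    (Set.toFinset_card live).symm
  rw [h3, h1, ← h4, ← h2]
  ring

theorem card_edges (h : TreeOn live G) [Finite S] :
    G.edgeSet.ncard + 1 = live.ncard := by
  classical
  have := Fintype.ofFinite S
  have h1 := G.sum_degrees_eq_twice_card_edges
  have h2 := h.sum_deg
  have h3 : ∑ x ∈ live.toFinset, deg G x = ∑ x, G.degree x := by
    rw [← Finset.sum_subset (Finset.subset_univ live.toFinset)]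
    · exact Finset.sum_congr rfl fun x _ => deg_eq_degree x
    · intro x _ hx
      rw [← deg_eq_degree, h.deg_eq_zero (by simpa using hx)]
  have h4 : G.edgeSet.ncard = G.edgeFinset.card := by
    rw [Set.ncard_eq_toFinset_card', SimpleGraph.edgeFinset]
  omega

/-- Otherwise all degrees are at least two, but by `sum_deg` the average degree is below two. -/
theorem exists_deg_one (h : TreeOn live G) [Finite S] (hn : live.Nontrivial) :
    ∃ x ∈ live, deg G x = 1 := by
  classical
  have := Fintype.ofFinite S
  by_contra hc
  push Not at hc
  have h1 := h.sum_deg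
  have h2 : ∑ x ∈ live.toFinset, 2 ≤ ∑ x ∈ live.toFinset, deg G x := by
    refine Finset.sum_le_sum fun x hx => ?_
    have hx := Set.mem_toFinset.1 hx
    have := h.deg_pos hn hx
    have := hc x hx
    omega
  rw [Finset.sum_const, smul_eq_mul, ← Set.ncard_eq_toFinset_card'] at h2
  omega

/-- In a tree without nodes of degree two most nodes are leaves. -/
theorem internal_add_two_le (h : TreeOn live G) [Finite S] (hn : live.Nontrivial)
    (h2 : ∀ x ∈ live, deg G x ≠ 2) :
    {x ∈ live | deg G x ≠ 1}.ncard + 2 ≤ {x ∈ live | deg G x = 1}.ncard := by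
  classical
  have := Fintype.ofFinite S
  have h1 := h.sum_deg
  have h3 := Finset.sum_filter_add_sum_filter_not live.toFinset (fun x => deg G x = 1) (deg G)
  have h4 := Finset.card_filter_add_card_filter_not (s := live.toFinset) (fun x => deg G x = 1)
  have h5 : ∑ x ∈ live.toFinset.filter (fun x => deg G x = 1), deg G x =
      (live.toFinset.filter (fun x => deg G x = 1)).card := by
    rw [Finset.card_eq_sum_ones]
    exact Finset.sum_congr rfl fun x hx => (Finset.mem_filter.1 hx).2
  -- The remaining nodes have degree at least three, so `I` internal nodes and `L` leaves satisfy `3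
  -- I + L ≤ 2 (I + L) - 2`.
  have h6 : (live.toFinset.filter (fun x => ¬ deg G x = 1)).card * 3 ≤
      ∑ x ∈ live.toFinset.filter (fun x => ¬ deg G x = 1), deg G x := by
    rw [← smul_eq_mul, ← Finset.sum_const]
    refine Finset.sum_le_sum fun x hx => ?_
    have hx := Finset.mem_filter.1 hx
    have hl := Set.mem_toFinset.1 hx.1
    have := h.deg_pos hn hl
    have := h2 x hl
    omega
  have h7 : {x ∈ live | deg G x ≠ 1}.ncard =
      (live.toFinset.filter (fun x => ¬ deg G x = 1)).card := by
    rw [← Set.ncard_coe_finset]; congr 1; ext; simp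
  have h8 : {x ∈ live | deg G x = 1}.ncard =
      (live.toFinset.filter (fun x => deg G x = 1)).card := by
    rw [← Set.ncard_coe_finset]; congr 1; ext; simp
  rw [Set.ncard_eq_toFinset_card'] at h1
  omega

/-- Every walk in a tree contains the edges of the path between its ends. -/
theorem edges_subset (h : TreeOn live G) {x y : S} {p : G.Walk x y} (hp : p.IsPath)
    (q : G.Walk x y) : p.edges ⊆ q.edges := by
  classical
  have : p = q.bypass := h.path_unique hp q.bypass_isPath
  rw [this]
  exact q.edges_bypass_subset_edges

/-- A path of a tree can be prolonged by any neighbour of its end other than the last but one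
node. -/
theorem isPath_concat (h : TreeOn live G) {x v w : S} {p : G.Walk x v} (hp : p.IsPath)
    (hvw : G.Adj v w) (hw : w ≠ p.penultimate) : (p.concat hvw).IsPath :=
  hp.concat (fun hmem => hw (h.acyclic.eq_penultimate_of_adj_end hp hvw hmem)) hvw

end TreeOn

theorem TreeLike.treeOn {S : Type*} [PartialOrder S] (h : TreeLike S) :
    TreeOn Set.univ (SimpleGraph.hasse S) where
  acyclic := h.isTree.isAcyclic
  left_mem _ := Set.mem_univ _
  reachable _ _ := h.isTree.connected.preconnected _ _
  nonempty := h.exists_least.imp fun _ _ => Set.mem_univ _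

end LineLeaf
namespace LineLeaf

/-! ## Lines -/

section Lines

variable {S : Type*} {live : Set S} {G : SimpleGraph S}

namespace IsLine

variable {x y : S} {p : G.Walk x y}

theorem length_pos (h : IsLine G p) : 0 < p.length := by
  rcases Nat.eq_zero_or_pos p.length with h0 | h0
  · exact absurd (SimpleGraph.Walk.eq_of_length_eq_zero h0) h.2.1
  · exact h0

theorem adj_snd (h : IsLine G p) : G.Adj x p.snd := by
  have := p.adj_getVert_succ h.length_pos
  simpa using this

theorem reverse (h : IsLine G p) : IsLine G p.reverse :=
  ⟨h.1.reverse, h.2.1.symm, h.2.2.2.1, h.2.2.1, fun z hz h1 h2 =>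
    h.2.2.2.2 z (by simpa using hz) h2 h1⟩

theorem deg_getVert (h : IsLine G p) {i : ℕ} (h0 : 0 < i) (hl : i < p.length) :
    deg G (p.getVert i) = 2 := by
  refine h.2.2.2.2 _ (p.getVert_mem_support i) (fun h1 => ?_) (fun h1 => ?_)
  · rw [h.1.getVert_eq_start_iff hl.le] at h1; omega
  · rw [h.1.getVert_eq_end_iff hl.le] at h1; omega

/-- A line can be followed backwards to its start from each of its darts. -/
theorem start_eq {x' y' : S} {q : G.Walk x' y'} (hp : IsLine G p) (hq : IsLine G q) :
    ∀ {i j : ℕ}, i < p.length → j < q.length → p.getVert i = q.getVert j →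
      p.getVert (i + 1) = q.getVert (j + 1) → i = j ∧ x = x' := by
  intro i
  induction i with
  | zero =>
    intro j _ hj h1 _
    -- For positive `j` the common node would be interior to `q` and have degree two, but it is the
    -- start of the line `p`.
    rcases Nat.eq_zero_or_pos j with rfl | h0
    · exact ⟨rfl, by simpa using h1⟩
    · have := hq.deg_getVert h0 hj
      rw [← h1] at this
      exact absurd (by simpa using this) hp.2.2.1
  | succ i ih =>
    intro j hi hj h1 h2
    have hd := hp.deg_getVert (Nat.succ_pos i) hi
    rcases j with _ | j
    · rw [h1] at hd
      exact absurd (by simpa using hd) hq.2.2.1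
    · have ha : G.Adj (p.getVert (i + 1)) (p.getVert i) := (p.adj_getVert_succ (by omega)).symm
      have hb : G.Adj (p.getVert (i + 1)) (p.getVert (i + 2)) := p.adj_getVert_succ hi
      have hc : G.Adj (p.getVert (i + 1)) (q.getVert j) := by
        rw [h1]; exact (q.adj_getVert_succ (by omega)).symm
      have hab : p.getVert i ≠ p.getVert (i + 2) := fun h => by
        have := hp.1.getVert_injOn (by simp; omega) (by simp; omega) h
        omega
      have hcb : q.getVert j ≠ p.getVert (i + 2) := fun h => by
        rw [h2] at h
        have := hq.1.getVert_injOn (by simp; omega) (by simp; omega) h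
        omega
      -- At a node of degree two the successor determines the predecessor, so the two lines also
      -- agree one dart earlier.
      obtain ⟨h3, h4⟩ := ih (by omega) (by omega) (eq_of_deg_two hd ha hb hc hab hcb) h1
      exact ⟨by omega, h4⟩

theorem end_eq {x' y' : S} {q : G.Walk x' y'} (hp : IsLine G p) (hq : IsLine G q)
    {i j : ℕ} (hi : i < p.length) (hj : j < q.length) (h1 : p.getVert i = q.getVert j)
    (h2 : p.getVert (i + 1) = q.getVert (j + 1)) : y = y' := by
  refine (hp.reverse.start_eq hq.reverse (i := p.length - (i + 1)) (j := q.length - (j + 1))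
    (by simp; omega) (by simp; omega) ?_ ?_).2
  · rw [SimpleGraph.Walk.getVert_reverse, SimpleGraph.Walk.getVert_reverse]
    convert h2 using 2 <;> omega
  · rw [SimpleGraph.Walk.getVert_reverse, SimpleGraph.Walk.getVert_reverse]
    convert h1 using 2 <;> omega

theorem end_eq_of_snd_eq {y' : S} {q : G.Walk x y'} (hp : IsLine G p) (hq : IsLine G q)
    (h : p.snd = q.snd) : y = y' :=
  hp.end_eq hq hp.length_pos hq.length_pos (by simp) h

theorem mem_live (h : IsLine G p) (ht : TreeOn live G) : x ∈ live := ht.left_mem h.adj_snd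

end IsLine

/-- A path through nodes of degree two that has not yet reached its end can be prolonged. -/
theorem TreeOn.exists_concat (h : TreeOn live G) {x v : S} {p : G.Walk x v} (hp : p.IsPath)
    (hl : 0 < p.length) (hv : deg G v = 2) :
    ∃ (w : S) (hw : G.Adj v w), w ≠ p.penultimate ∧ (p.concat hw).IsPath := by
  have hn : ¬ p.Nil := by rw [← SimpleGraph.Walk.length_eq_zero_iff]; omega
  obtain ⟨w, hw, hne⟩ := exists_other_of_deg_two hv (p.adj_penultimate hn).symm
  exact ⟨w, hw, hne, h.isPath_concat hp hw hne⟩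

/-- Interior nodes of `p` have degree two. -/
def InteriorTwo {x v : S} (p : G.Walk x v) : Prop :=
  ∀ z ∈ p.support, z ≠ x → z ≠ v → deg G z = 2

theorem InteriorTwo.concat {x v w : S} {p : G.Walk x v} (h : InteriorTwo p) (hv : deg G v = 2)
    (hw : G.Adj v w) : InteriorTwo (p.concat hw) := by
  intro z hz hx hzw
  rw [SimpleGraph.Walk.support_concat, List.mem_append, List.mem_singleton] at hz
  rcases hz with hz | rfl
  · by_cases hzv : z = v
    · exact hzv ▸ hv
    · exact h z hz hx hzv
  · exact absurd rfl hzw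

theorem snd_concat {x v w : S} {p : G.Walk x v} (hl : 0 < p.length) (hw : G.Adj v w) :
    (p.concat hw).snd = p.snd := by
  cases p with
  | nil => simp at hl
  | cons h p => simp [SimpleGraph.Walk.concat_cons]

theorem isLine_of_interiorTwo {x v : S} {p : G.Walk x v} (hp : p.IsPath) (hl : 0 < p.length)
    (hi : InteriorTwo p) (hx : deg G x ≠ 2) (hv : deg G v ≠ 2) : IsLine G p := by
  refine ⟨hp, ?_, hx, hv, hi⟩
  rintro rfl
  rw [SimpleGraph.Walk.isPath_iff_nil.1 hp |>.length_eq_zero] at hl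
  exact lt_irrefl _ hl

/-- Starting with the edge `x b`, the path is prolonged as long as its end has degree two. It never
repeats a node, so this stops; `k` counts the prolongations still possible. -/
theorem TreeOn.exists_line (h : TreeOn live G) [Finite S] {x b : S} (hx : deg G x ≠ 2)
    (hb : G.Adj x b) : ∃ (y : S) (p : G.Walk x y), IsLine G p ∧ p.snd = b := by
  classical
  have := Fintype.ofFinite S
  have key : ∀ (k : ℕ) (v : S) (p : G.Walk x v), p.IsPath → 0 < p.length → InteriorTwo p →
      p.snd = b → Fintype.card S ≤ p.length + k →
      ∃ (y : S) (p : G.Walk x y), IsLine G p ∧ p.snd = b := by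
    intro k
    induction k with
    | zero => intro v p hp _ _ _ hk; exact absurd hp.length_lt (by omega)
    | succ k ih =>
      intro v p hp hl hi hs hk
      by_cases hv : deg G v = 2
      · obtain ⟨w, hw, _, hc⟩ := h.exists_concat hp hl hv
        exact ih w (p.concat hw) hc (by simp) (hi.concat hv hw) (by rw [snd_concat hl, hs])
          (by rw [SimpleGraph.Walk.length_concat]; omega)
      · exact ⟨v, p, isLine_of_interiorTwo hp hl hi hx hv, hs⟩
  refine key (Fintype.card S) b hb.toWalk ?_ (by simp) ?_ (by simp) (by omega)
  · simp [hb.ne]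
  · intro z hz h1 h2
    simp at hz
    tauto

/-- The graph after a line contraction. -/
def lineGraph (G : SimpleGraph S) : SimpleGraph S where
  Adj x y := ∃ p : G.Walk x y, IsLine G p
  symm := ⟨fun _ _ ⟨p, hp⟩ => ⟨p.reverse, hp.reverse⟩⟩
  loopless := ⟨fun _ ⟨_, hp⟩ => hp.2.1 rfl⟩

theorem lineGraph_adj {x y : S} : (lineGraph G).Adj x y ↔ ∃ p : G.Walk x y, IsLine G p := Iff.rfl

/-- Neighbours `y` in the line graph correspond to neighbours `b` in `G`, where `b` is the second
node of the line from `x` to `y`: a line is determined by its first dart, and every dart at `x`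
starts a line. -/
theorem TreeOn.deg_lineGraph (h : TreeOn live G) [Finite S] {x : S} (hx : deg G x ≠ 2) :
    deg (lineGraph G) x = deg G x := by
  refine Set.ncard_congr (fun y hy => (Classical.choose (lineGraph_adj.1 hy)).snd) ?_ ?_ ?_
  · intro y hy
    exact (Classical.choose_spec (lineGraph_adj.1 hy)).adj_snd
  · intro y z hy hz hyz
    exact (Classical.choose_spec (lineGraph_adj.1 hy)).end_eq_of_snd_eq
      (Classical.choose_spec (lineGraph_adj.1 hz)) hyz
  · intro b hb
    obtain ⟨y, p, hp, rfl⟩ := h.exists_line hx hb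
    have hy : (lineGraph G).Adj x y := ⟨p, hp⟩
    refine ⟨y, hy, ?_⟩
    rw [h.path_unique (Classical.choose_spec (lineGraph_adj.1 hy)).1 hp.1]

theorem deg_lineGraph_of_two {x : S} (hx : deg G x = 2) : deg (lineGraph G) x = 0 := by
  have : (lineGraph G).neighborSet x = ∅ := by
    ext y
    simp only [Set.mem_empty_iff_false, iff_false]
    rintro ⟨p, hp⟩
    exact hp.2.2.1 hx
  rw [deg, this, Set.ncard_empty]

/-- A path from a node of degree other than two to another such node starts with a line. -/
theorem IsLine.getVert_eq {x y z : S} {q : G.Walk x z} (hq : IsLine G q) {p : G.Walk x y}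
    (hp : p.IsPath) (hy : deg G y ≠ 2) (hs : q.snd = p.snd) (hl : 0 < p.length) :
    ∀ i ≤ q.length, i ≤ p.length ∧ q.getVert i = p.getVert i := by
  have key : ∀ i < q.length, (i ≤ p.length ∧ q.getVert i = p.getVert i) ∧
      (i + 1 ≤ p.length ∧ q.getVert (i + 1) = p.getVert (i + 1)) := by
    intro i
    induction i with
    | zero => exact fun _ => ⟨⟨by omega, by simp⟩, by omega, hs⟩
    | succ i ih =>
      intro hi
      obtain ⟨⟨_, h1⟩, h2, h3⟩ := ih (by omega)
      have hd := hq.deg_getVert (Nat.succ_pos i) hi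
      have hne : i + 1 ≠ p.length := fun h => by
        rw [h3, h, SimpleGraph.Walk.getVert_length] at hd
        exact hy hd
      refine ⟨⟨h2, h3⟩, by omega, ?_⟩
      refine eq_of_deg_two (b := q.getVert i) hd (q.adj_getVert_succ hi)
        (q.adj_getVert_succ (by omega)).symm ?_ ?_ ?_
      · rw [h3]; exact p.adj_getVert_succ (by omega)
      · intro h
        have := hq.1.getVert_injOn (by simp; omega) (by simp; omega) h
        omega
      · rw [h1]
        intro h
        have := hp.getVert_injOn (by simp; omega) (by simp; omega) h
        omega
  intro i hi
  rcases i with _ | i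
  · simp
  · exact (key i (by omega)).2

/-- The first edge of the path starts a line, which is an initial segment of the path because `y`
does not have degree two. This line is one step in the line graph, and the rest of the path is
shorter. -/
theorem TreeOn.lineGraph_reachable (h : TreeOn live G) [Finite S] {y : S} (hy : deg G y ≠ 2) :
    ∀ (k : ℕ) (x : S) (p : G.Walk x y), p.IsPath → p.length ≤ k → deg G x ≠ 2 →
      (lineGraph G).Reachable x y := by
  classical
  intro k
  induction k with
  | zero =>
    intro x p _ hk _
    rw [SimpleGraph.Walk.eq_of_length_eq_zero (Nat.le_zero.1 hk)]
  | succ k ih =>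
    intro x p hp hk hx
    rcases Nat.eq_zero_or_pos p.length with h0 | h0
    · rw [SimpleGraph.Walk.eq_of_length_eq_zero h0]
    · have hadj : G.Adj x p.snd := by simpa using p.adj_getVert_succ h0
      obtain ⟨z, q, hq, hs⟩ := h.exists_line hx hadj
      obtain ⟨h1, h2⟩ := hq.getVert_eq hp hy hs h0 q.length le_rfl
      rw [SimpleGraph.Walk.getVert_length] at h2
      refine (SimpleGraph.Adj.reachable (show (lineGraph G).Adj x z from ⟨q, hq⟩)).trans ?_
      have hl := hq.length_pos
      refine ih z ((p.drop q.length).copy h2.symm rfl) ?_ ?_ hq.2.2.2.1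
      · rw [SimpleGraph.Walk.isPath_copy]; exact hp.drop _
      · rw [SimpleGraph.Walk.length_copy, SimpleGraph.Walk.drop_length]; omega

/-- A walk along lines can be traced in the original graph. -/
theorem exists_walk_of_lineGraph {u v : S} (P : (lineGraph G).Walk u v) :
    ∃ W : G.Walk u v, ∀ e ∈ W.edges, ∃ (a b : S) (r : G.Walk a b), IsLine G r ∧
      s(a, b) ∈ P.edges ∧ e ∈ r.edges := by
  induction P with
  | nil => exact ⟨SimpleGraph.Walk.nil, by simp⟩
  | @cons u w v hadj P ih =>
    obtain ⟨W, hW⟩ := ih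
    obtain ⟨r, hr⟩ := lineGraph_adj.1 hadj
    refine ⟨r.append W, fun e he => ?_⟩
    rw [SimpleGraph.Walk.edges_append, List.mem_append] at he
    rcases he with he | he
    · exact ⟨u, w, r, hr, by simp, he⟩
    · obtain ⟨a, b, r', h1, h2, h3⟩ := hW e he
      exact ⟨a, b, r', h1, by simp [h2], h3⟩

theorem mem_edges_snd {x y : S} {p : G.Walk x y} (hl : 0 < p.length) : s(x, p.snd) ∈ p.edges := by
  cases p with
  | nil => simp at hl
  | cons h p => simp

/-- Every edge is a bridge. A walk from `x` to `y` along lines traces a walk in `G`, which must use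
the first edge of the line `p`. The end `x` of that edge is not of degree two, so a line containing
the edge starts or ends at `x`, and it coincides with `p` up to direction. -/
theorem TreeOn.lineGraph_acyclic (h : TreeOn live G) : (lineGraph G).IsAcyclic := by
  rw [SimpleGraph.isAcyclic_iff_forall_adj_isBridge]
  rintro x y ⟨p, hp⟩
  rw [SimpleGraph.isBridge_iff_forall_walk_mem_edges]
  intro P
  obtain ⟨W, hW⟩ := exists_walk_of_lineGraph P
  obtain ⟨a, b, r, hr, h1, h2⟩ := hW _ (h.edges_subset hp.1 W (mem_edges_snd hp.length_pos))
  have hx : x ∈ r.support := r.fst_mem_support_of_mem_edges h2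
  have hs : p.snd ∈ r.support := r.snd_mem_support_of_mem_edges h2
  by_cases hxa : x = a
  · subst hxa
    have := hp.end_eq_of_snd_eq hr (h.acyclic.eq_snd_of_adj_start hr.1 hp.adj_snd hs)
    have h3 : s(x, y) = s(x, b) := by rw [this]
    exact h3 ▸ h1
  · by_cases hxb : x = b
    · subst hxb
      have := hp.end_eq_of_snd_eq hr.reverse
        (h.acyclic.eq_snd_of_adj_start hr.reverse.1 hp.adj_snd (by simpa using hs))
      have h3 : s(x, y) = s(a, x) := by rw [this, Sym2.eq_swap]
      exact h3 ▸ h1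
    · exact absurd (hr.2.2.2.2 x hx hxa hxb) hp.2.2.1

theorem TreeOn.treeOn_lineGraph (h : TreeOn live G) [Finite S] :
    TreeOn {x ∈ live | deg G x ≠ 2} (lineGraph G) where
  acyclic := h.lineGraph_acyclic
  left_mem := by
    rintro x y ⟨p, hp⟩
    exact ⟨hp.mem_live h, hp.2.2.1⟩
  reachable := by
    classical
    intro x y hx hy
    obtain ⟨p⟩ := h.reachable hx.1 hy.1
    exact h.lineGraph_reachable hy.2 _ x p.bypass p.bypass_isPath le_rfl hx.2
  nonempty := by
    by_cases hn : live.Nontrivial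
    · obtain ⟨x, hx, h1⟩ := h.exists_deg_one hn
      exact ⟨x, hx, by omega⟩
    · obtain ⟨x, hx⟩ := h.nonempty
      refine ⟨x, hx, fun h2 => hn ?_⟩
      obtain ⟨y, hy⟩ := deg_pos_iff.1 (by omega : 0 < deg G x)
      exact ⟨x, hx, y, h.right_mem hy, hy.ne⟩

theorem TreeOn.deg_lineGraph_ne_two (h : TreeOn live G) [Finite S] (x : S) :
    deg (lineGraph G) x ≠ 2 := by
  by_cases hx : deg G x = 2
  · rw [deg_lineGraph_of_two hx]; omega
  · rwa [h.deg_lineGraph hx]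

/-- Removing leaves, at least one node being kept, leaves a tree. -/
theorem TreeOn.of_removeLeaves (h : TreeOn live G) [Finite S] {live' : Set S} {G' : SimpleGraph S}
    (hsub : live' ⊆ live) (hne : live'.Nonempty) (hdeg : ∀ x ∈ live, x ∉ live' → deg G x = 1)
    (hadj : ∀ x y, G'.Adj x y ↔ G.Adj x y ∧ x ∈ live' ∧ y ∈ live') : TreeOn live' G' where
  acyclic := h.acyclic.anti fun x y hxy => ((hadj x y).1 hxy).1
  left_mem hxy := ((hadj _ _).1 hxy).2.1
  reachable := by
    classical
    intro x y hx hy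
    obtain ⟨q⟩ := h.reachable (hsub hx) (hsub hy)
    have hp := q.bypass_isPath
    set p := q.bypass
    -- Interior nodes of a path have degree at least two, so none of them is a removed leaf.
    have hs : ∀ z ∈ p.support, z ∈ live' := by
      intro z hz
      by_contra hc
      have h1 := hdeg z (h.support_subset (hsub hx) p z hz) hc
      have h2 := two_le_deg_of_interior hp hz (by rintro rfl; exact hc hx)
        (by rintro rfl; exact hc hy)
      omega
    refine ⟨p.transfer G' fun e he => ?_⟩
    induction e with
    | h a b =>
      rw [SimpleGraph.mem_edgeSet, hadj]
      exact ⟨p.adj_of_mem_edges he, hs _ (p.fst_mem_support_of_mem_edges he),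
        hs _ (p.snd_mem_support_of_mem_edges he)⟩
  nonempty := hne

end Lines

/-! ## The stages of the contraction -/

section Stages

variable {S : Type*} {st st' : Stage S}

theorem LineContraction.graph_eq (hc : LineContraction st st') : st'.graph = lineGraph st.graph := by
  ext x y
  rw [hc.adj_iff, lineGraph_adj]

theorem LineContraction.treeOn [Finite S] (hc : LineContraction st st')
    (h : TreeOn st.live st.graph) : TreeOn st'.live st'.graph := by
  rw [hc.graph_eq, hc.live_eq]
  exact h.treeOn_lineGraph

theorem LeafContraction.live_subset (hc : LeafContraction st st') : st'.live ⊆ st.live := by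
  by_cases hne : {x ∈ st.live | deg st.graph x ≠ 1}.Nonempty
  · rw [hc.live_eq hne]
    exact fun x hx => hx.1
  · obtain ⟨r, hr, h1⟩ := hc.live_root hne
    rw [h1]
    rintro x rfl
    exact hr

theorem LeafContraction.deg_eq_one (hc : LeafContraction st st') {x : S} (hx : x ∈ st.live)
    (hx' : x ∉ st'.live) : deg st.graph x = 1 := by
  by_contra h1
  have hne : {x ∈ st.live | deg st.graph x ≠ 1}.Nonempty := ⟨x, hx, h1⟩
  rw [hc.live_eq hne] at hx'
  exact hx' ⟨hx, h1⟩

theorem LeafContraction.treeOn [Finite S] (hc : LeafContraction st st')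
    (h : TreeOn st.live st.graph) : TreeOn st'.live st'.graph := by
  refine h.of_removeLeaves hc.live_subset ?_ (fun x hx hx' => hc.deg_eq_one hx hx') hc.adj_iff
  by_cases hne : {x ∈ st.live | deg st.graph x ≠ 1}.Nonempty
  · rw [hc.live_eq hne]
    exact hne
  · obtain ⟨r, _, h1⟩ := hc.live_root hne
    rw [h1]
    exact Set.singleton_nonempty r

theorem Iteration.treeOn [Finite S] (hc : Iteration st st')
    (h : TreeOn st.live st.graph) : TreeOn st'.live st'.graph := by
  obtain ⟨_, st₁, h1, h2⟩ := hc
  exact h2.treeOn (h1.treeOn h)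

end Stages

end LineLeaf
-- Statement (a): lower bounds for OPT and the upper bound for Line-Leaf Trees.
namespace LineLeaf

/-! ## Lower bounds on the height of search trees -/

section SearchTrees

variable {S : Type*} [PartialOrder S]

/-- An edge query only distinguishes the two ends of two edges. -/
theorem TreeLike.exists_edges_answer_eq (hS : TreeLike S) (a b : S) : ∃ e₁ e₂ : Sym2 S,
    ∀ u v, (SimpleGraph.hasse S).Adj u v → s(u, v) ≠ e₁ → s(u, v) ≠ e₂ →
      answer a b u = answer a b v := by
  obtain ⟨p, hp, huniq⟩ := hS.isTree.existsUnique_path a b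
  have step : ∀ {E : Set (Sym2 S)} {c u v : S}, (SimpleGraph.hasse S).Adj u v → s(u, v) ∉ E →
      (((SimpleGraph.hasse S).deleteEdges E).Reachable c u ↔
        ((SimpleGraph.hasse S).deleteEdges E).Reachable c v) := by
    intro E c u v huv hE
    have hadj : ((SimpleGraph.hasse S).deleteEdges E).Adj u v :=
      (SimpleGraph.deleteEdges_adj).2 ⟨huv, hE⟩
    exact ⟨fun h => h.trans hadj.reachable, fun h => h.trans hadj.symm.reachable⟩
  have h1 : ∀ u, OnSideOf a b u ↔ ((SimpleGraph.hasse S).deleteEdges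
      {s(a, p.snd), s(p.penultimate, b)}).Reachable a u := by
    intro u
    constructor
    · rintro ⟨q, hq, h⟩
      rwa [huniq q hq] at h
    · exact fun h => ⟨p, hp, h⟩
  have h2 : ∀ u, OnSideOf b a u ↔ ((SimpleGraph.hasse S).deleteEdges
      {s(b, p.reverse.snd), s(p.reverse.penultimate, a)}).Reachable b u := by
    intro u
    constructor
    · rintro ⟨q, hq, h⟩
      have : q = p.reverse := by rw [← huniq _ hq.reverse, SimpleGraph.Walk.reverse_reverse]
      rwa [this] at h
    · exact fun h => ⟨p.reverse, hp.reverse, h⟩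
  refine ⟨s(a, p.snd), s(p.penultimate, b), fun u v huv he₁ he₂ => ?_⟩
  have h3 : OnSideOf a b u ↔ OnSideOf a b v := by
    rw [h1, h1]
    exact step huv (by simp [he₁, he₂])
  -- The reversed path has the same first and last edge in the other order, so the same two edges
  -- serve for this side.
  have h4 : OnSideOf b a u ↔ OnSideOf b a v := by
    rw [h2, h2]
    refine step huv ?_
    rw [SimpleGraph.Walk.snd_reverse, SimpleGraph.Walk.penultimate_reverse,
      Sym2.eq_swap (a := b), Sym2.eq_swap (b := a)]
    simp [he₁, he₂]
  unfold answer
  congr 1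
  · exact propext h3
  · congr 1
    exact propext h4

theorem TreeLike.answer_self_left (u v : S) (hS : TreeLike S) : answer u v u = Answer.atFst := by
  obtain ⟨p, hp, -⟩ := hS.isTree.existsUnique_path u v
  exact if_pos ⟨p, hp, SimpleGraph.Reachable.refl _⟩

theorem TreeLike.answer_self_right_ne {u v : S} (hS : TreeLike S) (huv : u ≠ v) :
    answer u v v ≠ Answer.atFst := by
  have hn : ¬ OnSideOf u v v := by
    rintro ⟨p, hp, ⟨q⟩⟩
    have hl : 0 < p.length := by
      rcases Nat.eq_zero_or_pos p.length with h0 | h0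
      · exact absurd (SimpleGraph.Walk.eq_of_length_eq_zero h0) huv
      · exact h0
    have h1 := hS.treeOn.edges_subset hp (q.mapLe (SimpleGraph.deleteEdges_le _))
      (mem_edges_snd hl)
    rw [SimpleGraph.Walk.edges_mapLe_eq_edges] at h1
    have h2 := q.edges_subset_edgeSet h1
    simp [SimpleGraph.edgeSet_deleteEdges] at h2
  unfold answer
  rw [if_neg hn]
  split <;> simp

/-- This makes the infimum in `opt` an attained one. As long as two candidates `u ≠ v` are left, the
query `(u, v)` separates them, so each of the three answers leaves a proper subset: the first misses
`v`, the others miss `u`. -/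
theorem TreeLike.exists_searchTree (hS : TreeLike S) : ∀ (k : ℕ) (U : Set S), U.ncard ≤ k →
    ∃ T : SearchTree S, ∀ u ∈ U, T.search u = some u := by
  have := hS.finite
  intro k
  induction k with
  | zero =>
    intro U hU
    rw [(Set.ncard_eq_zero).1 (Nat.le_zero.1 hU)]
    exact ⟨SearchTree.nil, by simp⟩
  | succ k ih =>
    intro U hU
    by_cases hn : U.Nontrivial
    · obtain ⟨u, hu, v, hv, huv⟩ := hn
      have lt : ∀ (A : Set S) (w : S), w ∈ U → w ∉ A → A ⊆ U → A.ncard ≤ k := by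
        intro A w hw hwA hAU
        have := Set.ncard_lt_ncard (hAU.ssubset_of_mem_notMem hw hwA)
        omega
      obtain ⟨T₁, h1⟩ := ih {w ∈ U | answer u v w = Answer.atFst}
        (lt _ v hv (fun h => hS.answer_self_right_ne huv h.2) fun _ h => h.1)
      obtain ⟨T₂, h2⟩ := ih {w ∈ U | answer u v w = Answer.here}
        (lt _ u hu (fun h => by simpa [hS.answer_self_left] using h.2) fun _ h => h.1)
      obtain ⟨T₃, h3⟩ := ih {w ∈ U | answer u v w = Answer.atSnd}
        (lt _ u hu (fun h => by simpa [hS.answer_self_left] using h.2) fun _ h => h.1)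
      refine ⟨SearchTree.query u v T₁ T₂ T₃, fun w hw => ?_⟩
      rw [SearchTree.search]
      cases ha : answer u v w with
      | atFst => exact h1 w ⟨hw, ha⟩
      | here => exact h2 w ⟨hw, ha⟩
      | atSnd => exact h3 w ⟨hw, ha⟩
    · rw [Set.not_nontrivial_iff] at hn
      rcases hn.eq_empty_or_singleton with rfl | ⟨x, rfl⟩
      · exact ⟨SearchTree.nil, by simp⟩
      · exact ⟨SearchTree.found x, by simp [SearchTree.search]⟩

theorem TreeLike.exists_height_eq_opt (hS : TreeLike S) :
    ∃ T : SearchTree S, IsSearchTree T ∧ T.height = opt S := by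
  obtain ⟨T, hT⟩ := hS.exists_searchTree _ Set.univ le_rfl
  exact Nat.sInf_mem (s := {h | ∃ T : SearchTree S, IsSearchTree T ∧ T.height = h})
    ⟨_, T, fun u => hT u trivial, rfl⟩

theorem IsSearchTree.opt_le {T : SearchTree S} (hT : IsSearchTree T) : opt S ≤ T.height :=
  Nat.sInf_le ⟨T, hT, rfl⟩

/-- Information-theoretic bound: the three answers split `U` into three classes, each found by a
subtree. -/
theorem ncard_le_three_pow_height [Finite S] (T : SearchTree S) : ∀ U : Set S,
    (∀ u ∈ U, T.search u = some u) → U.ncard ≤ 3 ^ T.height := by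
  induction T with
  | nil =>
    intro U hU
    have : U = ∅ := Set.eq_empty_of_forall_notMem fun u hu => by
      simpa [SearchTree.search] using hU u hu
    simp [this]
  | found x =>
    intro U hU
    have : U ⊆ {x} := fun u hu => by
      simpa [SearchTree.search, eq_comm] using hU u hu
    simpa [SearchTree.height] using Set.ncard_le_ncard this
  | query x y tx there ty ih₁ ih₂ ih₃ =>
    intro U hU
    have h : ∀ a : Answer, ∀ u ∈ {w ∈ U | answer x y w = a}, (match a with
        | Answer.atFst => tx.search u
        | Answer.here => there.search u
        | Answer.atSnd => ty.search u) = some u := by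
      rintro a u ⟨hu, rfl⟩
      exact hU u hu
    have h1 := ih₁ _ (h Answer.atFst)
    have h2 := ih₂ _ (h Answer.here)
    have h3 := ih₃ _ (h Answer.atSnd)
    have hU' : U ⊆ {w ∈ U | answer x y w = Answer.atFst} ∪
        ({w ∈ U | answer x y w = Answer.here} ∪ {w ∈ U | answer x y w = Answer.atSnd}) := by
      intro u hu
      cases ha : answer x y u <;> simp [hu, ha]
    have h4 := (Set.ncard_le_ncard hU').trans ((Set.ncard_union_le _ _).trans
      (Nat.add_le_add_left (Set.ncard_union_le _ _) _))
    have hm : ∀ {k}, k ≤ max tx.height (max there.height ty.height) →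
        3 ^ k ≤ 3 ^ max tx.height (max there.height ty.height) :=
      fun h => Nat.pow_le_pow_right (by norm_num) h
    have h5 := hm (le_max_left tx.height (max there.height ty.height))
    have h6 := hm ((le_max_left there.height ty.height).trans (le_max_right tx.height _))
    have h7 := hm ((le_max_right there.height ty.height).trans (le_max_right tx.height _))
    rw [SearchTree.height, pow_succ]
    omega

theorem TreeLike.card_le (hS : TreeLike S) : Nat.card S ≤ 3 ^ opt S := by
  have := hS.finite
  obtain ⟨T, hT, h⟩ := hS.exists_height_eq_opt
  rw [← Set.ncard_univ, ← h]
  exact ncard_le_three_pow_height T _ fun u _ => hT u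

/-- Follow the search for `x`. A query sends a neighbour `y` elsewhere only if its answer changes
across the edge `x y`; this concerns at most two edges, and an edge at `x` determines `y`. In a
correct search tree all neighbours must part from `x`, so the lemma bounds degrees by `2 * opt S`.
-/
theorem TreeLike.ncard_search_ne_le (hS : TreeLike S) (x : S) (T : SearchTree S) :
    {y | (SimpleGraph.hasse S).Adj x y ∧ T.search y ≠ T.search x}.ncard ≤ 2 * T.height := by
  have := hS.finite
  induction T with
  | nil => simp [SearchTree.search]
  | found z => simp [SearchTree.search]
  | query a b tx there ty ih₁ ih₂ ih₃ =>
    obtain ⟨e₁, e₂, he⟩ := hS.exists_edges_answer_eq a b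
    have hpair : {y | (SimpleGraph.hasse S).Adj x y ∧ answer a b y ≠ answer a b x}.ncard ≤ 2 := by
      have h1 : ∀ e : Sym2 S, {y | s(x, y) = e}.ncard ≤ 1 := by
        intro e
        rw [Set.ncard_le_one]
        intro y hy z hz
        exact Sym2.congr_right.1 ((show s(x, y) = e from hy).trans
          (show s(x, z) = e from hz).symm)
      have h2 : {y | (SimpleGraph.hasse S).Adj x y ∧ answer a b y ≠ answer a b x} ⊆
          {y | s(x, y) = e₁} ∪ {y | s(x, y) = e₂} := by
        rintro y ⟨hy, hne⟩
        by_contra hc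
        simp only [Set.mem_union, not_or] at hc
        exact hne (he x y hy hc.1 hc.2).symm
      have h3 := Set.ncard_le_ncard h2
      have h4 := Set.ncard_union_le {y | s(x, y) = e₁} {y | s(x, y) = e₂}
      have h5 := h1 e₁
      have h6 := h1 e₂
      omega
    have key : ∀ t : SearchTree S,
        (∀ y, answer a b y = answer a b x →
          (SearchTree.query a b tx there ty).search y = t.search y) →
        {y | (SimpleGraph.hasse S).Adj x y ∧ t.search y ≠ t.search x}.ncard ≤ 2 * t.height →
        t.height ≤ max tx.height (max there.height ty.height) →
        {y | (SimpleGraph.hasse S).Adj x y ∧ (SearchTree.query a b tx there ty).search y ≠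
          (SearchTree.query a b tx there ty).search x}.ncard ≤
          2 * (SearchTree.query a b tx there ty).height := by
      intro t h1 h2 h3
      have hsub : {y | (SimpleGraph.hasse S).Adj x y ∧
          (SearchTree.query a b tx there ty).search y ≠
          (SearchTree.query a b tx there ty).search x} ⊆
          {y | (SimpleGraph.hasse S).Adj x y ∧ answer a b y ≠ answer a b x} ∪
          {y | (SimpleGraph.hasse S).Adj x y ∧ t.search y ≠ t.search x} := by
        rintro y ⟨hy, hne⟩
        by_cases ha : answer a b y = answer a b x
        · right
          rw [h1 y ha, h1 x rfl] at hne
          exact ⟨hy, hne⟩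
        · exact Or.inl ⟨hy, ha⟩
      have h4 := Set.ncard_le_ncard hsub
      have h5 := Set.ncard_union_le
        {y | (SimpleGraph.hasse S).Adj x y ∧ answer a b y ≠ answer a b x}
        {y | (SimpleGraph.hasse S).Adj x y ∧ t.search y ≠ t.search x}
      rw [SearchTree.height]
      omega
    cases ha : answer a b x with
    | atFst => exact key tx (fun y hy => by rw [SearchTree.search, hy, ha]) ih₁ (le_max_left _ _)
    | here =>
      exact key there (fun y hy => by rw [SearchTree.search, hy, ha]) ih₂
        ((le_max_left _ _).trans (le_max_right _ _))
    | atSnd =>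
      exact key ty (fun y hy => by rw [SearchTree.search, hy, ha]) ih₃
        ((le_max_right _ _).trans (le_max_right _ _))

theorem TreeLike.deg_le (hS : TreeLike S) (x : S) : deg (SimpleGraph.hasse S) x ≤ 2 * opt S := by
  have := hS.finite
  obtain ⟨T, hT, h⟩ := hS.exists_height_eq_opt
  rw [← h]
  refine (Set.ncard_le_ncard fun y hy => ?_).trans (hS.ncard_search_ne_le x T)
  refine ⟨hy, ?_⟩
  rw [hT y, hT x]
  exact fun hne => (SimpleGraph.Adj.ne (G := SimpleGraph.hasse S) hy).symm
    (Option.some_injective _ hne)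

/-! ## Width -/

theorem card_le_width [Finite S] {A : Finset S} (hA : IsAntichain (· ≤ ·) (A : Set S)) :
    A.card ≤ width S := by
  classical
  have := Fintype.ofFinite S
  exact le_csSup ⟨Fintype.card S, by rintro _ ⟨B, _, rfl⟩; exact B.card_le_univ⟩ ⟨A, hA, rfl⟩

theorem width_le_card [Finite S] : width S ≤ Nat.card S := by
  classical
  have := Fintype.ofFinite S
  rw [Nat.card_eq_fintype_card]
  exact csSup_le' (by rintro _ ⟨B, _, rfl⟩; exact B.card_le_univ)

theorem TreeLike.width_pos (hS : TreeLike S) : 0 < width S := by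
  have := hS.finite
  obtain ⟨ν, _⟩ := hS.exists_least
  have := card_le_width (A := {ν}) (by simp)
  rw [Finset.card_singleton] at this
  omega

/-- All leaves but the root are incomparable. -/
theorem TreeLike.ncard_leaves_le (hS : TreeLike S) :
    {x | deg (SimpleGraph.hasse S) x = 1}.ncard ≤ width S + 1 := by
  classical
  have := hS.finite
  have := Fintype.ofFinite S
  obtain ⟨ν, hν⟩ := hS.exists_least
  set A : Finset S := Finset.univ.filter fun x => deg (SimpleGraph.hasse S) x = 1 ∧ x ≠ ν
  have hA : IsAntichain (· ≤ ·) (A : Set S) := by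
    intro x hx y hy hne hle
    simp only [A, Finset.coe_filter, Set.mem_ofPred_eq, Finset.mem_univ, true_and] at hx
    have hlt : x < y := lt_of_le_of_ne hle hne
    -- An element strictly between the least element and another one has an upper and a lower cover,
    -- that is, two different neighbours.
    obtain ⟨z, hz, _⟩ := exists_covBy_le_of_lt hlt
    obtain ⟨w, _, hw⟩ := exists_le_covBy_of_lt (lt_of_le_of_ne (hν x) hx.2.symm)
    have := eq_of_deg_one hx.1 (a := z) (b := w) (Or.inl hz) (Or.inr hw)
    exact lt_irrefl x ((hz.lt.trans_eq this).trans hw.lt)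
  have h1 : {x | deg (SimpleGraph.hasse S) x = 1} ⊆ insert ν (A : Set S) := by
    intro x hx
    by_cases h : x = ν
    · exact Or.inl h
    · right
      simpa [A] using ⟨hx, h⟩
  have h2 := (Set.ncard_le_ncard h1).trans (Set.ncard_insert_le _ _)
  rw [Set.ncard_coe_finset] at h2
  have h3 := card_le_width hA
  omega

end SearchTrees

end LineLeaf
namespace LineLeaf

/-! ## Upper bound on the height of Line-Leaf Trees -/

section Height

variable {S : Type*}

theorem IsBalancedBST.height_le {leaf : S → SearchTree S} {here : Sym2 S → SearchTree S} {H : ℕ}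
    (hleaf : ∀ x, (leaf x).height ≤ H) {path : List S} {h : ℕ} {t : SearchTree S}
    (ht : IsBalancedBST leaf here path h t)
    (hc : path.IsChain fun a b => (here s(a, b)).height ≤ H) : t.height ≤ h + H := by
  induction ht with
  | single x => simpa using hleaf x
  | node l r a b h₁ h₂ t₁ t₂ _ _ _ _ ih₁ ih₂ =>
    rw [List.isChain_append] at hc
    obtain ⟨hl, hr, hm⟩ := hc
    rw [List.isChain_cons_cons] at hr
    have h1 := ih₁ (List.isChain_append.2 ⟨hl, by simp, fun x hx y hy => by
      simp only [List.head?_cons, Option.mem_def, Option.some.injEq] at hy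
      exact hm x hx y (by simp [hy])⟩)
    have h2 := ih₂ hr.2
    have h3 := hr.1
    rw [SearchTree.height]
    omega

/-- The height is at most `2 * log₂` of the number of nodes. If the subtrees have heights `h ≤ k ≤ h
+ 1` with `2 ^ h ≤ a ^ 2` and `2 ^ k ≤ b ^ 2`, then `2 ^ k ≤ 2 * a * b`, and `(a + b) ^ 2 = a ^ 2 +
b ^ 2 + 2 * a * b` is at least `2 ^ k + 2 ^ k`. -/
theorem IsBalancedBST.two_pow_le {leaf : S → SearchTree S} {here : Sym2 S → SearchTree S}
    {path : List S} {h : ℕ} {t : SearchTree S} (ht : IsBalancedBST leaf here path h t) :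
    2 ^ h ≤ path.length ^ 2 := by
  have aux : ∀ {h k a b : ℕ}, h ≤ k → k ≤ h + 1 → 2 ^ h ≤ a ^ 2 → 2 ^ k ≤ b ^ 2 →
      2 ^ (k + 1) ≤ (a + b) ^ 2 := by
    intro h k a b h1 h2 ha hb
    have hk : 2 ^ k ≤ 2 * 2 ^ h := by
      rw [← pow_succ']
      exact Nat.pow_le_pow_right (by norm_num) h2
    have hab : 2 ^ k ≤ 2 * (a * b) := by
      refine (Nat.pow_le_pow_iff_left two_ne_zero).1 ?_
      calc (2 ^ k) ^ 2 = 2 ^ k * 2 ^ k := sq _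
        _ ≤ 2 * 2 ^ h * 2 ^ k := Nat.mul_le_mul_right _ hk
        _ ≤ 2 * a ^ 2 * b ^ 2 := by gcongr
        _ ≤ (2 * (a * b)) ^ 2 := by nlinarith [Nat.zero_le (a ^ 2 * b ^ 2)]
    rw [pow_succ]
    nlinarith [Nat.zero_le (a ^ 2)]
  induction ht with
  | single x => simp
  | node l r a b h₁ h₂ t₁ t₂ _ _ bal₁ bal₂ ih₁ ih₂ =>
    simp only [List.length_append, List.length_cons, List.length_nil] at ih₁ ih₂ ⊢
    have e : l.length + (r.length + 1 + 1) = (l.length + (0 + 1)) + (r.length + 1) := by omega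
    rw [e]
    rcases le_total h₁ h₂ with h | h
    · rw [max_eq_right h]
      exact aux h bal₂ ih₁ ih₂
    · rw [max_eq_left h, Nat.add_comm (l.length + _)]
      exact aux h bal₁ ih₂ ih₁

/-- All search trees attached to a stage have height at most `H`. -/
structure HeightBound (st : Stage S) (H : ℕ) : Prop where
  lst_le : ∀ x, (st.lst x).height ≤ H
  bst_le : ∀ x y, st.graph.Adj x y → (st.bst s(x, y)).height ≤ H

theorem HeightBound.pathBST_le {st : Stage S} {H A : ℕ} (hH : HeightBound st H) [Finite S]
    (hA : Nat.card S ^ 2 ≤ 2 ^ A) {a b x y : S} {p : st.graph.Walk a b} (hp : p.IsPath)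
    {t : SearchTree S} (ht : IsPathBST st x y p.support t) : t.height ≤ A + H := by
  classical
  have := Fintype.ofFinite S
  obtain ⟨h, ht⟩ := ht
  have h1 : t.height ≤ h + H := by
    refine ht.height_le (fun z => ?_) ?_
    · split
      · simp [SearchTree.height]
      · exact hH.lst_le z
    · exact p.isChain_adj_support.imp fun a b hab => hH.bst_le a b hab
  have h2 := ht.two_pow_le
  have h3 : p.support.length ≤ Nat.card S := by
    rw [Nat.card_eq_fintype_card]
    exact hp.support_nodup.length_le_card
  have h4 : 2 ^ h ≤ 2 ^ A := h2.trans ((Nat.pow_le_pow_left h3 2).trans hA)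
  have h5 := (Nat.pow_le_pow_iff_right (by norm_num)).1 h4
  omega

theorem LineContraction.heightBound {st st' : Stage S} (hc : LineContraction st st') {H A : ℕ}
    (hH : HeightBound st H) [Finite S] (hA : Nat.card S ^ 2 ≤ 2 ^ A) :
    HeightBound st' (A + H) where
  lst_le x := by
    rw [hc.lst_eq]
    exact (hH.lst_le x).trans (Nat.le_add_left _ _)
  bst_le x y hxy := by
    obtain ⟨p, hp⟩ := (hc.adj_iff x y).1 hxy
    rcases Nat.lt_or_ge p.length 2 with h | h
    · have h1 : p.length = 1 := by have := hp.length_pos; omega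
      rw [hc.bst_edge x y p hp h1]
      exact (hH.bst_le x y (SimpleGraph.Walk.adj_of_length_eq_one h1)).trans (Nat.le_add_left _ _)
    · rcases hc.bst_path x y p hp h with ht | ht
      · exact hH.pathBST_le hA hp.1 ht
      · rw [← SimpleGraph.Walk.support_reverse] at ht
        exact hH.pathBST_le hA hp.1.reverse ht

theorem height_addQueries_le {st : Stage S} {H : ℕ} (hH : HeightBound st H) (x : S) (ys : List S)
    (hys : ∀ y ∈ ys, st.graph.Adj x y) : (addQueries st x ys).height ≤ ys.length + H := by
  induction ys with
  | nil => simpa [addQueries] using hH.lst_le x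
  | cons y ys ih =>
    have h1 := ih fun z hz => hys z (List.mem_cons_of_mem _ hz)
    have h2 := hH.bst_le x y (hys y List.mem_cons_self)
    have h3 := hH.lst_le y
    rw [addQueries] at h1 ⊢
    rw [List.foldr_cons, SearchTree.height, List.length_cons]
    omega

theorem LeafContraction.heightBound {st st' : Stage S} (hc : LeafContraction st st') {H D : ℕ}
    (hH : HeightBound st H) [Finite S] (hD : ∀ x, deg st.graph x ≤ D) :
    HeightBound st' (D + H) where
  lst_le x := by
    classical
    by_cases hx : x ∈ st'.live
    · obtain ⟨ys, hnd, hys, h⟩ := hc.lst_live x hx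
      rw [h]
      refine (height_addQueries_le hH x ys fun y hy => ((hys y).1 hy).1).trans ?_
      have h1 : ys.length ≤ deg st.graph x := by
        rw [← List.toFinset_card_of_nodup hnd, ← Set.ncard_coe_finset]
        refine Set.ncard_le_ncard fun y hy => ((hys y).1 (by simpa using hy)).1
      have := hD x
      omega
    · rw [hc.lst_dead x hx]
      exact (hH.lst_le x).trans (Nat.le_add_left _ _)
  bst_le x y hxy := by
    rw [hc.bst_eq]
    exact (hH.bst_le x y ((hc.adj_iff x y).1 hxy).1).trans (Nat.le_add_left _ _)

theorem LineContraction.deg_le {st st' : Stage S} (hc : LineContraction st st') [Finite S]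
    (h : TreeOn st.live st.graph) (x : S) : deg st'.graph x ≤ deg st.graph x := by
  rw [hc.graph_eq]
  by_cases hx : deg st.graph x = 2
  · rw [deg_lineGraph_of_two hx]
    exact Nat.zero_le _
  · rw [h.deg_lineGraph hx]

theorem LeafContraction.deg_le {st st' : Stage S} (hc : LeafContraction st st') [Finite S] (x : S) :
    deg st'.graph x ≤ deg st.graph x :=
  Set.ncard_le_ncard fun y hy => ((hc.adj_iff x y).1 hy).1

theorem LineContraction.ncard_leaves_le {st st' : Stage S} (hc : LineContraction st st') [Finite S]
    (h : TreeOn st.live st.graph) :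
    {x | deg st'.graph x = 1}.ncard ≤ {x | deg st.graph x = 1}.ncard := by
  refine Set.ncard_le_ncard fun x hx => ?_
  have hx : deg st'.graph x = 1 := hx
  rw [hc.graph_eq] at hx
  by_cases h2 : deg st.graph x = 2
  · rw [deg_lineGraph_of_two h2] at hx
    omega
  · rwa [h.deg_lineGraph h2] at hx

/-- Without nodes of degree two, a leaf contraction halves the number of leaves. -/
theorem LeafContraction.two_mul_ncard_leaves_le {st st' : Stage S} (hc : LeafContraction st st')
    [Finite S] (h2 : ∀ x, deg st.graph x ≠ 2) (h : TreeOn st.live st.graph) :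
    2 * {x | deg st'.graph x = 1}.ncard ≤ {x | deg st.graph x = 1}.ncard := by
  classical
  have := Fintype.ofFinite S
  by_cases hne : {x ∈ st.live | deg st.graph x ≠ 1}.Nonempty
  · set A : S → Finset S := fun x => Finset.univ.filter fun y => st.graph.Adj x y ∧
      deg st.graph y = 1
    set L : Finset S := Finset.univ.filter fun x => deg st'.graph x = 1
    -- A node `x` that is a leaf afterwards had degree at least three before and has kept one
    -- neighbour only, so at least two leaves were absorbed by it.
    have hA : ∀ x ∈ L, 2 ≤ (A x).card := by
      intro x hx
      have hx : deg st'.graph x = 1 := by simpa [L] using hx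
      obtain ⟨y, hy⟩ := deg_pos_iff.1 (by omega : 0 < deg st'.graph x)
      have hxy := (hc.adj_iff x y).1 hy
      have h1 : deg st.graph x ≠ 1 := by
        have := hxy.2.1
        rw [hc.live_eq hne] at this
        exact this.2
      have h3 : 0 < deg st.graph x := deg_pos_iff.2 ⟨y, hxy.1⟩
      have h4 := h2 x
      have hsub : st.graph.neighborSet x ⊆ st'.graph.neighborSet x ∪ (A x : Set S) := by
        intro z hz
        have hz : st.graph.Adj x z := hz
        by_cases hzl : z ∈ st'.live
        · exact Or.inl ((hc.adj_iff x z).2 ⟨hz, hxy.2.1, hzl⟩)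
        · right
          simpa [A] using ⟨hz, hc.deg_eq_one (h.right_mem hz) hzl⟩
      have h5 := (Set.ncard_le_ncard hsub).trans (Set.ncard_union_le _ _)
      rw [Set.ncard_coe_finset] at h5
      change deg st.graph x ≤ deg st'.graph x + _ at h5
      omega
    -- A leaf has only one neighbour, so no leaf is counted twice.
    have hdis : ∀ x ∈ L, ∀ y ∈ L, x ≠ y → Disjoint (A x) (A y) := by
      intro x _ y _ hxy
      rw [Finset.disjoint_left]
      intro z hz hz'
      simp only [A, Finset.mem_filter, Finset.mem_univ, true_and] at hz hz'
      exact hxy (eq_of_deg_one hz.2 hz.1.symm hz'.1.symm)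
    have h6 : (L.biUnion A).card = ∑ x ∈ L, (A x).card := Finset.card_biUnion hdis
    have h7 : ∑ x ∈ L, 2 ≤ ∑ x ∈ L, (A x).card := Finset.sum_le_sum hA
    have h8 : (L.biUnion A : Set S) ⊆ {x | deg st.graph x = 1} := by
      intro z hz
      simp only [Finset.coe_biUnion, Set.mem_iUnion, A] at hz
      obtain ⟨x, _, hz⟩ := hz
      simp only [Finset.coe_filter, Set.mem_ofPred_eq] at hz
      exact hz.2.2
    have h9 := Set.ncard_le_ncard h8
    have h10 : {x | deg st'.graph x = 1}.ncard = L.card := by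
      rw [← Set.ncard_coe_finset]; congr 1; ext; simp [L]
    rw [Set.ncard_coe_finset] at h9
    rw [Finset.sum_const, smul_eq_mul] at h7
    omega
  · obtain ⟨r, _, hr⟩ := hc.live_root hne
    have : {x | deg st'.graph x = 1} = ∅ := by
      refine Set.eq_empty_of_forall_notMem fun x hx => ?_
      have hx : deg st'.graph x = 1 := hx
      obtain ⟨y, hy⟩ := deg_pos_iff.1 (by omega : 0 < deg st'.graph x)
      have hxy := (hc.adj_iff x y).1 hy
      rw [hr] at hxy
      exact hxy.1.ne (hxy.2.1.trans hxy.2.2.symm)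
    rw [this]
    simp

/-- Here `k` is the number of iterations. The invariant behind the second bound is that `2 ^ k`
times the current number of leaves is at most `w + 1`. -/
theorem exists_iterations_bound [PartialOrder S] (hS : TreeLike S) {A D : ℕ}
    (hA : Nat.card S ^ 2 ≤ 2 ^ A) (hD : ∀ x, deg (SimpleGraph.hasse S) x ≤ D) {st : Stage S}
    (hst : Relation.ReflTransGen Iteration (initial S) st) :
    ∃ k : ℕ, HeightBound st (k * (A + D)) ∧ 2 ^ k ≤ 2 * (width S + 1) := by
  have := hS.finite
  suffices ∃ k : ℕ, TreeOn st.live st.graph ∧ (∀ x, deg st.graph x ≤ D) ∧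
      HeightBound st (k * (A + D)) ∧ 2 ^ k * {x | deg st.graph x = 1}.ncard ≤ width S + 1 ∧
      2 ^ k ≤ 2 * (width S + 1) by
    obtain ⟨k, _, _, h, _, h'⟩ := this
    exact ⟨k, h, h'⟩
  induction hst with
  | refl =>
    refine ⟨0, hS.treeOn, hD, ⟨fun x => ?_, fun x y _ => ?_⟩, ?_, ?_⟩
    · simp [initial, SearchTree.height]
    · simp [initial, SearchTree.height]
    · rw [pow_zero, one_mul]
      exact hS.ncard_leaves_le
    · omega
  | tail _ hit ih =>
    obtain ⟨k, ht, hd, hh, hl, _⟩ := ih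
    have ht' := hit.treeOn ht
    obtain ⟨hn, st₁, h1, h2⟩ := hit
    have ht₁ := h1.treeOn ht
    have hl₁ := h1.ncard_leaves_le ht
    have hl₂ := h2.two_mul_ncard_leaves_le
      (by rw [h1.graph_eq]; exact ht.deg_lineGraph_ne_two) ht₁
    refine ⟨k + 1, ht', fun x => (h2.deg_le x).trans ((h1.deg_le ht x).trans (hd x)), ?_, ?_, ?_⟩
    · have h3 := h2.heightBound (h1.heightBound hh hA)
        fun x => (h1.deg_le ht x).trans (hd x)
      rwa [show (k + 1) * (A + D) = D + (A + k * (A + D)) by ring]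
    · refine le_trans ?_ hl
      rw [pow_succ, mul_assoc]
      exact Nat.mul_le_mul_left _ (hl₂.trans hl₁)
    -- No leaves may be left after this iteration, but there was one before it. Hence the bound is
    -- derived from the previous `2 ^ k`, at the price of a factor two.
    · obtain ⟨x, _, hx⟩ := ht.exists_deg_one hn
      have h4 := (Set.ncard_pos (Set.toFinite _)).2 (⟨x, hx⟩ : {x | deg _ x = 1}.Nonempty)
      have h5 : 2 ^ k * 1 ≤ width S + 1 := (Nat.mul_le_mul_left _ h4).trans hl
      rw [pow_succ]
      omega

/-- Line-Leaf Trees are at most `18 max(1, log₂ w)` times as high as optimal search trees. -/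
theorem IsLineLeafTree.height_le [PartialOrder S] (hS : TreeLike S) {T : SearchTree S}
    (hT : IsLineLeafTree T) :
    (T.height : ℝ) ≤ 18 * max 1 (Real.logb 2 (width S)) * opt S := by
  obtain ⟨st, r, hst, _, rfl⟩ := hT
  -- From `n ≤ 3 ^ OPT` and `3 ^ 2 ≤ 2 ^ 4`. With degrees at most `2 * OPT`, an iteration costs `4 +
  -- 2 = 6` times OPT.
  have hA : Nat.card S ^ 2 ≤ 2 ^ (4 * opt S) := by
    calc Nat.card S ^ 2 ≤ (3 ^ opt S) ^ 2 := Nat.pow_le_pow_left hS.card_le 2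
      _ = (3 ^ 2) ^ opt S := by rw [← pow_mul, ← pow_mul, mul_comm]
      _ ≤ (2 ^ 4) ^ opt S := Nat.pow_le_pow_left (by norm_num) _
      _ = 2 ^ (4 * opt S) := (pow_mul _ _ _).symm
  obtain ⟨k, hk, hw⟩ := exists_iterations_bound hS hA hS.deg_le hst
  have h1 : ((st.lst r).height : ℝ) ≤ k * (6 * opt S) := by
    have := hk.lst_le r
    rw [show 4 * opt S + 2 * opt S = 6 * opt S by ring] at this
    exact_mod_cast this
  -- Since `2 ^ k ≤ 2 * (w + 1) ≤ 4 * w`, the number of iterations is at most `2 + log₂ w`; this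
  -- yields the factor 3, and `3 * 6 = 18`.
  have h2 : (k : ℝ) ≤ 3 * max 1 (Real.logb 2 (width S)) := by
    have hpos := hS.width_pos
    have hw' : (2 : ℝ) ^ k ≤ 4 * width S := by
      have : 2 ^ k ≤ 4 * width S := by omega
      exact_mod_cast this
    have h3 : (k : ℝ) ≤ 2 + Real.logb 2 (width S) := by
      have h4 : Real.logb 2 (2 ^ k) ≤ Real.logb 2 (4 * width S) :=
        Real.logb_le_logb_of_le (by norm_num) (by positivity) hw'
      rw [Real.logb_pow, Real.logb_self_eq_one (by norm_num), mul_one,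
        Real.logb_mul (by norm_num) (by positivity),
        show (4 : ℝ) = 2 ^ 2 by norm_num, Real.logb_pow, Real.logb_self_eq_one (by norm_num)] at h4
      simpa using h4
    have h5 := le_max_left 1 (Real.logb 2 (width S))
    have h6 := le_max_right 1 (Real.logb 2 (width S))
    linarith
  calc ((st.lst r).height : ℝ) ≤ k * (6 * opt S) := h1
    _ ≤ 3 * max 1 (Real.logb 2 (width S)) * (6 * opt S) := by gcongr
    _ = 18 * max 1 (Real.logb 2 (width S)) * opt S := by ring

end Height

end LineLeaf
-- Statement (b): a family of tree-like posets with high Line-Leaf Trees.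
namespace LineLeaf

/-! ## Posets in which the elements below any element form a chain -/

section Forest

variable {S : Type*} [PartialOrder S]

/-- Descending through lower covers from `z` meets only elements that are not above `y`, so an edge
at `y` is never used. -/
theorem reachable_of_not_le [Finite S] {ν : S} (hν : ∀ x : S, ν ≤ x) {x y : S} :
    ∀ z : S, ¬ y ≤ z → ((SimpleGraph.hasse S).deleteEdges {s(x, y)}).Reachable z ν := by
  intro z
  induction z using WellFoundedLT.induction with
  | ind z ih =>
    intro hz
    rcases (hν z).eq_or_lt with rfl | hlt
    · exact SimpleGraph.Reachable.refl _
    · obtain ⟨w, _, hw⟩ := exists_le_covBy_of_lt hlt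
      refine SimpleGraph.Reachable.trans (SimpleGraph.Adj.reachable ?_)
        (ih w hw.lt fun h => hz (h.trans hw.le))
      rw [SimpleGraph.deleteEdges_adj]
      refine ⟨Or.inr hw, fun h => ?_⟩
      rcases Sym2.eq_iff.1 (Set.mem_singleton_iff.1 h) with ⟨_, rfl⟩ | ⟨rfl, _⟩
      · exact hz hw.le
      · exact hz le_rfl

theorem reachable_of_le [Finite S] {x y : S} (hxy : x < y) : ∀ z : S, y ≤ z →
    ((SimpleGraph.hasse S).deleteEdges {s(x, y)}).Reachable z y := by
  intro z
  induction z using WellFoundedLT.induction with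
  | ind z ih =>
    intro hz
    rcases hz.eq_or_lt with rfl | hlt
    · exact SimpleGraph.Reachable.refl _
    · obtain ⟨w, hyw, hw⟩ := exists_le_covBy_of_lt hlt
      refine SimpleGraph.Reachable.trans (SimpleGraph.Adj.reachable ?_) (ih w hw.lt hyw)
      rw [SimpleGraph.deleteEdges_adj]
      refine ⟨Or.inr hw, fun h => ?_⟩
      rcases Sym2.eq_iff.1 (Set.mem_singleton_iff.1 h) with ⟨rfl, _⟩ | ⟨rfl, _⟩
      · exact absurd (hxy.trans hlt) (lt_irrefl _)
      · exact absurd hlt (lt_irrefl _)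

/-- The elements above `y` can be left only downwards. Below any element there is a chain, so the
lower cover of an element strictly above `y` is still above `y`, and the only lower cover of `y`
itself is `x`; that edge has been deleted. -/
theorem le_of_reachable (hf : ∀ x y z : S, x ≤ z → y ≤ z → x ≤ y ∨ y ≤ x) {x y : S}
    (hxy : x ⋖ y) {u v : S} (h : ((SimpleGraph.hasse S).deleteEdges {s(x, y)}).Reachable u v)
    (hu : y ≤ u) : y ≤ v := by
  obtain ⟨p⟩ := h
  induction p with
  | nil => exact hu
  | @cons a b c hadj p ih =>
    refine ih ?_
    obtain ⟨hab | hba, he⟩ := SimpleGraph.deleteEdges_adj.1 hadj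
    · exact hu.trans hab.le
    · rcases hu.eq_or_lt with rfl | hlt
      · have : x = b := by
          rcases hf x b y hxy.le hba.le with h | h
          · rcases h.eq_or_lt with h | h
            · exact h
            · exact absurd hba.lt (hxy.2 h)
          · rcases h.eq_or_lt with h | h
            · exact h.symm
            · exact absurd hxy.lt (hba.2 h)
        subst this
        exact absurd (Sym2.eq_swap) he
      · rcases hf y b a hu hba.le with h | h
        · exact h
        · rcases h.eq_or_lt with h | h
          · exact h.ge
          · exact absurd hlt (hba.2 h)

/-- Descending to `ν` shows connectedness, and by `le_of_reachable` every covering pair is a bridge.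
-/
theorem treeLike_of_chains [Finite S] (hf : ∀ x y z : S, x ≤ z → y ≤ z → x ≤ y ∨ y ≤ x) {ν : S}
    (hν : ∀ x : S, ν ≤ x) : TreeLike S where
  finite := inferInstance
  exists_least := ⟨ν, hν⟩
  isTree := by
    have hr : ∀ z : S, (SimpleGraph.hasse S).Reachable z ν := by
      intro z
      induction z using WellFoundedLT.induction with
      | ind z ih =>
        rcases (hν z).eq_or_lt with rfl | hlt
        · exact SimpleGraph.Reachable.refl _
        · obtain ⟨w, _, hw⟩ := exists_le_covBy_of_lt hlt
          exact SimpleGraph.Reachable.trans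
            (SimpleGraph.Adj.reachable (G := SimpleGraph.hasse S) (Or.inr hw)) (ih w hw.lt)
    have : Nonempty S := ⟨ν⟩
    refine ⟨⟨fun x y => (hr x).trans (hr y).symm⟩, ?_⟩
    have key : ∀ {x y : S}, x ⋖ y → (SimpleGraph.hasse S).IsBridge s(x, y) := by
      intro x y hxy
      rw [SimpleGraph.isBridge_iff]
      intro h
      exact hxy.lt.not_ge (le_of_reachable hf hxy h.symm le_rfl)
    rw [SimpleGraph.isAcyclic_iff_forall_adj_isBridge]
    rintro x y (h | h)
    · exact key h
    · rw [Sym2.eq_swap]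
      exact key h

theorem onSideOf_iff_of_adj (hS : TreeLike S) {x y : S} (hxy : (SimpleGraph.hasse S).Adj x y)
    (u : S) : OnSideOf x y u ↔
      ((SimpleGraph.hasse S).deleteEdges {s(x, y)}).Reachable x u := by
  have hp : hxy.toWalk.IsPath := by simp [hxy.ne]
  constructor
  · rintro ⟨q, hq, h⟩
    rw [hS.treeOn.path_unique hq hp] at h
    simpa using h
  · intro h
    exact ⟨_, hp, by simpa using h⟩

/-- An edge of the Hasse diagram separates the elements above its upper end from the others. -/
theorem answer_of_covBy [Finite S] (hf : ∀ x y z : S, x ≤ z → y ≤ z → x ≤ y ∨ y ≤ x) {ν : S}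
    (hν : ∀ x : S, ν ≤ x) {x y : S} (hxy : x ⋖ y) (u : S) :
    (y ≤ u → answer x y u = Answer.atSnd) ∧ (¬ y ≤ u → answer x y u = Answer.atFst) := by
  have hS := treeLike_of_chains hf hν
  have hx : ¬ y ≤ x := hxy.lt.not_ge
  constructor
  · intro hu
    have h1 : ¬ OnSideOf x y u := by
      rw [onSideOf_iff_of_adj hS (Or.inl hxy)]
      exact fun h => hx (le_of_reachable hf hxy h.symm hu)
    have h2 : OnSideOf y x u := by
      rw [onSideOf_iff_of_adj hS (Or.inr hxy), Sym2.eq_swap]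
      exact (reachable_of_le hxy.lt u hu).symm
    unfold answer
    rw [if_neg h1, if_pos h2]
  · intro hu
    have h1 : OnSideOf x y u := by
      rw [onSideOf_iff_of_adj hS (Or.inl hxy)]
      exact (reachable_of_not_le hν x hx).trans (reachable_of_not_le hν u hu).symm
    exact if_pos h1

end Forest

/-- The elements of `U` can be found with `h` queries. -/
def Searchable {S : Type*} [PartialOrder S] (U : Set S) (h : ℕ) : Prop :=
  ∃ T : SearchTree S, (∀ u ∈ U, T.search u = some u) ∧ T.height ≤ h

namespace Searchable

variable {S : Type*} [PartialOrder S]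

theorem mono {U V : Set S} {h k : ℕ} (hU : Searchable U h) (hVU : V ⊆ U) (hhk : h ≤ k) :
    Searchable V k := by
  obtain ⟨T, hT, h1⟩ := hU
  exact ⟨T, fun u hu => hT u (hVU hu), h1.trans hhk⟩

theorem singleton (x : S) : Searchable {x} 0 :=
  ⟨SearchTree.found x, by simp [SearchTree.search], by simp [SearchTree.height]⟩

theorem split [Finite S] (hf : ∀ x y z : S, x ≤ z → y ≤ z → x ≤ y ∨ y ≤ x) {ν : S}
    (hν : ∀ x : S, ν ≤ x) {U : Set S} {h : ℕ} {x y : S} (hxy : x ⋖ y) (h₁ : Searchable (U \ Set.Ici y) h)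
    (h₂ : Searchable (U ∩ Set.Ici y) h) : Searchable U (h + 1) := by
  obtain ⟨T₁, hT₁, hh₁⟩ := h₁
  obtain ⟨T₂, hT₂, hh₂⟩ := h₂
  refine ⟨SearchTree.query x y T₁ SearchTree.nil T₂, fun u hu => ?_, ?_⟩
  · rw [SearchTree.search]
    by_cases hyu : y ≤ u
    · rw [(answer_of_covBy hf hν hxy u).1 hyu]
      exact hT₂ u ⟨hu, hyu⟩
    · rw [(answer_of_covBy hf hν hxy u).2 hyu]
      exact hT₁ u ⟨hu, hyu⟩
  · simp only [SearchTree.height]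
    omega

theorem splitList [Finite S] (hf : ∀ x y z : S, x ≤ z → y ≤ z → x ≤ y ∨ y ≤ x) {ν : S}
    (hν : ∀ x : S, ν ≤ x) {h : ℕ} {x : S} : ∀ (ys : List S) (U : Set S), (∀ y ∈ ys, x ⋖ y) →
    Searchable (U \ {u | ∃ y ∈ ys, y ≤ u}) h → (∀ y ∈ ys, Searchable (U ∩ Set.Ici y) h) →
    Searchable U (h + ys.length) := by
  intro ys
  induction ys with
  | nil => exact fun U _ h1 _ => h1.mono (by simp) (by simp)
  | cons y ys ih =>
    intro U hys h1 h2
    refine split hf hν (hys y (by simp)) (ih _ (fun z hz => hys z (by simp [hz])) ?_ ?_)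
      ((h2 y (by simp)).mono subset_rfl (Nat.le_add_right _ _))
    · refine h1.mono (fun u hu => ⟨hu.1.1, ?_⟩) le_rfl
      rintro ⟨z, hz, hzu⟩
      rcases List.mem_cons.1 hz with rfl | hz
      · exact hu.1.2 hzu
      · exact hu.2 ⟨z, hz, hzu⟩
    · intro z hz
      exact (h2 z (by simp [hz])).mono (Set.inter_subset_inter_left _ Set.sdiff_subset) le_rfl

end Searchable

end LineLeaf
namespace LineLeaf

/-! ## A family of trees with high Line-Leaf Trees -/

/-- Labels of the nodes: `chain j` has one child labelled `chain (j - 1)`, and further children that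
are contracted one iteration later; `filler r` is the root of a complete binary tree. -/
inductive Label
  | chain (j : ℕ)
  | filler (r : ℕ)

namespace Label

/-- The labels of the children. -/
def kids (d : ℕ) : Label → List Label
  | chain 0 => []
  -- The fillers have rank `2 * j + 1`, one more than `chain j`, so their queries are put in front
  -- of the query for `chain j`.
  | chain (j + 1) => chain j :: List.replicate d (filler (2 * j + 1))
  | filler 0 => []
  | filler (r + 1) => [filler r, filler r]

/-- The iteration in which a node is contracted. -/
def rank : Label → ℕ
  | chain j => 2 * j
  | filler r => r

theorem rank_lt {d : ℕ} {s t : Label} (h : s ∈ t.kids d) : s.rank < t.rank := by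
  rcases t with (_ | j) | (_ | r)
  · simp [kids] at h
  · simp only [kids, List.mem_cons, List.mem_replicate] at h
    rcases h with rfl | ⟨_, rfl⟩ <;> simp only [rank] <;> omega
  · simp [kids] at h
  · simp only [kids, List.mem_cons, List.not_mem_nil, or_false, or_self] at h
    subst h
    simp [rank]

/-- The label that is reached by descending along a sequence of child indices. -/
def descend (d : ℕ) : Label → List ℕ → Option Label
  | t, [] => some t
  | t, i :: l => ((t.kids d)[i]?).bind fun s => s.descend d l

theorem descend_append (d : ℕ) (l l' : List ℕ) (t : Label) :
    t.descend d (l ++ l') = (t.descend d l).bind fun s => s.descend d l' := by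
  induction l generalizing t with
  | nil => simp [descend]
  | cons i l ih =>
    simp only [List.cons_append, descend]
    cases (t.kids d)[i]? with
    | none => rfl
    | some s => simpa using ih s

/-- Ranks drop along every edge, so only finitely many index sequences are valid; induction on the
rank. -/
theorem finite_descend (d : ℕ) (k : ℕ) : ∀ t : Label, t.rank < k →
    {l | (t.descend d l).isSome}.Finite := by
  induction k with
  | zero => intro t h; omega
  | succ k ih =>
    intro t ht
    have h : {l | (t.descend d l).isSome} ⊆ {[]} ∪
        ⋃ i : Fin (t.kids d).length, (fun l => (i : ℕ) :: l) ''
          {l | ((t.kids d)[i].descend d l).isSome} := by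
      rintro (_ | ⟨i, l⟩) hl
      · exact Or.inl rfl
      · right
        simp only [Set.mem_ofPred_eq, descend] at hl
        by_cases hi : i < (t.kids d).length
        · rw [List.getElem?_eq_getElem hi] at hl
          exact Set.mem_iUnion.2 ⟨⟨i, hi⟩, l, hl, rfl⟩
        · rw [List.getElem?_eq_none (by omega)] at hl
          simp at hl
    refine Set.Finite.subset ((Set.finite_singleton _).union (Set.finite_iUnion fun i => ?_)) h
    exact (ih _ (by have := rank_lt (List.getElem_mem (l := t.kids d) i.2); simp; omega)).image _

end Label

/-- The nodes of the tree with root label `t`, given by the sequences of child indices that lead to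
them. -/
structure Node (d : ℕ) (t : Label) where
  path : List ℕ
  valid : (t.descend d path).isSome

namespace Node

variable {d : ℕ} {t : Label}

theorem ext_path {x y : Node d t} (h : x.path = y.path) : x = y := by
  cases x; cases y; cases h; rfl

instance : PartialOrder (Node d t) where
  le x y := x.path <+: y.path
  le_refl x := List.prefix_refl _
  le_trans _ _ _ := List.IsPrefix.trans
  le_antisymm _ _ h h' := ext_path (h.eq_of_length_le h'.length_le)

theorem le_def {x y : Node d t} : x ≤ y ↔ x.path <+: y.path := Iff.rfl

instance : Finite (Node d t) := by
  have h := (Label.finite_descend d (t.rank + 1) t (Nat.lt_succ_self _)).to_subtype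
  exact Finite.of_injective (fun x : Node d t => (⟨x.path, x.valid⟩ : {l | (t.descend d l).isSome}))
    fun x y hxy => ext_path (congrArg Subtype.val hxy)

/-- The root. -/
def root : Node d t := ⟨[], rfl⟩

theorem root_le (x : Node d t) : root ≤ x := List.nil_prefix

theorem le_total_of_le (x y z : Node d t) (hx : x ≤ z) (hy : y ≤ z) : x ≤ y ∨ y ≤ x :=
  List.prefix_or_prefix_of_prefix hx hy

theorem treeLike : TreeLike (Node d t) := treeLike_of_chains le_total_of_le root_le

/-- The label of a node. -/
def label (x : Node d t) : Label := (t.descend d x.path).get x.valid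

theorem descend_path (x : Node d t) : t.descend d x.path = some x.label := by
  simp [label]

theorem label_eq {x : Node d t} {s : Label} (h : t.descend d x.path = some s) : x.label = s := by
  simp [label, h]

theorem descend_snoc (x : Node d t) (i : ℕ) :
    t.descend d (x.path ++ [i]) = (x.label.kids d)[i]? := by
  rw [Label.descend_append, descend_path]
  simp only [Option.bind_some, Label.descend]
  cases (x.label.kids d)[i]? <;> rfl

/-- The child with index `i`. -/
def child (x : Node d t) (i : ℕ) (hi : i < (x.label.kids d).length) : Node d t where
  path := x.path ++ [i]
  valid := by rw [descend_snoc, List.getElem?_eq_getElem hi]; rfl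

theorem label_child (x : Node d t) (i : ℕ) (hi : i < (x.label.kids d).length) :
    (x.child i hi).label = (x.label.kids d)[i] :=
  label_eq (by rw [child, descend_snoc, List.getElem?_eq_getElem hi])

theorem covBy_iff {x y : Node d t} : x ⋖ y ↔ ∃ i hi, y = x.child i hi := by
  constructor
  · intro h
    obtain ⟨l, hl⟩ := h.le
    rcases l with _ | ⟨i, l⟩
    · exact absurd (ext_path (by simpa using hl)) h.lt.ne
    · have h1 : t.descend d y.path = ((x.label.kids d)[i]?).bind fun s => s.descend d l := by
        rw [← hl, show x.path ++ i :: l = (x.path ++ [i]) ++ l by simp, Label.descend_append,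
          descend_snoc]
      have hi : i < (x.label.kids d).length := by
        by_contra hc
        have := y.valid
        rw [h1, List.getElem?_eq_none (by omega)] at this
        simp at this
      have h2 : x < x.child i hi := by
        refine lt_of_le_of_ne (List.prefix_append _ _) fun h => ?_
        have := congrArg (fun z => z.path.length) h
        simp [child] at this
      have h3 : x.child i hi ≤ y := by
        rw [le_def, ← hl]
        exact ⟨l, by simp [child]⟩
      refine ⟨i, hi, ?_⟩
      rcases h3.eq_or_lt with h4 | h4
      · exact h4.symm
      · exact absurd h4 (h.2 h2)
  · rintro ⟨i, hi, rfl⟩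
    constructor
    · refine lt_of_le_of_ne (List.prefix_append _ _) fun h => ?_
      have := congrArg (fun z => z.path.length) h
      simp [child] at this
    · intro z hz1 hz2
      have h1 : x.path.length < z.path.length := by
        by_contra hc
        exact hz1.ne (ext_path (hz1.le.eq_of_length_le (by omega)))
      have h2 : z.path.length < x.path.length + 1 := by
        by_contra hc
        exact hz2.ne (ext_path (hz2.le.eq_of_length_le (by simp [child]; omega)))
      omega

theorem child_injective {x : Node d t} {i j : ℕ} {hi hj} (h : x.child i hi = x.child j hj) :
    i = j := by
  have := congrArg Node.path h
  simpa [child] using this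

theorem eq_of_covBy {x y z : Node d t} (hx : x ⋖ z) (hy : y ⋖ z) : x = y := by
  obtain ⟨i, hi, h1⟩ := covBy_iff.1 hx
  obtain ⟨j, hj, h2⟩ := covBy_iff.1 hy
  have h3 := congrArg Node.path (h1.symm.trans h2)
  exact ext_path (List.append_inj_left' h3 rfl)

theorem exists_parent {x : Node d t} (hx : x ≠ root) : ∃ y, y ⋖ x := by
  obtain ⟨y, _, hy⟩ := exists_le_covBy_of_lt (lt_of_le_of_ne (root_le x) hx.symm)
  exact ⟨y, hy⟩

/-- The iteration in which a node is contracted. -/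
def rank (x : Node d t) : ℕ := x.label.rank

theorem rank_lt_of_covBy {x y : Node d t} (h : x ⋖ y) : y.rank < x.rank := by
  obtain ⟨i, hi, rfl⟩ := covBy_iff.1 h
  rw [rank, rank, label_child]
  exact Label.rank_lt (List.getElem_mem hi)

theorem rank_root : (root : Node d t).rank = t.rank := by
  rw [rank, label_eq (s := t) rfl]

theorem rank_lt_rank_root {x : Node d t} (hx : x ≠ root) : x.rank < t.rank := by
  induction x using WellFoundedLT.induction with
  | ind x ih =>
    obtain ⟨y, hy⟩ := exists_parent hx
    have h1 := rank_lt_of_covBy hy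
    by_cases hr : y = root
    · rwa [hr, rank_root] at h1
    · exact h1.trans (ih y hy.lt hr)

/-- The children of a node. -/
def children (x : Node d t) : List (Node d t) := List.ofFn fun i => x.child i i.2

theorem mem_children {x y : Node d t} : y ∈ x.children ↔ x ⋖ y := by
  rw [children, List.mem_ofFn, covBy_iff]
  exact ⟨fun ⟨i, h⟩ => ⟨i, i.2, h.symm⟩, fun ⟨i, hi, h⟩ => ⟨⟨i, hi⟩, h.symm⟩⟩

theorem length_children (x : Node d t) : x.children.length = (x.label.kids d).length := by
  simp [children]

theorem card_le_ncard_children {x : Node d t} {r : ℕ} (I : Finset ℕ)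
    (hI : ∀ i ∈ I, ∃ h : i < (x.label.kids d).length, (x.label.kids d)[i].rank = r) :
    I.card ≤ {y | x ⋖ y ∧ y.rank = r}.ncard := by
  classical
  rw [← Set.ncard_coe_finset]
  refine Set.ncard_le_ncard_of_injOn
    (fun i => if h : i < (x.label.kids d).length then x.child i h else x) ?_ ?_
  · intro i hi
    obtain ⟨h, hr⟩ := hI i hi
    rw [dif_pos h]
    exact ⟨covBy_iff.2 ⟨i, h, rfl⟩, by rw [rank, label_child, hr]⟩
  · intro i hi j hj hij
    obtain ⟨h, _⟩ := hI i hi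
    obtain ⟨h', _⟩ := hI j hj
    simp only [dif_pos h, dif_pos h'] at hij
    exact child_injective hij

theorem le_ncard_children_of_chain {x : Node d t} {j : ℕ} (hx : x.label = Label.chain (j + 1)) :
    d ≤ {y | x ⋖ y ∧ y.rank = 2 * j + 1}.ncard := by
  have := card_le_ncard_children (x := x) (r := 2 * j + 1) (Finset.Icc 1 d) (by
    intro i hi
    rw [Finset.mem_Icc] at hi
    refine ⟨by simp only [hx, Label.kids, List.length_cons, List.length_replicate]; omega, ?_⟩
    obtain ⟨i, rfl⟩ : ∃ m, i = m + 1 := ⟨i - 1, by omega⟩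
    simp [hx, Label.kids, Label.rank])
  simpa using this

/-- Together with its parent, a node thus keeps three neighbours until all nodes of smaller rank are
gone. This is what prevents nodes of degree two. -/
theorem two_le_ncard_children {x : Node d t} (hd : 2 ≤ d) (hx : 0 < x.rank) :
    2 ≤ {y | x ⋖ y ∧ y.rank = x.rank - 1}.ncard := by
  rcases h : x.label with (_ | j) | (_ | r)
  · rw [rank, h] at hx
    simp [Label.rank] at hx
  · have := le_ncard_children_of_chain h
    have hr : x.rank - 1 = 2 * j + 1 := by rw [rank, h, Label.rank]; omega
    rw [hr]
    omega
  · rw [rank, h] at hx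
    simp [Label.rank] at hx
  · have hr : x.rank - 1 = r := by rw [rank, h, Label.rank]; omega
    rw [hr]
    have := card_le_ncard_children (x := x) (r := r) (Finset.range 2) (by
      intro i hi
      rw [Finset.mem_range] at hi
      refine ⟨by simpa [h, Label.kids] using hi, ?_⟩
      interval_cases i <;> simp [h, Label.kids, Label.rank])
    simpa using this

end Node

end LineLeaf
-- The contraction of the family, and cheap search trees for it.
namespace LineLeaf

theorem length_add_height_le {S : Type*} (st : Stage S) (x : S) (ys : List S) :
    ys.length + (st.lst x).height ≤ (addQueries st x ys).height := by
  induction ys with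
  | nil => simp [addQueries]
  | cons y ys ih =>
    rw [addQueries] at ih ⊢
    rw [List.foldr_cons, SearchTree.height, List.length_cons]
    omega

theorem height_lt_of_mem {S : Type*} (st : Stage S) (x : S) {y : S} {ys : List S} (hy : y ∈ ys) :
    (st.lst y).height + 1 ≤ (addQueries st x ys).height := by
  induction ys with
  | nil => simp at hy
  | cons z ys ih =>
    rw [addQueries] at ih ⊢
    rw [List.foldr_cons, SearchTree.height]
    rcases List.mem_cons.1 hy with rfl | hy
    · omega
    · have := ih hy
      omega

namespace Node

variable {d k : ℕ}

theorem _root_.LineLeaf.Label.descend_replicate (d : ℕ) : ∀ m k : ℕ, m ≤ k →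
    (Label.chain k).descend d (List.replicate m 0) = some (Label.chain (k - m))
  | 0, k, _ => by simp [Label.descend]
  | m + 1, 0, h => by omega
  | m + 1, k + 1, h => by
    simp only [List.replicate_succ, Label.descend, Label.kids, List.getElem?_cons_zero,
      Option.bind_some, Nat.add_sub_add_right]
    exact Label.descend_replicate d m k (by omega)

/-- The node labelled `chain j`. -/
def link (d k j : ℕ) : Node d (Label.chain k) where
  path := List.replicate (k - j) 0
  valid := by rw [Label.descend_replicate d _ _ (Nat.sub_le _ _)]; rfl

theorem label_link {j : ℕ} (hj : j ≤ k) : (link d k j).label = Label.chain j := by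
  refine label_eq ?_
  rw [link, Label.descend_replicate d _ _ (Nat.sub_le _ _), Nat.sub_sub_self hj]

theorem rank_link {j : ℕ} (hj : j ≤ k) : (link d k j).rank = 2 * j := by
  rw [rank, label_link hj, Label.rank]

theorem link_self : link d k k = root := by
  refine ext_path ?_
  simp [link, root]

theorem link_succ_covBy {j : ℕ} (hj : j < k) : link d k (j + 1) ⋖ link d k j := by
  refine covBy_iff.2 ⟨0, by simp [label_link (show j + 1 ≤ k from hj), Label.kids], ?_⟩
  refine ext_path ?_
  have : k - j = (k - (j + 1)) + 1 := by omega
  change List.replicate (k - j) 0 = List.replicate (k - (j + 1)) 0 ++ [0]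
  rw [this, List.replicate_succ']

/-- The `i`-th stage of the contraction. -/
structure AtStage (i : ℕ) (st : Stage (Node d (Label.chain k))) : Prop where
  live_eq : st.live = {x | i ≤ x.rank}
  adj_iff : ∀ x y, st.graph.Adj x y ↔ (x ⋖ y ∨ y ⋖ x) ∧ i ≤ x.rank ∧ i ≤ y.rank
  -- In iteration `2 * j` the node `chain (j + 1)` absorbs `chain j`, in the next one its `d`
  -- fillers; the two bounds record the height before and between these events.
  lst_even : ∀ j ≤ k, 2 * j ≤ i → j * d ≤ (st.lst (link d k j)).height
  lst_odd : ∀ j < k, 2 * j + 1 ≤ i → j * d + 1 ≤ (st.lst (link d k (j + 1))).height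

namespace AtStage

variable {i : ℕ} {st : Stage (Node d (Label.chain k))}

theorem initial : AtStage 0 (initial (Node d (Label.chain k))) where
  live_eq := by simp [LineLeaf.initial]
  adj_iff x y := by simp [LineLeaf.initial]
  lst_even j _ h := by
    obtain rfl : j = 0 := by omega
    simp
  lst_odd j _ h := by omega

/-- The children have smaller rank and are gone, the parent has larger rank and is still present. -/
theorem deg_eq_one (h : AtStage i st) (hi : i < 2 * k) {x : Node d (Label.chain k)}
    (hx : x.rank = i) : deg st.graph x = 1 := by
  obtain ⟨p, hp⟩ := exists_parent (x := x) (by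
    rintro rfl
    rw [rank_root, Label.rank] at hx
    omega)
  have : st.graph.neighborSet x = {p} := by
    ext y
    rw [SimpleGraph.mem_neighborSet, h.adj_iff, Set.mem_singleton_iff]
    constructor
    · rintro ⟨hy | hy, _, h2⟩
      · have := rank_lt_of_covBy hy
        omega
      · exact eq_of_covBy hy hp
    · rintro rfl
      exact ⟨Or.inr hp, by omega, by have := rank_lt_of_covBy hp; omega⟩
  rw [deg, this, Set.ncard_singleton]

/-- An inner node has its parent and two children of the next smaller rank; the root has no parent,
but `d ≥ 3` children of the next smaller rank. -/
theorem three_le_deg (h : AtStage i st) (hd : 3 ≤ d) (hk : 0 < k)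
    {x : Node d (Label.chain k)} (hx : i < x.rank) : 3 ≤ deg st.graph x := by
  by_cases hr : x = root
  · subst hr
    have hl : (root : Node d (Label.chain k)).label = Label.chain (k - 1 + 1) := by
      rw [← link_self, label_link le_rfl, Nat.sub_add_cancel hk]
    have h1 := le_ncard_children_of_chain hl
    refine (hd.trans h1).trans (Set.ncard_le_ncard fun y hy => ?_)
    rw [SimpleGraph.mem_neighborSet, h.adj_iff]
    rw [rank_root, Label.rank] at hx ⊢
    exact ⟨Or.inl hy.1, by omega, by have := hy.2; omega⟩
  · obtain ⟨p, hp⟩ := exists_parent hr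
    have h1 := two_le_ncard_children (x := x) (by omega) (by omega)
    have h2 : insert p {y | x ⋖ y ∧ y.rank = x.rank - 1} ⊆ st.graph.neighborSet x := by
      rintro y (rfl | hy)
      · rw [SimpleGraph.mem_neighborSet, h.adj_iff]
        exact ⟨Or.inr hp, by omega, by have := rank_lt_of_covBy hp; omega⟩
      · rw [SimpleGraph.mem_neighborSet, h.adj_iff]
        exact ⟨Or.inl hy.1, by omega, by have := hy.2; omega⟩
    have h3 := Set.ncard_le_ncard h2
    rw [Set.ncard_insert_of_notMem] at h3
    · change _ ≤ deg st.graph x at h3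
      omega
    · rintro ⟨hy, _⟩
      exact absurd (hy.lt.trans hp.lt) (lt_irrefl _)

theorem deg_ne_two (h : AtStage i st) (hd : 3 ≤ d) (hi : i < 2 * k)
    (x : Node d (Label.chain k)) : deg st.graph x ≠ 2 := by
  rcases lt_trichotomy x.rank i with hx | hx | hx
  · have : st.graph.neighborSet x = ∅ := by
      ext y
      rw [SimpleGraph.mem_neighborSet, h.adj_iff]
      simp only [Set.mem_empty_iff_false, iff_false]
      rintro ⟨_, h1, _⟩
      omega
    rw [deg, this, Set.ncard_empty]
    omega
  · rw [h.deg_eq_one hi hx]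
    omega
  · have := h.three_le_deg hd (by omega) hx
    omega

/-- There are no nodes of degree two, so every line is a single edge and nothing changes that the
invariant speaks of. -/
theorem lineContraction (h : AtStage i st) (hd : 3 ≤ d) (hi : i < 2 * k)
    {st' : Stage (Node d (Label.chain k))} (hc : LineContraction st st') : AtStage i st' where
  live_eq := by
    rw [hc.live_eq, ← h.live_eq]
    ext x
    simp [h.deg_ne_two hd hi x]
  adj_iff x y := by
    rw [hc.adj_iff, ← h.adj_iff]
    constructor
    · rintro ⟨p, hp⟩
      have h1 : p.length = 1 := by
        have h0 := hp.length_pos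
        by_contra hne
        exact h.deg_ne_two hd hi _ (hp.deg_getVert (i := 1) (by omega) (by omega))
      exact SimpleGraph.Walk.adj_of_length_eq_one h1
    · intro hxy
      refine ⟨hxy.toWalk, by simp [hxy.ne], hxy.ne, h.deg_ne_two hd hi x, h.deg_ne_two hd hi y, ?_⟩
      intro z hz h1 h2
      simp at hz
      tauto
  lst_even := by rw [hc.lst_eq]; exact h.lst_even
  lst_odd := by rw [hc.lst_eq]; exact h.lst_odd

theorem leafContraction (h : AtStage i st) (hd : 3 ≤ d) (hi : i < 2 * k)
    {st' : Stage (Node d (Label.chain k))} (hc : LeafContraction st st') :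
    AtStage (i + 1) st' := by
  classical
  have hset : {x ∈ st.live | deg st.graph x ≠ 1} = {x | i + 1 ≤ x.rank} := by
    ext x
    rw [h.live_eq]
    simp only [Set.mem_ofPred_eq]
    constructor
    · rintro ⟨h1, h2⟩
      rcases h1.eq_or_lt with h3 | h3
      · exact absurd (h.deg_eq_one hi h3.symm) h2
      · exact h3
    · intro h1
      have := h.three_le_deg hd (by omega) (x := x) (by omega)
      exact ⟨by omega, by omega⟩
  have hlive : st'.live = {x | i + 1 ≤ x.rank} := by
    rw [← hset]
    refine hc.live_eq ?_
    rw [hset]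
    exact ⟨root, by rw [Set.mem_ofPred_eq, rank_root, Label.rank]; omega⟩
  have hmono : ∀ x, (st.lst x).height ≤ (st'.lst x).height := by
    intro x
    by_cases hx : x ∈ st'.live
    · obtain ⟨ys, _, _, h1⟩ := hc.lst_live x hx
      rw [h1]
      exact (Nat.le_add_left _ _).trans (length_add_height_le st x ys)
    · rw [hc.lst_dead x hx]
  refine ⟨hlive, fun x y => ?_, fun j hj hij => ?_, fun j hj hij => ?_⟩
  · rw [hc.adj_iff, h.adj_iff, hlive]
    simp only [Set.mem_ofPred_eq]
    refine ⟨fun h1 => ⟨h1.1.1, h1.2⟩, fun h1 => ⟨⟨h1.1, ?_⟩, h1.2⟩⟩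
    omega
  · by_cases hlt : 2 * j ≤ i
    · exact (h.lst_even j hj hlt).trans (hmono _)
    -- The `d` fillers of rank `2 * j + 1` are absorbed now. Their queries precede a tree of height
    -- at least `j * d + 1`, so the result has height at least `(j + 1) * d`.
    · obtain ⟨j, rfl⟩ : ∃ m, j = m + 1 := ⟨j - 1, by omega⟩
      obtain rfl : i = 2 * j + 1 := by omega
      have h1 := h.lst_odd j (by omega) le_rfl
      have hr := rank_link (d := d) hj
      obtain ⟨ys, _, hys, h2⟩ := hc.lst_live (link d k (j + 1)) (by
        rw [hlive, Set.mem_ofPred_eq]; omega)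
      rw [h2]
      refine le_trans ?_ (length_add_height_le st _ ys)
      have h3 := le_ncard_children_of_chain (label_link (d := d) hj)
      have h4 : {y | link d k (j + 1) ⋖ y ∧ y.rank = 2 * j + 1} ⊆ (ys.toFinset : Set _) := by
        rintro y ⟨hy1, hy2⟩
        rw [List.coe_toFinset, Set.mem_ofPred_eq, hys, h.adj_iff, hlive]
        exact ⟨⟨Or.inl hy1, by omega, by omega⟩, by rw [Set.mem_ofPred_eq]; omega⟩
      have h5 := Set.ncard_le_ncard h4
      rw [Set.ncard_coe_finset] at h5
      have h6 := ys.toFinset_card_le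
      rw [Nat.succ_mul]
      omega
  · by_cases hlt : 2 * j + 1 ≤ i
    · exact (h.lst_odd j hj hlt).trans (hmono _)
    -- Now `chain j` is absorbed, and its whole tree hangs below the new query.
    · obtain rfl : i = 2 * j := by omega
      have h1 := h.lst_even j hj.le le_rfl
      have hr := rank_link (d := d) (show j + 1 ≤ k from hj)
      have hr' := rank_link (d := d) hj.le
      obtain ⟨ys, _, hys, h2⟩ := hc.lst_live (link d k (j + 1)) (by
        rw [hlive, Set.mem_ofPred_eq]; omega)
      rw [h2]
      refine le_trans ?_ (height_lt_of_mem st _ (y := link d k j) ?_)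
      · omega
      · rw [hys, h.adj_iff, hlive]
        exact ⟨⟨Or.inl (link_succ_covBy hj), by omega, by omega⟩,
          by rw [Set.mem_ofPred_eq]; omega⟩

theorem exists_of_reachable (hd : 3 ≤ d)
    (hst : Relation.ReflTransGen Iteration (LineLeaf.initial _) st) :
    ∃ i ≤ 2 * k, AtStage i st := by
  induction hst with
  | refl => exact ⟨0, Nat.zero_le _, initial⟩
  | tail _ hit ih =>
    obtain ⟨i, hi, h⟩ := ih
    obtain ⟨hn, st₁, h1, h2⟩ := hit
    have hlt : i < 2 * k := by
      by_contra hc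
      obtain ⟨x, hx, hne⟩ := hn.exists_ne root
      rw [h.live_eq] at hx
      have := rank_lt_rank_root hne
      rw [Label.rank] at this
      have hx : i ≤ x.rank := hx
      omega
    exact ⟨i + 1, hlt, (h.lineContraction hd hlt h1).leafContraction hd hlt h2⟩

end AtStage

/-- The Line-Leaf Trees of the family are high. -/
theorem mul_le_height (hd : 3 ≤ d) {T : SearchTree (Node d (Label.chain k))}
    (hT : IsLineLeafTree T) : k * d ≤ T.height := by
  obtain ⟨st, r, hst, hlive, rfl⟩ := hT
  obtain ⟨i, hi, h⟩ := AtStage.exists_of_reachable hd hst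
  have hroot : (root : Node d (Label.chain k)) ∈ st.live := by
    rw [h.live_eq, Set.mem_ofPred_eq, rank_root, Label.rank]
    exact hi
  have hr : root = r := by rwa [hlive] at hroot
  -- At an earlier stage the root still has live children, namely the fillers of rank `2 * k - 1`,
  -- so more than one node is left.
  have hik : i = 2 * k := by
    by_contra hne
    obtain ⟨j, rfl⟩ : ∃ m, k = m + 1 := ⟨k - 1, by omega⟩
    have h1 := le_ncard_children_of_chain (label_link (d := d) (le_refl (j + 1)))
    obtain ⟨y, hy1, hy2⟩ := (Set.ncard_pos (Set.toFinite _)).1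
      (lt_of_lt_of_le (by omega : 0 < d) h1)
    have h2 : y ∈ st.live := by
      rw [h.live_eq, Set.mem_ofPred_eq]
      omega
    rw [hlive, Set.mem_singleton_iff, ← hr, ← link_self] at h2
    exact hy1.lt.ne h2.symm
  have := h.lst_even k le_rfl hik.ge
  rwa [link_self, hr] at this

theorem searchable_of_children {x : Node d (Label.chain k)} {U : Set (Node d (Label.chain k))}
    {h : ℕ} (hU : U ⊆ Set.Ici x) (hc : ∀ y, x ⋖ y → Searchable (U ∩ Set.Ici y) h) :
    Searchable U (h + (x.label.kids d).length) := by
  rw [← length_children]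
  refine Searchable.splitList le_total_of_le root_le (x := x) _ U
    (fun y hy => mem_children.1 hy) ?_ (fun y hy => hc y (mem_children.1 hy))
  refine (Searchable.singleton x).mono (fun u hu => ?_) (Nat.zero_le _)
  rcases (show x ≤ u from hU hu.1).eq_or_lt with h | h
  · exact h.symm
  · obtain ⟨y, hy, hyu⟩ := exists_covBy_le_of_lt h
    exact absurd ⟨y, mem_children.2 hy, hyu⟩ hu.2

/-- Two queries, one for each child, settle one level of a complete binary tree. -/
theorem searchable_filler (r : ℕ) : ∀ x : Node d (Label.chain k), x.label = Label.filler r →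
    Searchable (Set.Ici x) (2 * r) := by
  induction r with
  | zero =>
    intro x hx
    have := searchable_of_children (x := x) (h := 0) subset_rfl (fun y hy => by
      obtain ⟨i, hi, rfl⟩ := covBy_iff.1 hy
      simp [hx, Label.kids] at hi)
    simpa [hx, Label.kids] using this
  | succ r ih =>
    intro x hx
    have := searchable_of_children (x := x) (h := 2 * r) subset_rfl (fun y hy => by
      obtain ⟨i, hi, rfl⟩ := covBy_iff.1 hy
      refine (ih _ ?_).mono Set.inter_subset_right le_rfl
      rw [label_child]
      simp only [hx, Label.kids, List.length_cons, List.length_nil] at hi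
      interval_cases i <;> simp [hx, Label.kids])
    simpa [hx, Label.kids, Nat.mul_add] using this

/-- The edge to the next link is asked first. Its two sides are then searched separately, so the
cost `d + 1` of the siblings is not added up along the chain; a link adds only one query. -/
theorem searchable_chain (j : ℕ) (hj : j ≤ k) :
    ∀ x : Node d (Label.chain k), x.label = Label.chain j →
      Searchable (Set.Ici x) (d + 4 * k + j) := by
  induction j with
  | zero =>
    intro x hx
    have := searchable_of_children (x := x) (h := 0) subset_rfl (fun y hy => by
      obtain ⟨i, hi, rfl⟩ := covBy_iff.1 hy
      simp [hx, Label.kids] at hi)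
    exact this.mono subset_rfl (by simp [hx, Label.kids])
  | succ j ih =>
    intro x hx
    have hlen : (x.label.kids d).length = d + 1 := by simp [hx, Label.kids]
    have hcov : x ⋖ x.child 0 (by omega) := covBy_iff.2 ⟨0, _, rfl⟩
    refine Searchable.split le_total_of_le root_le hcov ?_ ?_
    · have := searchable_of_children (x := x) (U := Set.Ici x \ Set.Ici (x.child 0 (by omega)))
        (h := 2 * (2 * j + 1)) Set.sdiff_subset (fun y hy => by
        obtain ⟨i, hi, rfl⟩ := covBy_iff.1 hy
        rcases i with _ | i
        -- The child with index 0 has been split off already, so nothing is left to be found above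
        -- it.
        · exact (Searchable.singleton x).mono (fun u hu => absurd hu.2 hu.1.2) (Nat.zero_le _)
        · refine (searchable_filler (2 * j + 1) _ ?_).mono Set.inter_subset_right le_rfl
          rw [label_child]
          simp [hx, Label.kids])
      -- The siblings cost `2 * (2 * j + 1) + (d + 1)`, which is at most `d + 4 * k + j` because `j
      -- + 1 ≤ k`.
      exact this.mono subset_rfl (by change _ ≤ d + 4 * k + j; omega)
    · refine (ih (by omega) _ ?_).mono Set.inter_subset_right le_rfl
      rw [label_child]
      simp [hx, Label.kids]

theorem opt_le : opt (Node d (Label.chain k)) ≤ d + 5 * k := by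
  obtain ⟨T, hT, h⟩ := searchable_chain (d := d) k le_rfl (link d k k) (label_link le_rfl)
  have hT' : IsSearchTree T := fun u => hT u (by rw [link_self]; exact root_le u)
  have := hT'.opt_le
  omega

theorem le_width (hk : 0 < k) : d ≤ width (Node d (Label.chain k)) := by
  classical
  have := Fintype.ofFinite (Node d (Label.chain k))
  obtain ⟨j, rfl⟩ : ∃ m, k = m + 1 := ⟨k - 1, by omega⟩
  have h1 := le_ncard_children_of_chain (label_link (d := d) (le_refl (j + 1)))
  set A : Finset (Node d (Label.chain (j + 1))) :=
    Finset.univ.filter fun y => link d (j + 1) (j + 1) ⋖ y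
  have hA : IsAntichain (· ≤ ·) (A : Set (Node d (Label.chain (j + 1)))) := by
    intro x hx y hy hne hle
    have hx : link d (j + 1) (j + 1) ⋖ x := by simpa [A] using hx
    have hy : link d (j + 1) (j + 1) ⋖ y := by simpa [A] using hy
    exact hy.2 hx.lt (lt_of_le_of_ne hle hne)
  refine h1.trans ((Set.ncard_le_ncard fun y hy => ?_).trans
    ((Set.ncard_coe_finset A).le.trans (card_le_width hA)))
  simpa [A] using hy.1

end Node

/-- There are tree-like posets of arbitrarily large width all of whose Line-Leaf Trees are higher
than optimal search trees by a factor that is logarithmic in the width. -/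
theorem exists_high_lineLeafTrees (W : ℕ) : ∃ (S : Type) (_ : PartialOrder S), TreeLike S ∧
    W ≤ width S ∧ ∀ T : SearchTree S, IsLineLeafTree T →
      1 / 72 * Real.logb 2 (width S) * opt S ≤ (T.height : ℝ) := by
  -- Both parameters of the family are `k`; the summand 3 ensures that no nodes of degree two occur.
  set k := W + 3
  refine ⟨Node k (Label.chain k), inferInstance, Node.treeLike,
    le_trans (by omega) (Node.le_width (by omega)), fun T hT => ?_⟩
  have hS : TreeLike (Node k (Label.chain k)) := Node.treeLike
  have h1 : (k : ℝ) * k ≤ T.height := by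
    exact_mod_cast Node.mul_le_height (by omega) hT
  have h2 : (opt (Node k (Label.chain k)) : ℝ) ≤ 6 * k := by
    have := Node.opt_le (d := k) (k := k)
    have : opt (Node k (Label.chain k)) ≤ 6 * k := by omega
    exact_mod_cast this
  -- From `w ≤ n ≤ 3 ^ OPT ≤ 4 ^ OPT`. With `OPT ≤ 6 * k`, the product `log₂ w * OPT` is at most `2
  -- * (6 * k) ^ 2 = 72 * k ^ 2`, which explains the constant.
  have h3 : Real.logb 2 (width (Node k (Label.chain k))) ≤ 2 * opt (Node k (Label.chain k)) := by
    have hpos := hS.width_pos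
    have h4 : width (Node k (Label.chain k)) ≤ 2 ^ (2 * opt (Node k (Label.chain k))) := by
      rw [pow_mul]
      exact (width_le_card.trans hS.card_le).trans (Nat.pow_le_pow_left (by norm_num) _)
    have h5 : (width (Node k (Label.chain k)) : ℝ) ≤ 2 ^ (2 * opt (Node k (Label.chain k))) := by
      exact_mod_cast h4
    have h6 := Real.logb_le_logb_of_le (b := 2) (by norm_num) (by positivity) h5
    rw [Real.logb_pow, Real.logb_self_eq_one (by norm_num), mul_one] at h6
    exact_mod_cast h6
  have h7 : (0 : ℝ) ≤ opt (Node k (Label.chain k)) := Nat.cast_nonneg _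
  nlinarith [mul_le_mul_of_nonneg_right h3 h7, mul_le_mul h2 h2 h7 (by positivity)]

end LineLeaf
-- Statement (c): a verified linear-time program.
namespace LineLeaf

/-! ## Programs on arrays and their verification conditions -/

/-- A state of the array machine: registers, the arrays `0, …, 14`, and the heap as array `15`. -/
structure Mach where
  reg : ℕ → ℕ
  arr : ℕ → ℕ → ℕ

/-- Programs with array accesses: `ld i k e` loads entry `e` of array `k` into register `i`,
`st k e v` stores `v` into entry `e` of array `k`, `hst e v` stores `v` into the heap cell `e`. -/
inductive Cmd
  | nop
  | asg (i : ℕ) (e : Expr)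
  | ld (i k : ℕ) (e : Expr)
  | st (k : ℕ) (e v : Expr)
  | hst (e v : Expr)
  | seq (p q : Cmd)
  | ite (e : Expr) (p q : Cmd)
  | loop (e : Expr) (p : Cmd)

/-- Multiplication by a constant. -/
def Expr.mulc (e : Expr) : ℕ → Expr
  | 0 => Expr.const 0
  | c + 1 => Expr.add (e.mulc c) e

theorem Expr.eval_mulc (ρ : ℕ → ℕ) (e : Expr) (c : ℕ) : (e.mulc c).eval ρ = c * e.eval ρ := by
  induction c with
  | zero => simp [mulc, eval]
  | succ c ih => rw [mulc, eval, ih, Nat.succ_mul]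

/-- The address of an array entry; register `0` holds half the size of the arrays. -/
def entry (k : ℕ) (e : Expr) : Expr := Expr.add ((Expr.reg 0).mulc (2 * k)) e

namespace Cmd

/-- The program of the random access machine. -/
def compile : Cmd → Program
  | nop => Program.nop
  | asg i e => Program.assign i e
  | ld i k e => Program.load i (entry k e)
  | st k e v => Program.store (entry k e) v
  | hst e v => Program.store e v
  | seq p q => Program.seq p.compile q.compile
  | ite e p q => Program.ite e p.compile q.compile
  | loop e p => Program.loop e p.compile

/-- A sequence of programs. -/
def block : List Cmd → Cmd
  | [] => nop
  | c :: cs => seq c (block cs)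

/-- The weakest precondition of at most `N - 1` rounds of a loop. -/
def loopVC (e : Expr) (body : (ℕ → Mach → Prop) → Mach → Prop) :
    ℕ → (ℕ → Mach → Prop) → Mach → Prop
  | 0, _, _ => False
  | N + 1, Q, s => (e.eval s.reg = 0 → Q 1 s) ∧ (e.eval s.reg ≠ 0 →
      body (fun t s' => loopVC e body N (fun t' s'' => Q (t + t' + 1) s'') s') s)

/-- The weakest precondition for the postcondition `Q`, which also concerns the number of steps. -/
def vc (n B : ℕ) : Cmd → (ℕ → Mach → Prop) → Mach → Prop
  | nop, Q, s => Q 1 s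
  -- Register `0` must keep `n`, because array addresses are computed from it.
  | asg i e, Q, s => i ≠ 0 ∧ e.eval s.reg ≤ B ∧ Q 1 ⟨Function.update s.reg i (e.eval s.reg), s.arr⟩
  | ld i k e, Q, s => (i ≠ 0 ∧ k < 15) ∧ e.eval s.reg < 2 * n ∧
      -- A loaded value may be assumed to be at most `B`: `Rep` maintains this bound for all memory
      -- cells.
      (s.arr k (e.eval s.reg) ≤ B →
        Q 1 ⟨Function.update s.reg i (s.arr k (e.eval s.reg)), s.arr⟩)
  | st k e v, Q, s => k < 15 ∧ e.eval s.reg < 2 * n ∧ v.eval s.reg ≤ B ∧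
      Q 1 ⟨s.reg, Function.update s.arr k (Function.update (s.arr k) (e.eval s.reg)
        (v.eval s.reg))⟩
  | hst e v, Q, s => (30 * n ≤ e.eval s.reg ∧ e.eval s.reg ≤ B) ∧ v.eval s.reg ≤ B ∧
      Q 1 ⟨s.reg, Function.update s.arr 15 (Function.update (s.arr 15) (e.eval s.reg)
        (v.eval s.reg))⟩
  | seq p q, Q, s => p.vc n B (fun t s' => q.vc n B (fun t' s'' => Q (t + t') s'') s') s
  | ite e p q, Q, s => (e.eval s.reg ≠ 0 → p.vc n B (fun t s' => Q (t + 1) s') s) ∧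
      (e.eval s.reg = 0 → q.vc n B (fun t s' => Q (t + 1) s') s)
  | loop e p, Q, s => ∃ N, loopVC e (p.vc n B) N Q s

variable {n B : ℕ}

section Equations

variable {Q : ℕ → Mach → Prop} {s : Mach} {i k : ℕ} {e v : Expr} {p q : Cmd} {cs : List Cmd}

@[simp] theorem vc_nop : nop.vc n B Q s ↔ Q 1 s := Iff.rfl

@[simp] theorem vc_asg : (asg i e).vc n B Q s ↔ i ≠ 0 ∧ e.eval s.reg ≤ B ∧
    Q 1 ⟨Function.update s.reg i (e.eval s.reg), s.arr⟩ := Iff.rfl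

@[simp] theorem vc_ld : (ld i k e).vc n B Q s ↔ (i ≠ 0 ∧ k < 15) ∧ e.eval s.reg < 2 * n ∧
    (s.arr k (e.eval s.reg) ≤ B →
      Q 1 ⟨Function.update s.reg i (s.arr k (e.eval s.reg)), s.arr⟩) := Iff.rfl

@[simp] theorem vc_st : (st k e v).vc n B Q s ↔ k < 15 ∧ e.eval s.reg < 2 * n ∧ v.eval s.reg ≤ B ∧
    Q 1 ⟨s.reg, Function.update s.arr k (Function.update (s.arr k) (e.eval s.reg)
      (v.eval s.reg))⟩ := Iff.rfl

@[simp] theorem vc_hst : (hst e v).vc n B Q s ↔ (30 * n ≤ e.eval s.reg ∧ e.eval s.reg ≤ B) ∧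
    v.eval s.reg ≤ B ∧ Q 1 ⟨s.reg, Function.update s.arr 15 (Function.update (s.arr 15)
      (e.eval s.reg) (v.eval s.reg))⟩ := Iff.rfl

@[simp] theorem vc_ite : (ite e p q).vc n B Q s ↔ (e.eval s.reg ≠ 0 → p.vc n B (fun t s' => Q (t + 1) s') s)
    ∧ (e.eval s.reg = 0 → q.vc n B (fun t s' => Q (t + 1) s') s) := Iff.rfl

@[simp] theorem vc_block_nil : (block []).vc n B Q s ↔ Q 1 s := Iff.rfl

@[simp] theorem vc_block_cons : (block (p :: cs)).vc n B Q s ↔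
    p.vc n B (fun t s' => (block cs).vc n B (fun t' s'' => Q (t + t') s'') s') s := Iff.rfl

end Equations

theorem loopVC_mono {e : Expr} {body : (ℕ → Mach → Prop) → Mach → Prop}
    (hb : ∀ (Q Q' : ℕ → Mach → Prop) (s : Mach), (∀ t s, Q t s → Q' t s) → body Q s → body Q' s)
    (N : ℕ) : ∀ (Q Q' : ℕ → Mach → Prop) (s : Mach), (∀ t s, Q t s → Q' t s) →
      loopVC e body N Q s → loopVC e body N Q' s := by
  induction N with
  | zero => exact fun _ _ _ _ h => h
  | succ N ih =>
    exact fun Q Q' s hQ h => ⟨fun he => hQ _ _ (h.1 he), fun he =>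
      hb _ _ _ (fun _ _ h' => ih _ _ _ (fun _ _ => hQ _ _) h') (h.2 he)⟩

theorem vc_mono {p : Cmd} : ∀ {Q Q' : ℕ → Mach → Prop} {s : Mach}, p.vc n B Q s →
    (∀ t s, Q t s → Q' t s) → p.vc n B Q' s := by
  induction p with
  | nop => exact fun h hQ => hQ _ _ h
  | asg i e => exact fun h hQ => ⟨h.1, h.2.1, hQ _ _ h.2.2⟩
  | ld i k e => exact fun h hQ => ⟨h.1, h.2.1, fun hv => hQ _ _ (h.2.2 hv)⟩
  | st k e v => exact fun h hQ => ⟨h.1, h.2.1, h.2.2.1, hQ _ _ h.2.2.2⟩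
  | hst e v => exact fun h hQ => ⟨h.1, h.2.1, hQ _ _ h.2.2⟩
  | seq p q ihp ihq => exact fun h hQ => ihp h fun _ _ h' => ihq h' fun _ _ => hQ _ _
  | ite e p q ihp ihq =>
    exact fun h hQ => ⟨fun he => ihp (h.1 he) fun _ _ => hQ _ _,
      fun he => ihq (h.2 he) fun _ _ => hQ _ _⟩
  | loop e p ih =>
    rintro Q Q' s ⟨N, h⟩ hQ
    exact ⟨N, loopVC_mono (body := p.vc n B) (fun _ _ _ hQ h => ih h hQ) N _ _ _ hQ h⟩

/-- Total correctness with a variant: `k` decreases in every round, so `k + 1` units of fuel suffice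
for `loopVC`. The argument `t` of the invariant is the number of steps since the loop was entered.
-/
theorem vc_loop {e : Expr} {p : Cmd} {Q : ℕ → Mach → Prop} (I : ℕ → ℕ → Mach → Prop)
    (h : ∀ k t s, I k t s → (e.eval s.reg = 0 → Q (t + 1) s) ∧ (e.eval s.reg ≠ 0 →
      p.vc n B (fun t' s' => ∃ k' < k, I k' (t + t' + 1) s') s)) {k : ℕ} {s : Mach}
    (h0 : I k 0 s) : (loop e p).vc n B Q s := by
  have key : ∀ k N t s, k < N → I k t s →
      loopVC e (p.vc n B) N (fun t' s' => Q (t + t') s') s := by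
    intro k N
    induction N generalizing k with
    | zero => intro t s hk; omega
    | succ N ih =>
      intro t s hk hI
      refine ⟨(h k t s hI).1, fun he => vc_mono ((h k t s hI).2 he) ?_⟩
      rintro t' s' ⟨k', hk', hI'⟩
      have := ih k' (t + t' + 1) s' (by omega) hI'
      refine loopVC_mono (body := p.vc n B) (fun _ _ _ hQ h => vc_mono h hQ) N _ _ _ (fun t'' s'' hQ => ?_) this
      change Q (t + (t' + t'' + 1)) s''
      rwa [show t + (t' + t'' + 1) = t + t' + 1 + t'' by ring]
  exact ⟨k + 1, by simpa using key k (k + 1) 0 s (Nat.lt_succ_self k) h0⟩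

/-- The rule for loops with `J` rounds; `I j t` holds after `j` rounds and `t` steps. -/
theorem vc_rounds {e : Expr} {p : Cmd} {Q : ℕ → Mach → Prop} (J : ℕ) (I : ℕ → ℕ → Mach → Prop)
    (hcond : ∀ j t s, I j t s → j ≤ J ∧ (e.eval s.reg ≠ 0 ↔ j < J))
    (hbody : ∀ j < J, ∀ t s, I j t s → p.vc n B (fun t' s' => I (j + 1) (t + t' + 1) s') s)
    {s : Mach} (h0 : I 0 0 s) (hQ : ∀ t s', I J t s' → Q (t + 1) s') :
    (loop e p).vc n B Q s := by
  refine vc_loop (fun k t s => ∃ j, j + k = J ∧ I j t s) ?_ (k := J) ⟨0, by omega, h0⟩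
  rintro k t s ⟨j, hj, hI⟩
  have hc := hcond j t s hI
  refine ⟨fun he => ?_, fun he => ?_⟩
  · have : ¬ j < J := fun h => hc.2.2 h he
    obtain rfl : j = J := by omega
    exact hQ t s hI
  · refine vc_mono (hbody j (hc.2.1 he) t s hI) fun t' s' h' => ⟨k - 1, ?_, j + 1, ?_, h'⟩
    · have := hc.2.1 he; omega
    · have := hc.2.1 he; omega

/-- The rule for loops with `J` rounds of at most `T` steps each. -/
theorem vc_for {e : Expr} {p : Cmd} {Q : ℕ → Mach → Prop} (J T : ℕ) (I : ℕ → Mach → Prop)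
    (hcond : ∀ j s, I j s → j ≤ J ∧ (e.eval s.reg ≠ 0 ↔ j < J))
    (hbody : ∀ j < J, ∀ s, I j s → p.vc n B (fun t s' => t ≤ T ∧ I (j + 1) s') s)
    {s : Mach} (h0 : I 0 s) (hQ : ∀ t s', t ≤ J * (T + 1) + 1 → I J s' → Q t s') :
    (loop e p).vc n B Q s := by
  refine vc_rounds J (fun j t s => t ≤ j * (T + 1) ∧ I j s) (fun j t s h => hcond j s h.2)
    (fun j hj t s h => vc_mono (hbody j hj s h.2) fun t' s' h' => ⟨?_, h'.2⟩) ⟨by simp, h0⟩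
    fun t s' h => hQ _ _ (by omega) h.2
  have := h.1
  have := h'.1
  rw [Nat.succ_mul]
  omega

/-- The memory `mem` holds the arrays of `s`. -/
structure Rep (n B : ℕ) (mem : ℕ → ℕ) (s : Mach) : Prop where
  size : s.reg 0 = n
  le : ∀ p, mem p ≤ B
  arr : ∀ k < 15, ∀ i < 2 * n, mem (2 * k * n + i) = s.arr k i
  heap : ∀ p, 30 * n ≤ p → mem p = s.arr 15 p

theorem eval_entry {s : Mach} {k : ℕ} {e : Expr} (h : s.reg 0 = n) :
    (entry k e).eval s.reg = 2 * k * n + e.eval s.reg := by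
  rw [entry, Expr.eval, Expr.eval_mulc, Expr.eval, h]

theorem entry_lt {k i : ℕ} (hk : k < 15) (hi : i < 2 * n) : 2 * k * n + i < 30 * n := by
  have : 2 * k * n ≤ 28 * n := Nat.mul_le_mul_right _ (by omega)
  omega

theorem entry_inj {k k' i i' : ℕ} (hi : i < 2 * n) (hi' : i' < 2 * n)
    (h : 2 * k * n + i = 2 * k' * n + i') : k = k' ∧ i = i' := by
  have key : ∀ {k k' i i' : ℕ}, i < 2 * n → 2 * k * n + i = 2 * k' * n + i' → ¬ k < k' := by
    intro k k' i i' hi h hlt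
    have : 2 * (k + 1) * n ≤ 2 * k' * n := Nat.mul_le_mul_right _ (by omega)
    have e : 2 * (k + 1) * n = 2 * k * n + 2 * n := by ring
    omega
  have h1 := key hi h
  have h2 := key hi' h.symm
  obtain rfl : k = k' := by omega
  exact ⟨rfl, by omega⟩

/-- Soundness of the weakest preconditions. From here on programs are analysed on `Mach`, where
arrays are disjoint by construction; `Rep` and `entry_inj` translate this back to one memory. -/
theorem exec_of_vc (hB : 30 * n ≤ B) {p : Cmd} : ∀ {Q : ℕ → Mach → Prop} {s : Mach} {mem : ℕ → ℕ},
    p.vc n B Q s → Rep n B mem s → ∃ t s' mem', Exec B p.compile ⟨s.reg, mem⟩ t ⟨s'.reg, mem'⟩ ∧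
      Rep n B mem' s' ∧ Q t s' := by
  induction p with
  | nop => exact fun h hr => ⟨1, _, _, Exec.nop _, hr, h⟩
  | asg i e =>
    intro Q s mem h hr
    refine ⟨1, ⟨Function.update s.reg i (e.eval s.reg), s.arr⟩, mem, Exec.assign i e _ h.2.1, ⟨?_, hr.le, hr.arr, hr.heap⟩, h.2.2⟩
    change Function.update s.reg i _ 0 = n
    rw [Function.update_of_ne (Ne.symm h.1), hr.size]
  | ld i k e =>
    intro Q s mem h hr
    have he := eval_entry (k := k) (e := e) hr.size
    have hlt := entry_lt h.1.2 h.2.1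
    have hv : mem ((entry k e).eval s.reg) = s.arr k (e.eval s.reg) := by
      rw [he, hr.arr k h.1.2 _ h.2.1]
    refine ⟨1, ⟨Function.update s.reg i (s.arr k (e.eval s.reg)), s.arr⟩, mem, ?_,
      ⟨?_, hr.le, hr.arr, hr.heap⟩, h.2.2 (hv ▸ hr.le _)⟩
    · rw [← hv]
      exact Exec.load i (entry k e) ⟨s.reg, mem⟩
        (by change (entry k e).eval s.reg ≤ B; omega) (hr.le _)
    · change Function.update s.reg i _ 0 = n
      rw [Function.update_of_ne (Ne.symm h.1.1), hr.size]
  | st k e v =>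
    intro Q s mem h hr
    have he := eval_entry (k := k) (e := e) hr.size
    have hlt := entry_lt h.1 h.2.1
    refine ⟨1, ⟨s.reg, Function.update s.arr k (Function.update (s.arr k) (e.eval s.reg)
      (v.eval s.reg))⟩, _, Exec.store _ _ _ (by change (entry k e).eval s.reg ≤ B; omega) h.2.2.1,
      ⟨hr.size, fun q => ?_, fun k' hk' i hi => ?_, fun q hq => ?_⟩, h.2.2.2⟩
    · change Function.update mem _ _ q ≤ B
      rw [Function.update_apply]
      split
      · exact h.2.2.1
      · exact hr.le q
    · change Function.update mem ((entry k e).eval s.reg) _ (2 * k' * n + i) =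
        Function.update s.arr k _ k' i
      rw [he]
      by_cases hk : k' = k
      · subst hk
        rw [Function.update_self]
        by_cases hii : i = e.eval s.reg
        · rw [hii, Function.update_self, Function.update_self]
        · rw [Function.update_of_ne hii, Function.update_of_ne (by omega), hr.arr _ hk' _ hi]
      · rw [Function.update_of_ne hk, Function.update_of_ne, hr.arr _ hk' _ hi]
        exact fun hc => hk (entry_inj hi h.2.1 hc).1
    · have := h.1
      change Function.update mem ((entry k e).eval s.reg) _ q = Function.update s.arr k _ 15 q
      rw [Function.update_of_ne (by omega), hr.heap q hq, Function.update_of_ne (by omega)]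
  | hst e v =>
    intro Q s mem h hr
    refine ⟨1, ⟨s.reg, Function.update s.arr 15 (Function.update (s.arr 15) (e.eval s.reg)
      (v.eval s.reg))⟩, _, Exec.store _ _ _ h.1.2 h.2.1,
      ⟨hr.size, fun q => ?_, fun k' hk' i hi => ?_, fun q hq => ?_⟩, h.2.2⟩
    · change Function.update mem _ _ q ≤ B
      rw [Function.update_apply]
      split
      · exact h.2.1
      · exact hr.le q
    · have := entry_lt hk' hi
      have := h.1.1
      change Function.update mem (e.eval s.reg) _ (2 * k' * n + i) = Function.update s.arr 15 _ k' i
      rw [Function.update_of_ne (by omega), Function.update_of_ne (by omega), hr.arr _ hk' _ hi]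
    · change Function.update mem (e.eval s.reg) (v.eval s.reg) q =
        Function.update s.arr 15 (Function.update (s.arr 15) (e.eval s.reg) (v.eval s.reg)) 15 q
      rw [Function.update_self, Function.update_apply, Function.update_apply, hr.heap q hq]
  | seq p q ihp ihq =>
    intro Q s mem h hr
    obtain ⟨t, s', mem', h1, hr', h2⟩ := ihp h hr
    obtain ⟨t', s'', mem'', h3, hr'', h4⟩ := ihq h2 hr'
    exact ⟨_, _, _, Exec.seq _ _ _ _ _ _ _ h1 h3, hr'', h4⟩
  | ite e p q ihp ihq =>
    intro Q s mem h hr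
    by_cases he : e.eval s.reg = 0
    · obtain ⟨t, s', mem', h1, hr', h2⟩ := ihq (h.2 he) hr
      exact ⟨_, _, _, Exec.iteFalse _ _ _ _ _ _ he h1, hr', h2⟩
    · obtain ⟨t, s', mem', h1, hr', h2⟩ := ihp (h.1 he) hr
      exact ⟨_, _, _, Exec.iteTrue _ _ _ _ _ _ he h1, hr', h2⟩
  | loop e p ih =>
    rintro Q s mem ⟨N, h⟩ hr
    induction N generalizing Q s mem with
    | zero => exact absurd h id
    | succ N ihN =>
      by_cases he : e.eval s.reg = 0
      · exact ⟨_, _, _, Exec.loopFalse _ _ _ he, hr, h.1 he⟩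
      · obtain ⟨t, s', mem', h1, hr', h2⟩ := ih (h.2 he) hr
        obtain ⟨t', s'', mem'', h3, hr'', h4⟩ := ihN h2 hr'
        exact ⟨_, _, _, Exec.loopTrue _ _ _ _ _ _ _ he h1 h3, hr'', h4⟩

end Cmd

/-! ## Trees on the heap -/

/-- The tree `T` is stored at address `p` of the heap `h`, using cells `lo, …, lim - 1` only. -/
inductive Stored {S : Type*} (nm : S → ℕ) (h : ℕ → ℕ) (lo lim : ℕ) : ℕ → SearchTree S → Prop
  | nil (p : ℕ) (hlo : lo ≤ p) (hlim : p + 6 ≤ lim) (h₀ : h p = 0) :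
      Stored nm h lo lim p SearchTree.nil
  | found (p : ℕ) (x : S) (hlo : lo ≤ p) (hlim : p + 6 ≤ lim) (h₀ : h p = 1)
      (h₁ : h (p + 1) = nm x) : Stored nm h lo lim p (SearchTree.found x)
  | query (p : ℕ) (x y : S) (tx there ty : SearchTree S) (hlo : lo ≤ p) (hlim : p + 6 ≤ lim)
      (h₀ : h p = 2) (h₁ : h (p + 1) = nm x) (h₂ : h (p + 2) = nm y)
      (hx : Stored nm h lo lim (h (p + 3)) tx) (hh : Stored nm h lo lim (h (p + 4)) there)
      (hy : Stored nm h lo lim (h (p + 5)) ty) :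
      Stored nm h lo lim p (SearchTree.query x y tx there ty)

namespace Stored

variable {S : Type*} {nm : S → ℕ} {h h' : ℕ → ℕ} {lo lim lim' p : ℕ} {T : SearchTree S}

theorem bounds (hT : Stored nm h lo lim p T) : lo ≤ p ∧ p + 6 ≤ lim := by
  cases hT <;> exact ⟨by assumption, by assumption⟩

/-- Finished records are never overwritten: all later writes to the heap take place at or above
`lim`, so the trees built so far persist. -/
theorem mono (hT : Stored nm h lo lim p T) (hh : ∀ q, lo ≤ q → q < lim → h' q = h q)
    (hl : lim ≤ lim') : Stored nm h' lo lim' p T := by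
  induction hT with
  | nil p hlo hlim h₀ => exact nil p hlo (by omega) (by rw [hh p hlo (by omega), h₀])
  | found p x hlo hlim h₀ h₁ =>
    exact found p x hlo (by omega) (by rw [hh p hlo (by omega), h₀])
      (by rw [hh _ (by omega) (by omega), h₁])
  | query p x y tx there ty hlo hlim h₀ h₁ h₂ _ _ _ ihx ihh ihy =>
    refine query p x y tx there ty hlo (by omega) (by rw [hh p hlo (by omega), h₀])
      (by rw [hh _ (by omega) (by omega), h₁]) (by rw [hh _ (by omega) (by omega), h₂]) ?_ ?_ ?_
    · rwa [hh _ (by omega) (by omega)]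
    · rwa [hh _ (by omega) (by omega)]
    · rwa [hh _ (by omega) (by omega)]

theorem storedAt (hT : Stored nm h lo lim p T) {mem : ℕ → ℕ} (hh : ∀ q, lo ≤ q → mem q = h q) :
    StoredAt nm mem p T := by
  induction hT with
  | nil p hlo hlim h₀ => exact StoredAt.nil p (by rw [hh p hlo, h₀])
  | found p x hlo hlim h₀ h₁ =>
    exact StoredAt.found p x (by rw [hh p hlo, h₀]) (by rw [hh _ (by omega), h₁])
  | query p x y tx there ty hlo hlim h₀ h₁ h₂ _ _ _ ihx ihh ihy =>
    refine StoredAt.query p x y tx there ty (by rw [hh p hlo, h₀]) (by rw [hh _ (by omega), h₁])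
      (by rw [hh _ (by omega), h₂]) ?_ ?_ ?_
    · rwa [hh _ (by omega)]
    · rwa [hh _ (by omega)]
    · rwa [hh _ (by omega)]

end Stored

end LineLeaf
namespace LineLeaf

/-! ## Binary search trees in the shape of a binary heap -/

namespace HeapShape

/-- The position of the leaf `i` of a heap with `m` inner nodes; its lowest leaves start at `p`. -/
def pos (m p i : ℕ) : ℕ := if i < p then i + m + 1 - p else i - p

/-- The position of the first leaf below node `i`. -/
def first (m p i : ℕ) : ℕ := if 0 < i ∧ i ≤ m then first m p (2 * i) else pos m p i
  termination_by m + 1 - i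

/-- The position of the last leaf below node `i`. -/
def last (m p i : ℕ) : ℕ := if i ≤ m then last m p (2 * i + 1) else pos m p i
  termination_by m + 1 - i

/-- The height of node `i`. -/
def height (m i : ℕ) : ℕ :=
  if 0 < i ∧ i ≤ m then max (height m (2 * i)) (height m (2 * i + 1)) + 1 else 0
  termination_by m + 1 - i

variable {m p : ℕ}

theorem first_node {i : ℕ} (h0 : 0 < i) (hi : i ≤ m) : first m p i = first m p (2 * i) := by
  rw [first, if_pos ⟨h0, hi⟩]

theorem first_leaf {i : ℕ} (hi : m < i) : first m p i = pos m p i := by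
  rw [first, if_neg (by omega)]

theorem last_node {i : ℕ} (hi : i ≤ m) : last m p i = last m p (2 * i + 1) := by
  rw [last, if_pos hi]

theorem last_leaf {i : ℕ} (hi : m < i) : last m p i = pos m p i := by
  rw [last, if_neg (by omega)]

theorem height_node {i : ℕ} (h0 : 0 < i) (hi : i ≤ m) :
    height m i = max (height m (2 * i)) (height m (2 * i + 1)) + 1 := by
  rw [height, if_pos ⟨h0, hi⟩]

theorem height_leaf {i : ℕ} (hi : m < i) : height m i = 0 := by
  rw [height, if_neg (by omega)]

/-- Compare children: `2 * i ≤ 2 * j` and `2 * i ≤ 2 * j + 1`. Here, as in the following lemmas, `k`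
only drives the induction towards the leaves. -/
theorem height_anti (k : ℕ) : ∀ i j : ℕ, m + 1 - j ≤ k → 0 < i → i ≤ j →
    height m j ≤ height m i := by
  induction k with
  | zero => intro i j hk _ _; rw [height_leaf (i := j) (by omega)]; exact Nat.zero_le _
  | succ k ih =>
    intro i j hk h0 hij
    by_cases hj : j ≤ m
    · rw [height_node (i := j) (by omega) hj, height_node h0 (by omega)]
      have h1 := ih (2 * i) (2 * j) (by omega) (by omega) (by omega)
      have h2 := ih (2 * i) (2 * j + 1) (by omega) (by omega) (by omega)
      omega
    · rw [height_leaf (i := j) (by omega)]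
      exact Nat.zero_le _

/-- The relation `i ≤ j ≤ 2 * i` is inherited by left children and by right children. With
`height_anti` it shows that the siblings `2 * i` and `2 * i + 1` are balanced. -/
theorem height_le_succ (k : ℕ) : ∀ i j : ℕ, m + 1 - i ≤ k → 0 < i → i ≤ j → j ≤ 2 * i →
    height m i ≤ height m j + 1 := by
  induction k with
  | zero => intro i j hk _ _ _; rw [height_leaf (i := i) (by omega)]; exact Nat.zero_le _
  | succ k ih =>
    intro i j hk h0 hij hj2
    by_cases hi : i ≤ m
    · rw [height_node h0 hi]
      by_cases hj : j ≤ m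
      · rw [height_node (i := j) (by omega) hj]
        have h1 := ih (2 * i) (2 * j) (by omega) (by omega) (by omega) (by omega)
        have h2 := ih (2 * i + 1) (2 * j + 1) (by omega) (by omega) (by omega) (by omega)
        omega
      · rw [height_leaf (i := j) (by omega), height_leaf (i := 2 * i) (by omega),
          height_leaf (i := 2 * i + 1) (by omega)]
        simp
    · rw [height_leaf (i := i) (by omega)]
      exact Nat.zero_le _

theorem last_le (hp : m + 1 ≤ p) (hp' : p ≤ 2 * m + 1) (k : ℕ) : ∀ i : ℕ, m + 1 - i ≤ k →
    i ≤ 2 * m + 1 → last m p i ≤ m := by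
  induction k with
  | zero =>
    intro i hk hi
    rw [last_leaf (by omega), pos]
    split <;> omega
  | succ k ih =>
    intro i hk hi
    by_cases him : i ≤ m
    · rw [last_node him]
      exact ih _ (by omega) (by omega)
    · rw [last_leaf (by omega), pos]
      split <;> omega

/-- The leaves below node `i + 1` follow those below node `i` on the same level. -/
theorem first_succ {e : ℕ} (hpe : p = 2 ^ e) (k : ℕ) : ∀ i : ℕ, m + 1 - i ≤ k → 0 < i →
    i + 1 ≤ 2 * m + 1 → (∀ f, i + 1 ≠ 2 ^ f) → m + 1 ≤ p → p ≤ 2 * m →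
    first m p (i + 1) = last m p i + 1 := by
  induction k with
  | zero =>
    intro i hk h0 hi hf hp hp'
    have := hf e
    rw [first_leaf (by omega), last_leaf (by omega), pos, pos]
    split_ifs <;> omega
  | succ k ih =>
    intro i hk h0 hi hf hp hp'
    have := hf e
    rcases lt_trichotomy i m with h | h | h
    -- The claim for `i` and `i + 1` is the claim for the consecutive children `2 * i + 1` and `2 *
    -- i + 2`.
    · rw [first_node (by omega) (by omega), last_node h.le]
      refine ih (2 * i + 1) (by omega) (by omega) (by omega) (fun f hf' => ?_) hp hp'
      rcases f with _ | f
      · simp at hf'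
      · rw [pow_succ] at hf'
        exact hf f (by omega)
    -- Node `m` is the last inner node: its last leaf `2 * m + 1` ends the lowest level and is
    -- followed by `m + 1`, the first leaf of the level above.
    · rw [first_leaf (by omega), last_node h.le, last_leaf (by omega), pos, pos]
      split_ifs <;> omega
    · rw [first_leaf (by omega), last_leaf (by omega), pos, pos]
      split_ifs <;> omega

theorem first_right {e i : ℕ} (hpe : p = 2 ^ e) (hp : m + 1 ≤ p) (hp' : p ≤ 2 * m) (h0 : 0 < i)
    (hi : i ≤ m) :
    first m p (2 * i + 1) = last m p (2 * i) + 1 := by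
  refine first_succ hpe (m + 1) (2 * i) (by omega) (by omega) (by omega) (fun f hf => ?_) hp hp'
  rcases f with _ | f
  · rw [pow_zero] at hf
    omega
  · rw [pow_succ] at hf
    omega

theorem first_le_last {e : ℕ} (hpe : p = 2 ^ e) (hp : m + 1 ≤ p) (hp' : p ≤ 2 * m)
    (k : ℕ) : ∀ i : ℕ, m + 1 - i ≤ k → 0 < i → first m p i ≤ last m p i := by
  induction k with
  | zero => intro i hk _; rw [first_leaf (by omega), last_leaf (by omega)]
  | succ k ih =>
    intro i hk h0
    by_cases hi : i ≤ m
    · rw [first_node h0 hi, last_node hi]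
      have h1 := ih (2 * i) (by omega) (by omega)
      have h2 := ih (2 * i + 1) (by omega) (by omega)
      have h3 := first_right hpe hp hp' h0 hi
      omega
    · rw [first_leaf (by omega), last_leaf (by omega)]

/-- The left spine consists of the powers of two and ends at `p`, the first leaf of the lowest
level. -/
theorem first_one {e : ℕ} (hpe : p = 2 ^ e) (hp : m + 1 ≤ p) (hp' : p ≤ 2 * m) :
    first m p 1 = 0 := by
  have key : ∀ k f, f + k = e → first m p (2 ^ f) = 0 := by
    intro k
    induction k with
    | zero =>
      rintro f rfl
      rw [Nat.add_zero] at hpe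
      rw [← hpe, first_leaf (by omega), pos]
      simp
    | succ k ih =>
      intro f hf
      have h1 : 2 * 2 ^ f ≤ p := by
        rw [hpe, ← pow_succ']
        exact Nat.pow_le_pow_right (by norm_num) (by omega)
      rw [first_node (by positivity) (by omega), ← pow_succ']
      exact ih _ (by omega)
  simpa using key e 0 (by omega)

/-- The right spine consists of the nodes `2 ^ f - 1`. It ends at `p - 1`, or at `2 * p - 1` if `p -
1` is an inner node; in both cases the leaf has position `m`. -/
theorem last_one {e : ℕ} (hpe : p = 2 ^ e) (hp : m + 1 ≤ p) (hp' : p ≤ 2 * m) :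
    last m p 1 = m := by
  have key : ∀ k f, f + k = e → last m p (2 ^ f - 1) = m := by
    intro k
    induction k with
    | zero =>
      rintro f rfl
      rw [Nat.add_zero] at hpe
      rw [← hpe]
      by_cases h : p - 1 ≤ m
      · rw [last_node h, last_leaf (by omega), pos]
        split <;> omega
      · rw [last_leaf (by omega), pos]
        split <;> omega
    | succ k ih =>
      intro f hf
      have h1 : 2 * 2 ^ f ≤ p := by
        rw [hpe, ← pow_succ']
        exact Nat.pow_le_pow_right (by norm_num) (by omega)
      have h2 := ih (f + 1) (by omega)
      rw [pow_succ] at h2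
      have h3 : 0 < 2 ^ f := by positivity
      rw [last_node (by omega), ← h2]
      congr 1
      omega
  rcases e with _ | e
  · omega
  · have := key e 1 (by omega)
    simpa using this

end HeapShape

/-- The values of `g` at `a, …, b`. -/
def slice {α : Type*} (g : ℕ → α) (a b : ℕ) : List α := (List.range' a (b + 1 - a)).map g

theorem slice_self {α : Type*} (g : ℕ → α) (a : ℕ) : slice g a a = [g a] := by
  simp [slice]

theorem slice_append {α : Type*} (g : ℕ → α) {a b c : ℕ} (hab : a ≤ b + 1) (hbc : b ≤ c) :
    slice g a c = slice g a b ++ slice g (b + 1) c := by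
  rw [slice, slice, slice, ← List.map_append]
  congr 1
  have h1 := List.range'_append (s := a) (m := b + 1 - a) (n := c + 1 - (b + 1)) (step := 1)
  rw [one_mul, show a + (b + 1 - a) = b + 1 by omega] at h1
  rw [h1]
  congr 1
  omega

theorem slice_snoc {α : Type*} (g : ℕ → α) {a b : ℕ} (hab : a ≤ b) :
    slice g a b = (List.range' a (b - a)).map g ++ [g b] := by
  rw [slice, show b + 1 - a = (b - a) + 1 by omega, List.range'_concat]
  simp [Nat.add_sub_cancel' hab]

theorem slice_cons {α : Type*} (g : ℕ → α) {a b : ℕ} (hab : a ≤ b) :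
    slice g a b = g a :: (List.range' (a + 1) (b - a)).map g := by
  rw [slice, show b + 1 - a = (b - a) + 1 by omega, List.range'_succ]
  simp

theorem IsBalancedBST.join {S : Type*} {leaf : S → SearchTree S} {here : Sym2 S → SearchTree S}
    {g : ℕ → S} {a b c h₁ h₂ : ℕ} {t₁ t₂ : SearchTree S}
    (left : IsBalancedBST leaf here (slice g a b) h₁ t₁)
    (right : IsBalancedBST leaf here (slice g (b + 1) c) h₂ t₂) (hab : a ≤ b) (hbc : b + 1 ≤ c)
    (bal₁ : h₁ ≤ h₂ + 1) (bal₂ : h₂ ≤ h₁ + 1) :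
    IsBalancedBST leaf here (slice g a c) (max h₁ h₂ + 1)
      (SearchTree.query (g b) (g (b + 1)) t₁ (here s(g b, g (b + 1))) t₂) := by
  rw [slice_append g (by omega : a ≤ b + 1) (by omega), slice_snoc g hab, slice_cons g hbc,
    List.append_assoc, List.singleton_append]
  rw [slice_snoc g hab] at left
  rw [slice_cons g hbc] at right
  exact IsBalancedBST.node _ _ _ _ _ _ _ _ left right bal₁ bal₂

theorem support_eq_slice {S : Type*} {G : SimpleGraph S} {x y : S} (p : G.Walk x y) :
    p.support = slice p.getVert 0 p.length := by
  refine List.ext_getElem (by simp [slice]) fun i h1 h2 => ?_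
  simp [slice, SimpleGraph.Walk.support_getElem_eq_getVert]

/-! ## Edge arrays -/

/-- The edge number `j` of an edge array. -/
def edge {S : Type*} (E : ℕ → S × S) (j : ℕ) : Sym2 S := s((E j).1, (E j).2)

/-- `E` enumerates the `m` edges of `G`. -/
structure EdgesOf {S : Type*} (G : SimpleGraph S) (E : ℕ → S × S) (m : ℕ) : Prop where
  adj_iff : ∀ x y, G.Adj x y ↔ ∃ j < m, edge E j = s(x, y)
  inj : ∀ i < m, ∀ j < m, edge E i = edge E j → i = j

namespace EdgesOf

variable {S : Type*} {G : SimpleGraph S} {E : ℕ → S × S} {m : ℕ}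

theorem adj (h : EdgesOf G E m) {j : ℕ} (hj : j < m) : G.Adj (E j).1 (E j).2 :=
  (h.adj_iff _ _).2 ⟨j, hj, rfl⟩

theorem mem_edge_iff (h : EdgesOf G E m) {x : S} {j : ℕ} (hj : j < m) :
    x ∈ edge E j ↔ ∃ y, G.Adj x y ∧ edge E j = s(x, y) := by
  constructor
  · intro hx
    obtain ⟨y, hy⟩ := hx
    exact ⟨y, (h.adj_iff x y).2 ⟨j, hj, hy⟩, hy⟩
  · rintro ⟨y, _, hy⟩
    rw [hy]
    simp

theorem card_eq (h : EdgesOf G E m) [Finite S] : G.edgeSet.ncard = m := by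
  have h1 : G.edgeSet = edge E '' (Finset.range m : Set ℕ) := by
    ext e
    induction e with
    | h x y =>
      rw [SimpleGraph.mem_edgeSet, h.adj_iff]
      simp
  rw [h1, Set.InjOn.ncard_image, Set.ncard_coe_finset, Finset.card_range]
  intro i hi j hj hij
  exact h.inj i (by simpa using hi) j (by simpa using hj) hij

open Classical in
/-- The number of edges among the first `j` that contain `x`. -/
noncomputable def inc (E : ℕ → S × S) (j : ℕ) (x : S) : ℕ :=
  ((Finset.range j).filter fun i => x ∈ edge E i).card

theorem inc_succ (E : ℕ → S × S) (j : ℕ) (x : S) [Decidable (x ∈ edge E j)] :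
    inc E (j + 1) x = inc E j x + if x ∈ edge E j then 1 else 0 := by
  classical
  rw [inc, Finset.range_add_one, Finset.filter_insert]
  split
  · rw [Finset.card_insert_of_notMem (by simp), inc]
  · rw [inc, Nat.add_zero]

theorem inc_le (E : ℕ → S × S) (j : ℕ) (x : S) : inc E j x ≤ j := by
  classical
  exact (Finset.card_filter_le _ _).trans (by simp)

theorem inc_eq_deg (h : EdgesOf G E m) [Finite S] (x : S) : inc E m x = deg G x := by
  classical
  rw [inc, ← Set.ncard_coe_finset, deg]
  refine (Set.ncard_congr (fun y hy => Classical.choose ((h.adj_iff x y).1 hy)) ?_ ?_ ?_).symm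
  · intro y hy
    obtain ⟨h1, h2⟩ := Classical.choose_spec ((h.adj_iff x y).1 hy)
    simp only [Finset.coe_filter, Finset.mem_range, Set.mem_ofPred_eq]
    refine ⟨h1, ?_⟩
    rw [h2]
    simp
  · intro y z hy hz hyz
    have h1 := (Classical.choose_spec ((h.adj_iff x y).1 hy)).2
    have h2 := (Classical.choose_spec ((h.adj_iff x z).1 hz)).2
    rw [hyz] at h1
    exact Sym2.congr_right.1 (h1.symm.trans h2)
  · intro j hj
    simp only [Finset.coe_filter, Finset.mem_range, Set.mem_ofPred_eq] at hj
    obtain ⟨y, hy, he⟩ := (h.mem_edge_iff hj.1).1 hj.2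
    refine ⟨y, hy, ?_⟩
    obtain ⟨h1, h2⟩ := Classical.choose_spec ((h.adj_iff x y).1 hy)
    exact h.inj _ h1 _ hj.1 (h2.trans he.symm)

end EdgesOf

end LineLeaf
namespace LineLeaf

/-! ## The program -/

/-- `s'` differs from `s` only in the given registers and arrays. -/
def Frame (rs ks : List ℕ) (s s' : Mach) : Prop :=
  (∀ i ∉ rs, s'.reg i = s.reg i) ∧ ∀ k ∉ ks, s'.arr k = s.arr k

namespace Frame

variable {rs ks rs' ks' : List ℕ} {s s' s'' : Mach}

theorem refl (rs ks : List ℕ) (s : Mach) : Frame rs ks s s := ⟨fun _ _ => rfl, fun _ _ => rfl⟩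

theorem trans (h : Frame rs ks s s') (h' : Frame rs ks s' s'') : Frame rs ks s s'' :=
  ⟨fun i hi => (h'.1 i hi).trans (h.1 i hi), fun k hk => (h'.2 k hk).trans (h.2 k hk)⟩

theorem mono (h : Frame rs ks s s') (hr : rs ⊆ rs') (hk : ks ⊆ ks') : Frame rs' ks' s s' :=
  ⟨fun i hi => h.1 i fun h => hi (hr h), fun k hk' => h.2 k fun h => hk' (hk h)⟩

theorem set_reg {r : ℕ → ℕ} {a : ℕ → ℕ → ℕ} (h : Frame rs ks s ⟨r, a⟩) {i v : ℕ} (hi : i ∈ rs) :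
    Frame rs ks s ⟨Function.update r i v, a⟩ :=
  ⟨fun i' hi' => (Function.update_of_ne (by rintro rfl; exact hi' hi) _ _).trans (h.1 i' hi'), h.2⟩

theorem set_arr {r : ℕ → ℕ} {a : ℕ → ℕ → ℕ} (h : Frame rs ks s ⟨r, a⟩) {k : ℕ} {v : ℕ → ℕ}
    (hk : k ∈ ks) : Frame rs ks s ⟨r, Function.update a k v⟩ :=
  ⟨h.1, fun k' hk' => (Function.update_of_ne (by rintro rfl; exact hk' hk) _ _).trans (h.2 k' hk')⟩

end Frame

/-- The edge array `E` is stored in the array `a`. -/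
def HoldsEdges {S : Type*} (nm : S → ℕ) (a : ℕ → ℕ) (E : ℕ → S × S) (m : ℕ) : Prop :=
  ∀ j < m, a (2 * j) = nm (E j).1 ∧ a (2 * j + 1) = nm (E j).2

/-- Twice register `i`, plus `c`. -/
def twice (i c : ℕ) : Expr := .add (.add (.reg i) (.reg i)) (.const c)

/-- Sets the degrees of the ends of all edges to zero. -/
def resetDegrees : Cmd := .block [
  -- Only ends of present edges are reset, so the cost is linear in the number of edges and not in
  -- `n`. Throughout, register `2` holds the number of edges, `4` that of the new edges, `5` the
  -- free heap address and `12` the last absorbing node. Array `0` holds the edges, `1` the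
  -- addresses of their trees, `2` degrees, `5` the addresses of the trees of the nodes, `6` and `7`
  -- the current path, `8` and `9` its search tree, `10` and `11` the new edges and their trees.
  .asg 3 (.const 0),
  .loop (.lt (.reg 3) (.reg 2)) (.block [
    .ld 6 0 (twice 3 0),
    .st 2 (.reg 6) (.const 0),
    .ld 6 0 (twice 3 1),
    .st 2 (.reg 6) (.const 0),
    .asg 3 (.add (.reg 3) (.const 1))])]

/-- Counts one end of the edge in register `3`. -/
def countEnd (c : ℕ) : Cmd := .block [
  .ld 6 0 (twice 3 c),
  .ld 10 2 (.reg 6),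
  .st 2 (.reg 6) (.add (.reg 10) (.const 1)),
  -- Arrays `3` and `4` keep the last two edges at a node. For a node of degree two these are all
  -- its edges, which is what following a line requires.
  .ld 11 4 (.reg 6),
  .st 3 (.reg 6) (.reg 11),
  .st 4 (.reg 6) (.reg 3)]

/-- Computes the degrees, and the last two edges at each node. -/
def countDegrees : Cmd := .block [
  .asg 3 (.const 0),
  .loop (.lt (.reg 3) (.reg 2)) (.block [
    countEnd 0,
    countEnd 1,
    .asg 3 (.add (.reg 3) (.const 1))])]

/-! ### Counting degrees. -/

section Degrees

variable {S : Type*} {nm : S → ℕ} {n B m : ℕ} {E : ℕ → S × S} {G : SimpleGraph S}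

theorem resetDegrees_spec (hnm : ∀ x, nm x < n) (hB : 30 * n ≤ B) (hmn : m < n) {s : Mach}
    (hE : HoldsEdges nm (s.arr 0) E m) (hm : s.reg 2 = m) {Q : ℕ → Mach → Prop}
    (hQ : ∀ t s', t ≤ 10 * m + 5 → Frame [3, 6] [2] s s' →
      (∀ x, ∀ j < m, x ∈ edge E j → s'.arr 2 (nm x) = 0) → Q t s') :
    resetDegrees.vc n B Q s := by
  rw [resetDegrees, Cmd.vc_block_cons, Cmd.vc_asg]
  refine ⟨by decide, by simp [Expr.eval], ?_⟩
  rw [Cmd.vc_block_cons]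
  refine Cmd.vc_for m 6 (fun j s' => Frame [3, 6] [2] s s' ∧ s'.reg 3 = j ∧ j ≤ m ∧
    ∀ x, ∀ i < j, x ∈ edge E i → s'.arr 2 (nm x) = 0) ?_ ?_ ?_ ?_
  · rintro j s' ⟨hf, h3, hj, _⟩
    have h2 := hf.1 2 (by decide)
    refine ⟨hj, ?_⟩
    simp only [Expr.eval, h3, h2, hm]
    split <;> simp_all
  · rintro j hj s' ⟨hf, h3, _, hz⟩
    have h0 := hf.2 0 (by decide)
    have hE' := hE j hj
    rw [← h0] at hE'
    have ha := hnm (E j).1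
    have hb := hnm (E j).2
    have e1 : j + j = 2 * j := by ring
    simp [twice, Expr.eval, h3, e1, hE', Function.update_apply]
    refine ⟨by omega, fun _ => ⟨by omega, by omega, fun _ => ⟨by omega, by omega,
      ((hf.set_arr (by decide)).set_reg (by decide)).set_reg (by decide), by omega, ?_⟩⟩⟩
    intro x i hi hx h1 h2
    rcases hi.eq_or_lt with rfl | hi
    · rcases Sym2.mem_iff.1 hx with rfl | rfl
      · exact absurd rfl h2
      · exact absurd rfl h1
    · exact hz x i hi hx
  · exact ⟨(Frame.refl _ _ s).set_reg (by decide), by simp [Expr.eval], Nat.zero_le _,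
      fun _ _ h => absurd h (Nat.not_lt_zero _)⟩
  · intro t s' ht h
    rw [Cmd.vc_block_nil]
    exact hQ _ _ (by omega) h.1 h.2.2.2

open EdgesOf

/-- The degrees and the last two edges at each node are known. -/
def DegreesKnown (nm : S → ℕ) (G : SimpleGraph S) (E : ℕ → S × S) (m : ℕ) (s : Mach) : Prop :=
  ∀ x, 0 < deg G x → s.arr 2 (nm x) = deg G x ∧ (2 ≤ deg G x →
    s.arr 3 (nm x) < m ∧ x ∈ edge E (s.arr 3 (nm x)) ∧
    s.arr 4 (nm x) < m ∧ x ∈ edge E (s.arr 4 (nm x)) ∧ s.arr 3 (nm x) ≠ s.arr 4 (nm x))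

/-- The state of the counters for `x` after `c` of the edges at `x`, all of which have numbers
below `j`. -/
def Counted (nm : S → ℕ) (E : ℕ → S × S) (x : S) (c j : ℕ) (s : Mach) : Prop :=
  s.arr 2 (nm x) = c ∧ (1 ≤ c → s.arr 4 (nm x) < j ∧ x ∈ edge E (s.arr 4 (nm x))) ∧
    (2 ≤ c → s.arr 3 (nm x) < j ∧ x ∈ edge E (s.arr 3 (nm x)) ∧ s.arr 3 (nm x) ≠ s.arr 4 (nm x))

theorem Counted.mono {x : S} {c j j' : ℕ} {s s' : Mach} (h : Counted nm E x c j s) (hj : j ≤ j')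
    (h2 : s'.arr 2 (nm x) = s.arr 2 (nm x)) (h3 : s'.arr 3 (nm x) = s.arr 3 (nm x))
    (h4 : s'.arr 4 (nm x) = s.arr 4 (nm x)) : Counted nm E x c j' s' := by
  unfold Counted
  rw [h2, h3, h4]
  exact ⟨h.1, fun hc => ⟨(h.2.1 hc).1.trans_le hj, (h.2.1 hc).2⟩,
    fun hc => ⟨(h.2.2 hc).1.trans_le hj, (h.2.2 hc).2⟩⟩

theorem countEnd_spec (hnm : ∀ x, nm x < n) (hinj : Function.Injective nm) (hB : 30 * n ≤ B)
    {c j k : ℕ} {a : S} {s : Mach} (hj : 2 * j + c < 2 * n) (h3 : s.reg 3 = j)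
    (ha : s.arr 0 (2 * j + c) = nm a) (hk : k < n) (hc : Counted nm E a k j s)
    (hmem : a ∈ edge E j) {Q : ℕ → Mach → Prop}
    (hQ : ∀ s', Frame [6, 10, 11] [2, 3, 4] s s' → Counted nm E a (k + 1) (j + 1) s' →
      (∀ x ≠ a, ∀ k' i, Counted nm E x k' i s → Counted nm E x k' i s') → Q 7 s') :
    (countEnd c).vc n B Q s := by
  have e1 : j + j = 2 * j := by ring
  have hna := hnm a
  have hc1 := hc.1
  simp [countEnd, twice, Expr.eval, h3, e1, ha, hc1]
  refine ⟨hj, fun _ => ⟨by omega, fun _ => ⟨by omega, by omega, by omega, fun hv => ⟨by omega, hv,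
    by omega, by omega, hQ _ ?_ ?_ ?_⟩⟩⟩⟩
  · exact ((((((Frame.refl _ _ s).set_reg (by decide)).set_reg (by decide)).set_arr
      (by decide)).set_reg (by decide)).set_arr (by decide)).set_arr (by decide)
  · refine ⟨by simp, fun _ => by simp [hmem], fun hk' => ?_⟩
    obtain ⟨h5, h6⟩ := hc.2.1 (by omega)
    simp only [Function.update_apply]
    simp [h6]
    omega
  · intro x hx k' i h
    have hne : nm x ≠ nm a := fun h => hx (hinj h)
    exact h.mono le_rfl (by simp [hne]) (by simp [hne]) (by simp [hne])

theorem countDegrees_spec [Finite S] (hnm : ∀ x, nm x < n) (hinj : Function.Injective nm)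
    (hB : 30 * n ≤ B) (hmn : m < n) (hG : EdgesOf G E m) {s : Mach}
    (hE : HoldsEdges nm (s.arr 0) E m) (hm : s.reg 2 = m)
    (hz : ∀ x, ∀ j < m, x ∈ edge E j → s.arr 2 (nm x) = 0) {Q : ℕ → Mach → Prop}
    (hQ : ∀ t s', t ≤ 20 * m + 5 → Frame [3, 6, 10, 11] [2, 3, 4] s s' →
      DegreesKnown nm G E m s' → Q t s') :
    countDegrees.vc n B Q s := by
  classical
  rw [countDegrees, Cmd.vc_block_cons, Cmd.vc_asg]
  refine ⟨by decide, by simp [Expr.eval], ?_⟩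
  rw [Cmd.vc_block_cons]
  refine Cmd.vc_for m 16 (fun j s' => Frame [3, 6, 10, 11] [2, 3, 4] s s' ∧ s'.reg 3 = j ∧ j ≤ m ∧
    -- Nodes on no edge are excluded, since their stale counters have not been reset.
    ∀ x, (∃ i < m, x ∈ edge E i) → Counted nm E x (inc E j x) j s') ?_ ?_ ?_ ?_
  · rintro j s' ⟨hf, h3, hj, _⟩
    have h2 := hf.1 2 (by decide)
    refine ⟨hj, ?_⟩
    simp only [Expr.eval, h3, h2, hm]
    split <;> simp_all
  · rintro j hj s' ⟨hf, h3, _, hI⟩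
    have h0 := hf.2 0 (by decide)
    have hE' := hE j hj
    rw [← h0] at hE'
    have hab : (E j).1 ≠ (E j).2 := (hG.adj hj).ne
    have hma : (E j).1 ∈ edge E j := Sym2.mem_mk_left _ _
    have hmb : (E j).2 ∈ edge E j := Sym2.mem_mk_right _ _
    have hle := fun x => inc_le E j x
    rw [Cmd.vc_block_cons]
    refine countEnd_spec hnm hinj hB (by omega) h3 hE'.1 ((hle _).trans_lt (by omega))
      (hI _ ⟨j, hj, hma⟩) hma ?_
    intro s₁ hf₁ hc₁ ho₁
    rw [Cmd.vc_block_cons]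
    refine countEnd_spec hnm hinj hB (by omega) ((hf₁.1 3 (by decide)).trans h3)
      (by rw [hf₁.2 0 (by decide)]; exact hE'.2) ((hle _).trans_lt (by omega))
      (ho₁ _ hab.symm _ _ (hI _ ⟨j, hj, hmb⟩)) hmb ?_
    intro s₂ hf₂ hc₂ ho₂
    have h3' : s₂.reg 3 = j := ((hf₂.1 3 (by decide)).trans (hf₁.1 3 (by decide))).trans h3
    simp [Expr.eval, h3']
    refine ⟨by omega, ?_, by omega, ?_⟩
    · exact ((hf.trans (hf₁.mono (by decide) (by decide))).trans
        (hf₂.mono (by decide) (by decide))).set_reg (by decide)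
    · intro x i hi hx
      rw [inc_succ]
      by_cases hxa : x = (E j).1
      · subst hxa
        rw [if_pos hma]
        exact ho₂ _ hab _ _ hc₁
      · by_cases hxb : x = (E j).2
        · subst hxb
          rw [if_pos hmb]
          exact hc₂
        · rw [if_neg (show ¬ x ∈ edge E j from fun h => (Sym2.mem_iff.1 h).elim hxa hxb),
            Nat.add_zero]
          exact (ho₂ _ hxb _ _ (ho₁ _ hxa _ _ (hI x ⟨i, hi, hx⟩))).mono (Nat.le_succ j) rfl rfl rfl
  · refine ⟨(Frame.refl _ _ s).set_reg (by decide), by simp [Expr.eval], Nat.zero_le _, ?_⟩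
    rintro x ⟨i, hi, hx⟩
    have : inc E 0 x = 0 := Nat.le_zero.1 (inc_le E 0 x)
    rw [this]
    exact ⟨hz x i hi hx, fun h => by omega, fun h => by omega⟩
  · intro t s' ht h
    rw [Cmd.vc_block_nil]
    refine hQ _ _ (by omega) h.1 fun x hx => ?_
    obtain ⟨y, hy⟩ := deg_pos_iff.1 hx
    obtain ⟨i, hi, he⟩ := (hG.adj_iff x y).1 hy
    have hc := h.2.2.2 x ⟨i, hi, by rw [he]; simp⟩
    rw [hG.inc_eq_deg] at hc
    refine ⟨hc.1, fun h2 => ?_⟩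
    obtain ⟨h3, h4⟩ := hc.2.1 (by omega)
    obtain ⟨h5, h6, h7⟩ := hc.2.2 h2
    exact ⟨h5, h6, h3, h4, h7⟩

end Degrees

end LineLeaf
namespace LineLeaf

/-! ## Building binary search trees -/

/-- Writes a query record at the free address in register `5`. -/
def newQuery (a b c d e : Expr) : Cmd := .block [
  .hst (.reg 5) (.const 2),
  .hst (.add (.reg 5) (.const 1)) a,
  .hst (.add (.reg 5) (.const 2)) b,
  .hst (.add (.reg 5) (.const 3)) c,
  .hst (.add (.reg 5) (.const 4)) d,
  .hst (.add (.reg 5) (.const 5)) e,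
  .asg 5 (.add (.reg 5) (.const 6))]

/-- The heap of `s'` extends the heap of `s` below `lim`. -/
def HeapLe (lim : ℕ) (s s' : Mach) : Prop := ∀ q < lim, s'.arr 15 q = s.arr 15 q

theorem HeapLe.refl (lim : ℕ) (s : Mach) : HeapLe lim s s := fun _ _ => rfl

theorem HeapLe.trans {lim lim' : ℕ} {s s' s'' : Mach} (h : HeapLe lim s s')
    (h' : HeapLe lim' s' s'') (hl : lim ≤ lim') : HeapLe lim s s'' :=
  fun q hq => (h' q (hq.trans_le hl)).trans (h q hq)

theorem Stored.heapLe {S : Type*} {nm : S → ℕ} {lo lim lim' p : ℕ} {T : SearchTree S} {s s' : Mach}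
    (h : Stored nm (s.arr 15) lo lim p T) (hh : HeapLe lim s s') (hl : lim ≤ lim') :
    Stored nm (s'.arr 15) lo lim' p T := h.mono (fun q _ hq => hh q hq) hl

section Record

variable {S : Type*} {nm : S → ℕ} {n B : ℕ}

theorem newQuery_spec {a b c d e : Expr} {s : Mach} {p : ℕ} {x y : S} {tx there ty : SearchTree S}
    (h5 : s.reg 5 = p) (hp : p + 6 ≤ B) (hB : 30 * n + 6 ≤ B) (hx : a.eval s.reg = nm x)
    (hy : b.eval s.reg = nm y) (hnx : nm x < n) (hny : nm y < n)
    (hc : Stored nm (s.arr 15) (30 * n) p (c.eval s.reg) tx)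
    (hd : Stored nm (s.arr 15) (30 * n) p (d.eval s.reg) there)
    (he : Stored nm (s.arr 15) (30 * n) p (e.eval s.reg) ty) {Q : ℕ → Mach → Prop}
    (hQ : ∀ s', Frame [5] [15] s s' → s'.reg 5 = p + 6 → HeapLe p s s' →
      Stored nm (s'.arr 15) (30 * n) (p + 6) p (SearchTree.query x y tx there ty) → Q 8 s') :
    (newQuery a b c d e).vc n B Q s := by
  have b1 := hc.bounds
  have b2 := hd.bounds
  have b3 := he.bounds
  simp [newQuery, Expr.eval, h5]
  refine ⟨⟨by omega, by omega⟩, by omega, ⟨by omega, by omega⟩, by omega, ⟨by omega, by omega⟩,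
    by omega, ⟨by omega, by omega⟩, by omega, ⟨by omega, by omega⟩, by omega, ⟨by omega, by omega⟩,
    by omega, by omega, ?_⟩
  have hle : HeapLe p s ⟨s.reg, Function.update s.arr 15 (Function.update (Function.update
      (Function.update (Function.update (Function.update (Function.update (s.arr 15) p 2) (p + 1)
      (a.eval s.reg)) (p + 2) (b.eval s.reg)) (p + 3) (c.eval s.reg)) (p + 4) (d.eval s.reg)) (p + 5)
      (e.eval s.reg))⟩ := by
    intro q hq
    simp only [Function.update_self]
    repeat rw [Function.update_of_ne (by omega)]
  refine hQ _ ?_ (by simp) hle ?_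
  · exact ((Frame.refl _ _ s).set_arr (by decide)).set_reg (by decide)
  · refine Stored.query p x y tx there ty (by omega) (by omega) (by simp)
      (by simp [hx]) (by simp [hy]) ?_ ?_ ?_
    · simpa using hc.heapLe hle (by omega : p ≤ p + 6)
    · simpa using hd.heapLe hle (by omega : p ≤ p + 6)
    · simpa using he.heapLe hle (by omega : p ≤ p + 6)

end Record

/-- The address of an empty leaf. -/
def nilAddr : Expr := (Expr.reg 0).mulc 30

/-- Puts the smallest power of two that exceeds register `9` into register `14`. -/
def powerAbove : Cmd := .block [
  .asg 14 (.const 1),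
  .loop (.lt (.reg 14) (.add (.reg 9) (.const 1))) (.block [.asg 14 (.add (.reg 14) (.reg 14))])]

/-- Puts the position of the leaf in register `13` into register `15`. -/
def leafPos : Cmd := .ite (.lt (.reg 13) (.reg 14))
  (.asg 15 (.sub (.add (.add (.reg 13) (.reg 9)) (.const 1)) (.reg 14)))
  (.asg 15 (.sub (.reg 13) (.reg 14)))

/-- Handles a leaf of the search tree. -/
def bstLeaf : Cmd := .block [
  leafPos,
  .st 9 (.reg 13) (.reg 15),
  -- The positions `0` and `L` are the ends of the line, where the search cannot arrive; they get
  -- empty leaves.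
  .ite (.eq (.reg 15) (.const 0)) (.st 8 (.reg 13) nilAddr)
    (.ite (.eq (.reg 15) (.reg 9)) (.st 8 (.reg 13) nilAddr)
      (.block [.ld 10 6 (.reg 15), .ld 10 5 (.reg 10), .st 8 (.reg 13) (.reg 10)]))]

/-- Handles an inner node of the search tree. -/
def bstNode : Cmd := .block [
  -- Array `9` gives the position of the last leaf below the left child. The key of the node is the
  -- path edge from this position to the next one.
  .ld 15 9 (twice 13 0),
  .ld 10 6 (.reg 15),
  .ld 11 6 (.add (.reg 15) (.const 1)),
  .ld 16 8 (twice 13 0),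
  .ld 17 7 (.reg 15),
  .ld 17 1 (.reg 17),
  .ld 18 8 (twice 13 1),
  newQuery (.reg 10) (.reg 11) (.reg 16) (.reg 17) (.reg 18),
  .st 8 (.reg 13) (.sub (.reg 5) (.const 6)),
  .ld 19 9 (twice 13 1),
  .st 9 (.reg 13) (.reg 19)]

/-- Builds a balanced search tree for the path in the arrays `6` (nodes) and `7` (edges), whose
length is in register `9`. -/
def buildBST : Cmd := .block [
  powerAbove,
  -- A path with `L` edges needs `L` inner nodes and `L + 1` leaves. Counting down from `2 * L + 1`
  -- treats children before their parents.
  .asg 13 (twice 9 1),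
  .loop (.reg 13) (.block [
    .ite (.lt (.reg 9) (.reg 13)) bstLeaf bstNode,
    .asg 13 (.sub (.reg 13) (.const 1))])]

/-- The path `g 0, …, g L` is in the arrays `6` and `7`, and the search trees of its nodes and edges
are on the heap. -/
structure PathStored {S : Type*} (nm : S → ℕ) (n : ℕ) (g : ℕ → S) (L : ℕ)
    (leaf : S → SearchTree S) (here : Sym2 S → SearchTree S) (lim : ℕ) (s : Mach) : Prop where
  node : ∀ l ≤ L, s.arr 6 l = nm (g l)
  edge : ∀ l < L, s.arr 7 l < n ∧
    Stored nm (s.arr 15) (30 * n) lim (s.arr 1 (s.arr 7 l)) (here s(g l, g (l + 1)))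
  interior : ∀ l, 0 < l → l < L → Stored nm (s.arr 15) (30 * n) lim (s.arr 5 (nm (g l))) (leaf (g l))
  leaf_zero : leaf (g 0) = SearchTree.nil
  leaf_last : leaf (g L) = SearchTree.nil
  nil_stored : Stored nm (s.arr 15) (30 * n) lim (30 * n) SearchTree.nil

theorem PathStored.mono {S : Type*} {nm : S → ℕ} {n : ℕ} {g : ℕ → S} {L : ℕ}
    {leaf : S → SearchTree S} {here : Sym2 S → SearchTree S} {lim lim' : ℕ} {s s' : Mach}
    (h : PathStored nm n g L leaf here lim s) (hh : HeapLe lim s s') (hl : lim ≤ lim')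
    (ha : ∀ k ∈ [1, 5, 6, 7], s'.arr k = s.arr k) : PathStored nm n g L leaf here lim' s' := by
  have h1 := ha 1 (by decide)
  have h5 := ha 5 (by decide)
  have h6 := ha 6 (by decide)
  have h7 := ha 7 (by decide)
  refine ⟨fun l hl => ?_, fun l hl' => ?_, fun l h0 hl' => ?_, h.leaf_zero, h.leaf_last,
    h.nil_stored.heapLe hh hl⟩
  · rw [h6]; exact h.node l hl
  · rw [h7, h1]; exact ⟨(h.edge l hl').1, (h.edge l hl').2.heapLe hh hl⟩
  · rw [h5]; exact (h.interior l h0 hl').heapLe hh hl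

section Build

variable {S : Type*} {nm : S → ℕ} {n B L : ℕ} {g : ℕ → S} {leaf : S → SearchTree S}
  {here : Sym2 S → SearchTree S}

theorem powerAbove_spec (hB : 30 * n ≤ B) (hL : 1 ≤ L) (hLn : L < n) {s : Mach} (h9 : s.reg 9 = L)
    {Q : ℕ → Mach → Prop} (hQ : ∀ t s' e, t ≤ 6 * L + 5 → Frame [14] [] s s' → s'.reg 14 = 2 ^ e →
      L + 1 ≤ 2 ^ e → 2 ^ e ≤ 2 * L → Q t s') : powerAbove.vc n B Q s := by
  rw [powerAbove, Cmd.vc_block_cons, Cmd.vc_asg]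
  refine ⟨by decide, by simp only [Expr.eval]; omega, ?_⟩
  rw [Cmd.vc_block_cons]
  -- The variant is `2 * L - 2 ^ e`; doubling happens only while `2 ^ e ≤ L`, which keeps `2 ^ e ≤ 2
  -- * L`.
  refine Cmd.vc_loop (fun k t s' => ∃ e, Frame [14] [] s s' ∧ s'.reg 14 = 2 ^ e ∧ 2 ^ e ≤ 2 * L ∧
    t + 3 ≤ 3 * 2 ^ e ∧ k + 2 ^ e = 2 * L) (k := 2 * L - 1) ?_
    ⟨0, (Frame.refl _ _ s).set_reg (by decide), by simp [Expr.eval], by simp; omega, by simp,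
      by simp; omega⟩
  rintro k t s' ⟨e, hf, h14, h2, ht, hk⟩
  have h9' := (hf.1 9 (by decide)).trans h9
  have hpos : 0 < 2 ^ e := by positivity
  simp only [Expr.eval, h14, h9']
  refine ⟨fun h => ?_, fun h => ?_⟩
  · rw [Cmd.vc_block_nil]
    exact hQ _ _ e (by omega) hf h14 (by by_contra hc; rw [if_pos (by omega)] at h; omega) h2
  · have hlt : 2 ^ e < L + 1 := by
      by_contra hc
      rw [if_neg hc] at h
      exact h rfl
    simp only [Cmd.vc_block_cons, Cmd.vc_asg, Cmd.vc_block_nil, Expr.eval, h14]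
    refine ⟨by decide, by omega, k - 2 ^ e, by omega, e + 1, hf.set_reg (by decide), ?_, ?_, ?_, ?_⟩
    · rw [Function.update_self, pow_succ]; ring
    · rw [pow_succ]; omega
    · rw [pow_succ]; omega
    · rw [pow_succ]; omega

open HeapShape

/-- The search tree of node `i` is complete. -/
def NodeDone (nm : S → ℕ) (n : ℕ) (g : ℕ → S) (L : ℕ) (leaf : S → SearchTree S)
    (here : Sym2 S → SearchTree S) (p lim i : ℕ) (s : Mach) : Prop :=
  s.arr 9 i = last L p i ∧ ∃ t, Stored nm (s.arr 15) (30 * n) lim (s.arr 8 i) t ∧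
    IsBalancedBST leaf here (slice g (first L p i) (last L p i)) (height L i) t

theorem NodeDone.mono {p lim lim' i : ℕ} {s s' : Mach}
    (h : NodeDone nm n g L leaf here p lim i s) (h9 : s'.arr 9 i = s.arr 9 i)
    (h8 : s'.arr 8 i = s.arr 8 i) (hh : HeapLe lim s s') (hl : lim ≤ lim') :
    NodeDone nm n g L leaf here p lim' i s' := by
  obtain ⟨h1, t, h2, h3⟩ := h
  exact ⟨h9.trans h1, t, h8 ▸ h2.heapLe hh hl, h3⟩

theorem leafPos_spec (hB : 30 * n ≤ B) (hLn : L < n) {p i : ℕ} (hp : L + 1 ≤ p) (hi : L < i) (hi' : i ≤ 2 * L + 1) {s : Mach} (h9 : s.reg 9 = L)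
    (h13 : s.reg 13 = i) (h14 : s.reg 14 = p) {Q : ℕ → Mach → Prop}
    (hQ : ∀ s', Frame [15] [] s s' → s'.reg 15 = pos L p i → Q 2 s') : leafPos.vc n B Q s := by
  simp only [leafPos, Cmd.vc_ite, Cmd.vc_asg, Expr.eval, h9, h13, h14]
  refine ⟨fun h => ⟨by decide, by omega, hQ _ ((Frame.refl _ _ s).set_reg (by decide)) ?_⟩,
    fun h => ⟨by decide, by omega, hQ _ ((Frame.refl _ _ s).set_reg (by decide)) ?_⟩⟩
  · have : i < p := by
      by_contra hc
      simp [hc] at h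
    simp [pos, this]
  · have : ¬ i < p := fun hc => by simp [hc] at h
    simp [pos, this]

theorem bstLeaf_spec (hnm : ∀ x, nm x < n) (hB : 30 * n ≤ B) (hLn : L < n) {p i lim : ℕ}
    (hp : L + 1 ≤ p) (hp' : p ≤ 2 * L) (hi : L < i) (hi' : i ≤ 2 * L + 1) {s : Mach}
    (h0 : s.reg 0 = n) (h9 : s.reg 9 = L) (h13 : s.reg 13 = i) (h14 : s.reg 14 = p)
    (hP : PathStored nm n g L leaf here lim s) {Q : ℕ → Mach → Prop}
    (hQ : ∀ t s', t ≤ 20 → Frame [10, 15] [8, 9] s s' → 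
      (∀ i' ≠ i, s'.arr 8 i' = s.arr 8 i' ∧ s'.arr 9 i' = s.arr 9 i') →
      NodeDone nm n g L leaf here p lim i s' → Q t s') :
    bstLeaf.vc n B Q s := by
  rw [bstLeaf, Cmd.vc_block_cons]
  refine leafPos_spec hB hLn hp hi hi' h9 h13 h14 fun s₁ hf₁ h15 => ?_
  have g13 := (hf₁.1 13 (by decide)).trans h13
  have g9 := (hf₁.1 9 (by decide)).trans h9
  have g0 := (hf₁.1 0 (by decide)).trans h0
  have hpos : pos L p i ≤ L := by
    have := last_le hp (by omega) (L + 1) i (by omega) hi'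
    rwa [last_leaf hi] at this
  have hP₁ : PathStored nm n g L leaf here lim s₁ := hP.mono
    (fun q _ => by rw [hf₁.2 15 (by simp)]) le_rfl (fun k _ => hf₁.2 k (by simp))
  rw [Cmd.vc_block_cons, Cmd.vc_st]
  simp only [Expr.eval, g13, h15]
  refine ⟨by decide, by omega, by omega, ?_⟩
  have hdone : ∀ {s' : Mach} {v : ℕ}, s'.arr 9 i = pos L p i → s'.arr 8 i = v → HeapLe lim s s' →
      Stored nm (s.arr 15) (30 * n) lim v (leaf (g (pos L p i))) →
      NodeDone nm n g L leaf here p lim i s' := by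
    intro s' v e9 e8 hh hv
    refine ⟨by rw [e9, last_leaf hi], _, e8 ▸ hv.heapLe hh le_rfl, ?_⟩
    rw [first_leaf hi, last_leaf hi, height_leaf hi, slice_self]
    exact IsBalancedBST.single _
  have hframe : Frame [10, 15] [8, 9] s s₁ := hf₁.mono (by decide) (by decide)
  have hh₁ : HeapLe lim s s₁ := fun q _ => by rw [hf₁.2 15 (by simp)]
  have hnil := hP.nil_stored.bounds
  simp only [Cmd.vc_block_cons, Cmd.vc_ite, Cmd.vc_st, Cmd.vc_ld, Cmd.vc_block_nil, Expr.eval, g13,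
    h15, g9, nilAddr, Expr.eval_mulc, g0]
  have hne : ∀ i' ≠ i, s₁.arr 8 i' = s.arr 8 i' ∧ s₁.arr 9 i' = s.arr 9 i' := fun i' _ =>
    ⟨by rw [hf₁.2 8 (by simp)], by rw [hf₁.2 9 (by simp)]⟩
  refine ⟨fun h => ⟨by decide, by omega, by omega, hQ _ _ (by omega)
      ((hframe.set_arr (by decide)).set_arr (by decide)) (fun i' hi' => ?_)
      (hdone (v := 30 * n) (by simp) (by simp) (fun q hq => by simpa using hh₁ q hq) ?_)⟩,
    fun h => ⟨fun h' => ⟨by decide, by omega, by omega, hQ _ _ (by omega)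
      ((hframe.set_arr (by decide)).set_arr (by decide)) (fun i' hi' => ?_)
      (hdone (v := 30 * n) (by simp) (by simp) (fun q hq => by simpa using hh₁ q hq) ?_)⟩, fun h' => ?_⟩⟩
  · simpa [hi'] using hne i' hi'
  · rw [show pos L p i = 0 by by_contra hc; simp [hc] at h, hP.leaf_zero]
    exact hP.nil_stored
  · simpa [hi'] using hne i' hi'
  · rw [show pos L p i = L by by_contra hc; simp [hc] at h', hP.leaf_last]
    exact hP.nil_stored
  · have e0 : pos L p i ≠ 0 := by rintro hc; simp [hc] at h
    have e1 : pos L p i ≠ L := by rintro hc; simp [hc] at h'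
    have hlt := hnm (g (pos L p i))
    have hst := hP₁.interior (pos L p i) (by omega) (by omega)
    simp [hP₁.node _ hpos, g13]
    refine ⟨by omega, fun _ => ⟨by omega, fun hv => ⟨by omega, hv, hQ _ _ (by omega)
      (((hframe.set_arr (by decide)).set_reg (by decide)).set_arr (by decide)) (fun i' hi' => ?_)
        (hdone (v := s₁.arr 5 (nm (g (pos L p i)))) (by simp) (by simp)
          (fun q hq => by simpa using hh₁ q hq) ?_)⟩⟩⟩
    · simpa [hi'] using hne i' hi'
    · exact hst.mono (fun q _ hq => (hh₁ q hq).symm) le_rfl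

theorem bstNode_spec (hnm : ∀ x, nm x < n) (hLn : L < n) {p i e al : ℕ}
    (hpe : p = 2 ^ e) (hp : L + 1 ≤ p) (hp' : p ≤ 2 * L) (hi : 0 < i) (hi' : i ≤ L) {s : Mach}
    (h13 : s.reg 13 = i) (h5 : s.reg 5 = al) (hal : al + 6 ≤ B) (hB : 30 * n + 6 ≤ B)
    (hP : PathStored nm n g L leaf here al s)
    (hl : NodeDone nm n g L leaf here p al (2 * i) s)
    (hr : NodeDone nm n g L leaf here p al (2 * i + 1) s) {Q : ℕ → Mach → Prop}
    (hQ : ∀ t s', t ≤ 30 → Frame [5, 10, 11, 15, 16, 17, 18, 19] [8, 9, 15] s s' → 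
      s'.reg 5 = al + 6 → HeapLe al s s' →
      (∀ i' ≠ i, s'.arr 8 i' = s.arr 8 i' ∧ s'.arr 9 i' = s.arr 9 i') →
      NodeDone nm n g L leaf here p (al + 6) i s' → Q t s') :
    bstNode.vc n B Q s := by
  obtain ⟨hl9, tl, hl1, hl2⟩ := hl
  obtain ⟨hr9, tr, hr1, hr2⟩ := hr
  have f1 := first_right hpe hp hp' hi hi'
  have f2 := first_le_last hpe hp hp' (L + 1) (2 * i) (by omega) (by omega)
  have f3 := first_le_last hpe hp hp' (L + 1) (2 * i + 1) (by omega) (by omega)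
  have f4 := last_le hp (by omega) (L + 1) (2 * i + 1) (by omega) (by omega)
  set l := last L p (2 * i) with hldef
  have e1 : i + i = 2 * i := by ring
  have hE := hP.edge l (by omega)
  have hx := hnm (g l)
  have hy := hnm (g (l + 1))
  rw [bstNode]
  simp [Cmd.vc_block_cons, twice, Expr.eval, h13, e1, hl9, hP.node l (by omega),
    hP.node (l + 1) (by omega)]
  refine ⟨by omega, fun _ => ⟨by omega, fun _ => ⟨by omega, fun _ => ⟨by omega, fun _ => ⟨by omega,
    fun _ => ⟨by omega, fun _ => ⟨by omega, fun _ => ?_⟩⟩⟩⟩⟩⟩⟩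
  refine newQuery_spec (x := g l) (y := g (l + 1)) (p := al) (by simp [h5]) hal hB
    (by simp [Expr.eval]) (by simp [Expr.eval]) hx hy (by simpa [Expr.eval] using hl1)
    (by simpa [Expr.eval] using hE.2) (by simpa [Expr.eval] using hr1) fun s₁ hf₁ h5' hh ht => ?_
  have g13 : s₁.reg 13 = i := by rw [hf₁.1 13 (by decide)]; simp [h13]
  have g9 : s₁.arr 9 = s.arr 9 := hf₁.2 9 (by decide)
  have g8 : s₁.arr 8 = s.arr 8 := hf₁.2 8 (by decide)
  have hh' : HeapLe al s s₁ := hh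
  simp only [g13, g9, g8, h5', hr9, e1]
  refine ⟨by omega, by omega, by omega, fun _ => ⟨by omega, by omega, ?_⟩⟩
  refine hQ _ _ (by omega) ?_ (by simp [h5']) (fun q hq => by simpa using hh' q hq)
    (fun i' hi' => by simp [hi']) ?_
  · have h0 : Frame [5, 10, 11, 15, 16, 17, 18, 19] [8, 9, 15] s s₁ := Frame.trans
      (((((((Frame.refl _ _ s).set_reg (by decide)).set_reg (by decide)).set_reg (by decide)).set_reg
        (by decide)).set_reg (by decide)).set_reg (by decide)) (hf₁.mono (by decide) (by decide))
    exact ((h0.set_arr (by decide)).set_arr (by decide)).set_reg (by decide)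
  · refine ⟨by simp [last_node hi'], _, by simpa using ht, ?_⟩
    rw [first_node hi hi', last_node hi', height_node hi hi']
    rw [f1] at hr2
    -- By `f1` the leaves of the right child continue those of the left child, and the heights of
    -- the consecutive nodes `2 * i` and `2 * i + 1` differ by at most one.
    exact hl2.join hr2 f2 (by omega)
      (height_le_succ (L + 1) (2 * i) (2 * i + 1) (by omega) (by omega) (by omega) (by omega))
      (Nat.le_succ_of_le (height_anti (L + 1) (2 * i) (2 * i + 1) (by omega) (by omega) (by omega)))

theorem buildBST_spec (hnm : ∀ x, nm x < n) (hL : 2 ≤ L) (hLn : L < n) {al : ℕ} {s : Mach}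
    (h0 : s.reg 0 = n) (h9 : s.reg 9 = L) (h5 : s.reg 5 = al) (hal : al + 6 * L ≤ B)
    (hB : 30 * n + 6 ≤ B) (hP : PathStored nm n g L leaf here al s) {Q : ℕ → Mach → Prop}
    (hQ : ∀ t s', t ≤ 80 * L + 80 →
      Frame [5, 10, 11, 13, 14, 15, 16, 17, 18, 19] [8, 9, 15] s s' →
      s'.reg 5 = al + 6 * L → HeapLe al s s' →
      (∃ T, Stored nm (s'.arr 15) (30 * n) (al + 6 * L) (s'.arr 8 1) T ∧
        ∃ h, IsBalancedBST leaf here (slice g 0 L) h T) → Q t s') :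
    buildBST.vc n B Q s := by
  rw [buildBST, Cmd.vc_block_cons]
  refine powerAbove_spec (by omega) (by omega) hLn h9 fun t₀ s₀ e ht₀ hf₀ h14 hp hp' => ?_
  obtain ⟨p, hpe⟩ : ∃ p, p = 2 ^ e := ⟨_, rfl⟩
  rw [← hpe] at h14 hp hp'
  have g9 := (hf₀.1 9 (by decide)).trans h9
  rw [Cmd.vc_block_cons, Cmd.vc_asg]
  refine ⟨by decide, by simp only [twice, Expr.eval, g9]; omega, ?_⟩
  rw [Cmd.vc_block_cons]
  -- The first `L + 1` rounds treat leaves and allocate nothing, so after `j` rounds `j - (L + 1)`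
  -- records, in truncated subtraction, have been written.
  refine Cmd.vc_for (2 * L + 1) 34 (fun j s' =>
    Frame [5, 10, 11, 13, 14, 15, 16, 17, 18, 19] [8, 9, 15] s s' ∧ j ≤ 2 * L + 1 ∧
    s'.reg 13 = 2 * L + 1 - j ∧ s'.reg 14 = p ∧ s'.reg 5 = al + 6 * (j - (L + 1)) ∧
    HeapLe al s s' ∧ ∀ i, 2 * L + 1 - j < i → i ≤ 2 * L + 1 →
      NodeDone nm n g L leaf here p (al + 6 * (j - (L + 1))) i s') ?_ ?_ ?_ ?_
  · rintro j s' ⟨_, hj, h13, _⟩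
    simp only [Expr.eval, h13]
    omega
  · rintro j hj s' ⟨hf, _, h13, h14', h5', hh, hI⟩
    have hP' : PathStored nm n g L leaf here (al + 6 * (j - (L + 1))) s' :=
      hP.mono hh (by omega) (fun k hk => hf.2 k (by revert hk; revert k; decide))
    have k9 := (hf.1 9 (by decide)).trans h9
    have k0 := (hf.1 0 (by decide)).trans h0
    rw [Cmd.vc_block_cons, Cmd.vc_ite]
    simp only [Expr.eval, h13, k9]
    refine ⟨fun h => ?_, fun h => ?_⟩
    · have hlt : L < 2 * L + 1 - j := by
        by_contra hc
        simp [hc] at h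
      refine bstLeaf_spec hnm (by omega) hLn hp hp' hlt (by omega) k0 k9 h13 h14' hP'
        fun t₁ s₁ ht₁ hf₁ ho hd => ?_
      have e13 : s₁.reg 13 = _ := (hf₁.1 13 (by decide)).trans h13
      have e15 : s₁.arr 15 = s'.arr 15 := hf₁.2 15 (by decide)
      simp only [Cmd.vc_block_cons, Cmd.vc_block_nil, Cmd.vc_asg, Expr.eval, e13]
      refine ⟨by decide, by omega, by omega, (hf.trans (hf₁.mono (by decide) (by decide))).set_reg
        (by decide), by omega, by simp; omega, by simp [hf₁.1 14 (by decide), h14'],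
        by simp [hf₁.1 5 (by decide), h5']; omega, fun q hq => by simp [e15, hh q hq], ?_⟩
      intro i hi hi'
      rw [show j + 1 - (L + 1) = j - (L + 1) by omega]
      rcases Nat.eq_or_lt_of_le (show 2 * L + 1 - j ≤ i by omega) with hij | hij
      · subst hij
        exact hd.mono rfl rfl (HeapLe.refl _ _) le_rfl
      · exact (hI i hij hi').mono (ho i (by omega)).2 (ho i (by omega)).1
          (fun q _ => by simp [e15]) le_rfl
    · have hlt : ¬ L < 2 * L + 1 - j := by
        intro hc
        simp [hc] at h
      refine bstNode_spec hnm hLn hpe hp hp' (by omega) (by omega) h13 h5' (by omega) hB hP'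
        (hI _ (by omega) (by omega)) (hI _ (by omega) (by omega)) fun t₁ s₁ ht₁ hf₁ al₁ hh₁ ho hd => ?_
      have e13 : s₁.reg 13 = _ := (hf₁.1 13 (by decide)).trans h13
      simp only [Cmd.vc_block_cons, Cmd.vc_block_nil, Cmd.vc_asg, Expr.eval, e13]
      have e6 : al + 6 * (j + 1 - (L + 1)) = al + 6 * (j - (L + 1)) + 6 := by omega
      rw [e6]
      refine ⟨by decide, by omega, by omega, (hf.trans (hf₁.mono (by decide) (by decide))).set_reg
        (by decide), by omega, by simp; omega, by simp [hf₁.1 14 (by decide), h14'],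
        by simp [al₁], hh.trans hh₁ (by omega), ?_⟩
      intro i hi hi'
      rcases Nat.eq_or_lt_of_le (show 2 * L + 1 - j ≤ i by omega) with hij | hij
      · subst hij
        exact hd.mono rfl rfl (HeapLe.refl _ _) le_rfl
      · exact (hI i hij hi').mono (ho i (by omega)).2 (ho i (by omega)).1 hh₁ (by omega)
  · refine ⟨(hf₀.mono (by decide) (by decide)).set_reg (by decide), by omega, ?_, by simp [h14], ?_,
      fun q _ => by simp [hf₀.2 15 (by simp)], fun i h1 h2 => by omega⟩
    · simp [twice, Expr.eval, g9]; omega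
    · simp [hf₀.1 5 (by decide), h5]
  · rintro t s' ht ⟨hf, _, h13, _, h5', hh, hI⟩
    rw [Cmd.vc_block_nil]
    have e6 : 2 * L + 1 - (L + 1) = L := by omega
    rw [e6] at h5' hI
    obtain ⟨_, T, h1, h2⟩ := hI 1 (by omega) (by omega)
    rw [first_one hpe hp hp', last_one hpe hp hp'] at h2
    exact hQ _ _ (by omega) hf h5' hh ⟨T, h1, _, h2⟩

end Build

end LineLeaf
namespace LineLeaf

/-! ## Following a line -/

/-- One step along a line: the last node is in register `7`, the last edge in register `8`, the
number of edges in register `9`. -/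
def walkStep : Cmd := .block [
  .ld 11 3 (.reg 7),
  -- The line is continued by the one of the two edges through which the node was not entered.
  .ite (.eq (.reg 11) (.reg 8)) (.ld 11 4 (.reg 7)) .nop,
  .asg 8 (.reg 11),
  .ld 10 0 (twice 8 0),
  .ld 11 0 (twice 8 1),
  -- The other end of an edge is the sum of the names of both ends minus the name of the present
  -- node.
  .asg 7 (.sub (.add (.reg 10) (.reg 11)) (.reg 7)),
  .st 7 (.reg 9) (.reg 8),
  .asg 9 (.add (.reg 9) (.const 1)),
  .st 6 (.reg 9) (.reg 7),
  .ld 10 2 (.reg 7)]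

/-- Follows the line that starts with the edge in register `3`, from the node in register `6` to the
node in register `7`. -/
def walk : Cmd := .block [
  .st 6 (.const 0) (.reg 6),
  .st 6 (.const 1) (.reg 7),
  .st 7 (.const 0) (.reg 3),
  .asg 9 (.const 1),
  .asg 8 (.reg 3),
  .ld 10 2 (.reg 7),
  .loop (.eq (.reg 10) (.const 2)) walkStep]

section Walk

variable {S : Type*} {nm : S → ℕ} {n B m : ℕ} {E : ℕ → S × S} {G : SimpleGraph S} {live : Set S}

theorem getVert_concat {x v w : S} (p : G.Walk x v) (h : G.Adj v w) {l : ℕ} :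
    (p.concat h).getVert l = if l ≤ p.length then p.getVert l else w := by
  rw [SimpleGraph.Walk.concat_eq_append, SimpleGraph.Walk.getVert_append']
  split
  · rfl
  · obtain ⟨k, hk⟩ : ∃ k, l - p.length = k + 1 := ⟨l - p.length - 1, by omega⟩
    rw [hk]
    simp

/-- The path `p` is stored in the arrays `6` and `7`. -/
structure WalkStored (nm : S → ℕ) (E : ℕ → S × S) (m : ℕ) {x v : S} (p : G.Walk x v) (s : Mach) :
    Prop where
  node : ∀ l ≤ p.length, s.arr 6 l = nm (p.getVert l)
  edge : ∀ l < p.length, s.arr 7 l < m ∧ edge E (s.arr 7 l) = s(p.getVert l, p.getVert (l + 1))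

theorem WalkStored.concat {x v w : S} {p : G.Walk x v} {s s' : Mach} (h : WalkStored nm E m p s)
    (hvw : G.Adj v w) {c : ℕ} (hc : c < m) (he : LineLeaf.edge E c = s(v, w))
    (h6 : s'.arr 6 = Function.update (s.arr 6) (p.length + 1) (nm w))
    (h7 : s'.arr 7 = Function.update (s.arr 7) p.length c) :
    WalkStored nm E m (p.concat hvw) s' := by
  refine ⟨fun l hl => ?_, fun l hl => ?_⟩
  · rw [SimpleGraph.Walk.length_concat] at hl
    rw [h6, getVert_concat]
    split_ifs with h1
    · rw [Function.update_of_ne (by omega), h.node l h1]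
    · obtain rfl : l = p.length + 1 := by omega
      rw [Function.update_self]
  · rw [SimpleGraph.Walk.length_concat] at hl
    rw [h7, getVert_concat, getVert_concat, if_pos (by omega)]
    rcases Nat.eq_or_lt_of_le (Nat.lt_succ_iff.1 hl) with rfl | h1
    · rw [Function.update_self, if_neg (by omega), SimpleGraph.Walk.getVert_length]
      exact ⟨hc, he⟩
    · rw [Function.update_of_ne (by omega), if_pos (by omega)]
      exact h.edge l h1

theorem HoldsEdges.add_eq {a : ℕ → ℕ} (hE : HoldsEdges nm a E m) {c : ℕ} (hc : c < m) {v w : S}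
    (he : edge E c = s(v, w)) : a (2 * c) + a (2 * c + 1) = nm v + nm w := by
  obtain ⟨h1, h2⟩ := hE c hc
  rw [h1, h2]
  rcases Sym2.eq_iff.1 he with ⟨h3, h4⟩ | ⟨h3, h4⟩
  · rw [h3, h4]
  · rw [h3, h4, Nat.add_comm]

theorem walkStep_spec [Finite S] (ht : TreeOn live G) (hG : EdgesOf G E m) (hnm : ∀ x, nm x < n)
    (hB : 30 * n ≤ B) (hmn : m < n) {s : Mach} (hE : HoldsEdges nm (s.arr 0) E m)
    (hd : DegreesKnown nm G E m s) {x v : S} {p : G.Walk x v} (hp : p.IsPath) (hl : 0 < p.length)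
    (hln : p.length + 1 < n)
    (hv : deg G v = 2) (h7 : s.reg 7 = nm v) (h9 : s.reg 9 = p.length)
    (h8 : s.reg 8 < m) (h8' : edge E (s.reg 8) = s(p.penultimate, v))
    (hst : WalkStored nm E m p s) {Q : ℕ → Mach → Prop}
    (hQ : ∀ t s' w (hvw : G.Adj v w), t ≤ 20 → Frame [7, 8, 9, 10, 11] [6, 7] s s' →
      (p.concat hvw).IsPath → s'.reg 7 = nm w → s'.reg 9 = p.length + 1 → s'.reg 8 < m →
      edge E (s'.reg 8) = s(v, w) → s'.reg 10 = deg G w → WalkStored nm E m (p.concat hvw) s' →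
      Q t s') :
    walkStep.vc n B Q s := by
  obtain ⟨h3, h3v, h4, h4v, h34⟩ := (hd v (by omega)).2 hv.ge
  have hnv := hnm v
  have hle : p.length + 1 < 2 * n := by omega
  obtain ⟨c, hcdef⟩ : ∃ c, c = if s.arr 3 (nm v) = s.reg 8 then s.arr 4 (nm v) else s.arr 3 (nm v) :=
    ⟨_, rfl⟩
  obtain ⟨hc, hcv, hc8⟩ : c < m ∧ v ∈ edge E c ∧ c ≠ s.reg 8 := by
    rw [hcdef]
    split_ifs with h
    · exact ⟨h4, h4v, by rw [← h]; exact h34.symm⟩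
    · exact ⟨h3, h3v, h⟩
  obtain ⟨w, hvw, hcw⟩ := (hG.mem_edge_iff hc).1 hcv
  -- The edge `c` is not the one just used, and different numbers mean different edges.
  have hw : w ≠ p.penultimate := by
    rintro rfl
    exact hc8 (hG.inj _ hc _ h8 (by rw [hcw, h8', Sym2.eq_swap]))
  have hpath := ht.isPath_concat hp hvw hw
  have hsum := hE.add_eq hc hcw
  have hnw := hnm w
  have hdw := (hd w (deg_pos_iff.2 ⟨v, hvw.symm⟩)).1
  have e1 : c + c = 2 * c := by ring
  have he := hE c hc
  have ha := hnm (E c).1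
  have hb := hnm (E c).2
  -- The common remainder of both branches; `t'` stands for the steps of the test.
  have key : (Cmd.block [
      .asg 8 (.reg 11),
      .ld 10 0 (twice 8 0),
      .ld 11 0 (twice 8 1),
      .asg 7 (.sub (.add (.reg 10) (.reg 11)) (.reg 7)),
      .st 7 (.reg 9) (.reg 8),
      .asg 9 (.add (.reg 9) (.const 1)),
      .st 6 (.reg 9) (.reg 7),
      .ld 10 2 (.reg 7)]).vc n B (fun t s' => ∀ t' ≤ 3, Q (1 + (t' + t)) s')
        ⟨Function.update s.reg 11 c, s.arr⟩ := by
    simp [twice, Expr.eval, e1, h7, h9, hsum, hdw]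
    refine ⟨by omega, by omega, fun _ => ⟨by omega, fun _ => ⟨by omega, by omega, by omega, by omega,
      by omega, by omega, by omega, fun _ => ?_⟩⟩⟩
    intro t' ht'
    refine hQ _ _ w hvw (by omega) ?_ hpath (by simp) (by simp) (by simpa using hc) (by simpa using hcw)
      (by simp) (hst.concat hvw hc hcw (by simp) (by simp))
    exact (((((((((Frame.refl _ _ s).set_reg (by decide)).set_reg (by decide)).set_reg
      (by decide)).set_reg (by decide)).set_reg (by decide)).set_arr (by decide)).set_reg
      (by decide)).set_arr (by decide)).set_reg (by decide)
  rw [walkStep, Cmd.vc_block_cons, Cmd.vc_ld]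
  simp only [Expr.eval, h7]
  refine ⟨by decide, by omega, fun _ => ?_⟩
  rw [Cmd.vc_block_cons, Cmd.vc_ite]
  simp only [Expr.eval]
  refine ⟨fun h => ?_, fun h => ?_⟩
  · have h' : s.arr 3 (nm v) = s.reg 8 := by by_contra hc; simp [hc] at h
    have g : Function.update s.reg 11 (s.arr 3 (nm v)) 7 = nm v := by simp [h7]
    rw [if_pos h'] at hcdef
    simp only [Cmd.vc_ld, Expr.eval, g, Function.update_idem, ← hcdef]
    exact ⟨by decide, by omega, fun _ => Cmd.vc_mono key fun t s' h => h 2 (by omega)⟩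
  · have h' : ¬ s.arr 3 (nm v) = s.reg 8 := by intro hc; simp [hc] at h
    rw [if_neg h'] at hcdef
    rw [← hcdef, Cmd.vc_nop]
    exact Cmd.vc_mono key fun t s' h => h 2 (by omega)

theorem walk_spec [Finite S] (ht : TreeOn live G) (hG : EdgesOf G E m) (hnm : ∀ x, nm x < n)
    (hcard : Nat.card S ≤ n) (hB : 30 * n ≤ B) (hmn : m < n) {s : Mach}
    (hE : HoldsEdges nm (s.arr 0) E m) (hd : DegreesKnown nm G E m s) {a b : S} {j : ℕ} (hj : j < m)
    (h3 : s.reg 3 = j) (h6 : s.reg 6 = nm a) (h7 : s.reg 7 = nm b) (hab : edge E j = s(a, b))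
    (ha : deg G a ≠ 2) {Q : ℕ → Mach → Prop}
    (hQ : ∀ t s' (y : S) (p : G.Walk a y), t ≤ 30 * p.length + 30 →
      Frame [7, 8, 9, 10, 11] [6, 7] s s' → IsLine G p → p.snd = b → s'.reg 7 = nm y →
      s'.reg 9 = p.length → p.length < n → WalkStored nm E m p s' → Q t s') :
    walk.vc n B Q s := by
  have := Fintype.ofFinite S
  have hadj : G.Adj a b := (hG.adj_iff a b).2 ⟨j, hj, hab⟩
  have hdb := (hd b (deg_pos_iff.2 ⟨a, hadj.symm⟩)).1
  have hna := hnm a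
  have hnb := hnm b
  rw [walk]
  simp [Expr.eval, h3, h6, h7, hdb, -SimpleGraph.Walk.length_eq_zero_iff]
  refine ⟨by omega, by omega, by omega, by omega, by omega, by omega, by omega, by omega, by omega,
    fun _ => ?_⟩
  -- The variant is `n` minus the length of the path, which has fewer edges than there are nodes.
  refine Cmd.vc_loop (fun k t s' => ∃ (y : S) (p : G.Walk a y), Frame [7, 8, 9, 10, 11] [6, 7] s s' ∧
    p.IsPath ∧ 0 < p.length ∧ InteriorTwo p ∧ p.snd = b ∧ s'.reg 7 = nm y ∧ s'.reg 9 = p.length ∧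
    s'.reg 8 < m ∧ edge E (s'.reg 8) = s(p.penultimate, y) ∧ s'.reg 10 = deg G y ∧
    WalkStored nm E m p s' ∧ t ≤ 30 * p.length ∧ k + p.length = n) (k := n - 1) ?_ ?_
  · rintro k t s' ⟨y, p, hf, hp, hl, hi, hs, g7, g9, g8, g8', g10, hst, htt, hk⟩
    simp only [Expr.eval, g10]
    have hln := hp.length_lt
    rw [← Nat.card_eq_fintype_card] at hln
    refine ⟨fun h => ?_, fun h => ?_⟩
    · have hy : deg G y ≠ 2 := fun hc => by simp [hc] at h
      exact hQ _ _ y p (by omega) hf (isLine_of_interiorTwo hp hl hi ha hy) hs g7 g9 (by omega) hst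
    · have hy : deg G y = 2 := by by_contra hc; simp [hc] at h
      have hd' : DegreesKnown nm G E m s' := by
        intro z hz
        rw [hf.2 2 (by decide), hf.2 3 (by decide), hf.2 4 (by decide)]
        exact hd z hz
      obtain ⟨w, hw, _, hc⟩ := ht.exists_concat hp hl hy
      have hln' := hc.length_lt
      rw [← Nat.card_eq_fintype_card, SimpleGraph.Walk.length_concat] at hln'
      refine walkStep_spec ht hG hnm hB hmn (by rw [hf.2 0 (by decide)]; exact hE) hd' hp hl
        (by omega) hy g7 g9 g8 g8' hst fun t₁ s₁ w hvw ht₁ hf₁ hpath k7 k9 k8 k8' k10 hst₁ => ?_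
      refine ⟨k - 1, by omega, w, p.concat hvw, hf.trans hf₁, hpath, by simp, hi.concat hy hvw,
        by rw [snd_concat hl, hs], k7, by simp [k9], k8, by simpa using k8', k10, hst₁, ?_, ?_⟩
      · rw [SimpleGraph.Walk.length_concat]; omega
      · rw [SimpleGraph.Walk.length_concat]; omega
  · refine ⟨b, hadj.toWalk, ?_, by simp [hadj.ne], by simp, ?_, by simp, by simp [h7], by simp,
      by simpa using hj, by simpa using hab, by simp, ⟨?_, ?_⟩, by simp, by simp; omega⟩
    · exact (((((Frame.refl _ _ s).set_arr (by decide)).set_arr (by decide)).set_reg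
        (by decide)).set_reg (by decide)).set_reg (by decide)
    · intro z hz h1 h2
      simp at hz
      tauto
    · intro l hl
      simp at hl
      interval_cases l <;> simp
    · intro l hl
      simp at hl
      subst hl
      simpa using ⟨hj, hab⟩

end Walk

end LineLeaf
namespace LineLeaf

/-! ## Bookkeeping of line contractions -/

section Darts

variable {S : Type*} {nm : S → ℕ} {G : SimpleGraph S} {live : Set S} {E : ℕ → S × S} {m : ℕ}

/-- A line that is recorded by the program: from the end with the smaller name, unless it is a
single edge. -/
def Selected (nm : S → ℕ) {x y : S} (p : G.Walk x y) : Prop := p.length = 1 ∨ nm x < nm y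

theorem IsLine.length_eq_one {x y : S} {p : G.Walk x y} (hp : IsLine G p) (h : deg G p.snd ≠ 2) :
    p.length = 1 := by
  by_contra hc
  have := hp.length_pos
  exact h (hp.deg_getVert (i := 1) (by omega) (by omega))

theorem IsLine.snd_eq {x y : S} {p : G.Walk x y} (h : p.length = 1) : p.snd = y := by
  have := p.getVert_length
  rwa [h] at this

/-- Two lines with the same first edge have the same ends. -/
theorem IsLine.ends_eq (ht : TreeOn live G) {x y x' y' : S} {p : G.Walk x y} {q : G.Walk x' y'}
    (hp : IsLine G p) (hq : IsLine G q) (h : s(x', q.snd) = s(x, p.snd)) :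
    s(x', y') = s(x, y) ∧ (Selected nm q → Selected nm p) := by
  rcases Sym2.eq_iff.1 h with ⟨rfl, h2⟩ | ⟨h1, h2⟩
  · obtain rfl := hp.end_eq_of_snd_eq hq h2.symm
    rw [ht.path_unique hp.1 hq.1]
    exact ⟨rfl, id⟩
  · have h3 := hp.length_eq_one (by rw [← h1]; exact hq.2.2.1)
    have h4 := hq.length_eq_one (by rw [h2]; exact hp.2.2.1)
    rw [snd_eq h3] at h1
    rw [snd_eq h4] at h2
    refine ⟨?_, fun _ => Or.inl h3⟩
    rw [h1, h2]
    exact Sym2.eq_swap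

/-- Two recorded lines with the same ends have the same first edge. -/
theorem IsLine.first_edge_eq (ht : TreeOn live G) {x y x' y' : S} {p : G.Walk x y}
    {q : G.Walk x' y'} (hp : IsLine G p) (hq : IsLine G q) (hps : Selected nm p)
    (hqs : Selected nm q) (h : s(x', y') = s(x, y)) : s(x', q.snd) = s(x, p.snd) := by
  rcases Sym2.eq_iff.1 h with ⟨rfl, rfl⟩ | ⟨rfl, rfl⟩
  · rw [ht.path_unique hp.1 hq.1]
  · have hr : q = p.reverse := ht.path_unique hq.1 hp.1.reverse
    have hl : q.length = p.length := by rw [hr, SimpleGraph.Walk.length_reverse]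
    by_cases h1 : p.length = 1
    · rw [snd_eq h1, snd_eq (hl.trans h1), Sym2.eq_swap]
    · have h2 := hps.resolve_left h1
      have h3 := hqs.resolve_left (by omega)
      omega

open Classical in
/-- The darts of a walk. -/
noncomputable def dartsOf {x y : S} (p : G.Walk x y) : Finset (S × S) :=
  (Finset.range p.length).image fun i => (p.getVert i, p.getVert (i + 1))

theorem mem_dartsOf {x y : S} {p : G.Walk x y} {d : S × S} :
    d ∈ dartsOf p ↔ ∃ i < p.length, (p.getVert i, p.getVert (i + 1)) = d := by
  simp [dartsOf]

theorem card_dartsOf {x y : S} {p : G.Walk x y} (hp : p.IsPath) : (dartsOf p).card = p.length := by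
  classical
  rw [dartsOf, Finset.card_image_of_injOn, Finset.card_range]
  intro i hi j hj hij
  simp only [Finset.coe_range, Set.mem_Iio] at hi hj
  exact hp.getVert_injOn (by simp; omega) (by simp; omega) (Prod.mk.inj hij).1

/-- All members of `D` are darts of lines whose first edge has a number below `j`. -/
def DartsBelow (G : SimpleGraph S) (E : ℕ → S × S) (j : ℕ) (D : Finset (S × S)) : Prop :=
  ∀ d ∈ D, ∃ (x y : S) (p : G.Walk x y), IsLine G p ∧ (∃ j' < j, edge E j' = s(x, p.snd)) ∧
    d ∈ dartsOf p

theorem DartsBelow.mono {j j' : ℕ} {D : Finset (S × S)} (h : DartsBelow G E j D) (hj : j ≤ j') :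
    DartsBelow G E j' D := fun d hd => by
  obtain ⟨x, y, p, hp, ⟨i, hi, he⟩, hdp⟩ := h d hd
  exact ⟨x, y, p, hp, ⟨i, hi.trans_le hj, he⟩, hdp⟩

/-- Every edge has two darts. Applied to the darts of all lines followed so far, this bounds the
total length of the walks in one line contraction. -/
theorem DartsBelow.card_le (hG : EdgesOf G E m) {j : ℕ} {D : Finset (S × S)}
    (h : DartsBelow G E j D) : D.card ≤ 2 * m := by
  classical
  have hsub : D ⊆ (Finset.range m).image E ∪ (Finset.range m).image fun j => (E j).swap := by
    intro d hd
    obtain ⟨x, y, p, hp, _, hdp⟩ := h d hd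
    obtain ⟨i, hi, rfl⟩ := mem_dartsOf.1 hdp
    obtain ⟨k, hk, he⟩ := (hG.adj_iff _ _).1 (p.adj_getVert_succ hi)
    rcases Sym2.eq_iff.1 he with ⟨h1, h2⟩ | ⟨h1, h2⟩
    · exact Finset.mem_union_left _ (Finset.mem_image.2 ⟨k, by simpa using hk, Prod.ext h1 h2⟩)
    · exact Finset.mem_union_right _ (Finset.mem_image.2 ⟨k, by simpa using hk, Prod.ext h2 h1⟩)
  refine (Finset.card_le_card hsub).trans ((Finset.card_union_le _ _).trans ?_)
  have h1 := Finset.card_image_le (s := Finset.range m) (f := E)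
  have h2 := Finset.card_image_le (s := Finset.range m) (f := fun j => (E j).swap)
  rw [Finset.card_range] at h1 h2
  omega

/-- A dart lies on one line only: from it the line is determined backwards and forwards. So lines
with different first edges share no darts, and the lengths of the walks add up to the size of `D`.
-/
theorem DartsBelow.add (ht : TreeOn live G) (hG : EdgesOf G E m) {j : ℕ} (hj : j < m)
    {D : Finset (S × S)} (h : DartsBelow G E j D) {x y : S} {p : G.Walk x y} (hp : IsLine G p)
    (he : edge E j = s(x, p.snd)) :
    ∃ D', DartsBelow G E (j + 1) D' ∧ D'.card = D.card + p.length := by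
  classical
  refine ⟨D ∪ dartsOf p, fun d hd => ?_, ?_⟩
  · rcases Finset.mem_union.1 hd with hd | hd
    · exact h.mono (Nat.le_succ j) d hd
    · exact ⟨x, y, p, hp, ⟨j, Nat.lt_succ_self j, he⟩, hd⟩
  · rw [Finset.card_union_of_disjoint, card_dartsOf hp.1]
    rw [Finset.disjoint_left]
    intro d hd hdp
    obtain ⟨x', y', q, hq, ⟨j', hj', he'⟩, hdq⟩ := h d hd
    obtain ⟨i, hi, rfl⟩ := mem_dartsOf.1 hdp
    obtain ⟨i', hi', hii⟩ := mem_dartsOf.1 hdq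
    obtain ⟨h1, h2⟩ := Prod.mk.inj hii
    obtain ⟨_, rfl⟩ := hq.start_eq hp hi' hi h1 h2
    obtain rfl := hq.end_eq hp hi' hi h1 h2
    rw [ht.path_unique hq.1 hp.1, ← he] at he'
    exact hj'.ne (hG.inj _ (hj'.trans hj) _ hj he')

end Darts

section Stages

variable {S : Type*} {nm : S → ℕ} {n m : ℕ} {E N : ℕ → S × S} {st : Stage S}

/-- A stage is stored in memory: its edges in the array `ka`, the addresses of their search trees in
`kp`, those of the search trees of its nodes in the array `5`. -/
structure StageStored (nm : S → ℕ) (n ka kp m : ℕ) (E : ℕ → S × S) (st : Stage S) (lim : ℕ)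
    (s : Mach) : Prop where
  tree : TreeOn st.live st.graph
  edges : EdgesOf st.graph E m
  holds : HoldsEdges nm (s.arr ka) E m
  bst : ∀ j < m, Stored nm (s.arr 15) (30 * n) lim (s.arr kp j) (st.bst (edge E j))
  lst : ∀ x ∈ st.live, Stored nm (s.arr 15) (30 * n) lim (s.arr 5 (nm x)) (st.lst x)
  nil_stored : Stored nm (s.arr 15) (30 * n) lim (30 * n) SearchTree.nil

theorem StageStored.mono {ka kp lim lim' : ℕ} {s s' : Mach} (h : StageStored nm n ka kp m E st lim s)
    (hh : HeapLe lim s s') (hl : lim ≤ lim') (ha : s'.arr ka = s.arr ka)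
    (hp : s'.arr kp = s.arr kp) (h5 : s'.arr 5 = s.arr 5) :
    StageStored nm n ka kp m E st lim' s' :=
  ⟨h.tree, h.edges, ha ▸ h.holds, fun j hj => hp ▸ (h.bst j hj).heapLe hh hl,
    fun x hx => h5 ▸ (h.lst x hx).heapLe hh hl, h.nil_stored.heapLe hh hl⟩

/-- `T` is the search tree of the edge that replaces the line `p`. -/
def IsLineTree (st : Stage S) {x y : S} (p : st.graph.Walk x y) (T : SearchTree S) : Prop :=
  (p.length = 1 → T = st.bst s(x, y)) ∧ (2 ≤ p.length → IsPathBST st x y p.support T)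

theorem IsPathBST.swap {x y : S} {l : List S} {T : SearchTree S} (h : IsPathBST st x y l T) :
    IsPathBST st y x l T := by
  obtain ⟨d, hd⟩ := h
  refine ⟨d, ?_⟩
  convert hd using 3
  exact or_comm

/-- The edge `e`, with the search tree at address `a`, replaces a line with first edge below `j`. -/
def LineRecord (nm : S → ℕ) (n : ℕ) (st : Stage S) (E : ℕ → S × S) (j : ℕ) (e : S × S) (a lim : ℕ)
    (s : Mach) : Prop :=
  ∃ (x y : S) (p : st.graph.Walk x y), e = (x, y) ∧ IsLine st.graph p ∧ Selected nm p ∧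
    (∃ j' < j, edge E j' = s(x, p.snd)) ∧
    ∃ T, Stored nm (s.arr 15) (30 * n) lim a T ∧ IsLineTree st p T

theorem LineRecord.mono {j j' : ℕ} {e : S × S} {a lim lim' : ℕ} {s s' : Mach}
    (h : LineRecord nm n st E j e a lim s) (hj : j ≤ j') (hh : HeapLe lim s s') (hl : lim ≤ lim') :
    LineRecord nm n st E j' e a lim' s' := by
  obtain ⟨x, y, p, he, hp, hs, ⟨i, hi, hie⟩, T, hT, hT'⟩ := h
  exact ⟨x, y, p, he, hp, hs, ⟨i, hi.trans_le hj, hie⟩, T, hT.heapLe hh hl, hT'⟩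

/-- The lines with a first edge below `j` have been recorded in the arrays `10` and `11`. -/
structure LinesRecorded (nm : S → ℕ) (n : ℕ) (st : Stage S) (E : ℕ → S × S) (j k : ℕ)
    (N : ℕ → S × S) (lim : ℕ) (s : Mach) : Prop where
  holds : HoldsEdges nm (s.arr 10) N k
  sound : ∀ i < k, LineRecord nm n st E j (N i) (s.arr 11 i) lim s
  inj : ∀ i < k, ∀ i' < k, edge N i = edge N i' → i = i'
  complete : ∀ (x y : S) (p : st.graph.Walk x y), IsLine st.graph p → Selected nm p →
    (∃ j' < j, edge E j' = s(x, p.snd)) → ∃ i < k, edge N i = s(x, y)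

namespace LinesRecorded

variable {j k lim lim' : ℕ} {s s' : Mach}

theorem skip (h : LinesRecorded nm n st E j k N lim s) (hh : HeapLe lim s s') (hl : lim ≤ lim')
    (h10 : s'.arr 10 = s.arr 10) (h11 : s'.arr 11 = s.arr 11)
    (hno : ∀ (x y : S) (p : st.graph.Walk x y), IsLine st.graph p → Selected nm p →
      edge E j ≠ s(x, p.snd)) : LinesRecorded nm n st E (j + 1) k N lim' s' := by
  refine ⟨h10 ▸ h.holds, fun i hi => h11 ▸ (h.sound i hi).mono (Nat.le_succ j) hh hl, h.inj, ?_⟩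
  rintro x y p hp hs ⟨j', hj', he⟩
  rcases Nat.lt_succ_iff_lt_or_eq.1 hj' with hj' | rfl
  · exact h.complete x y p hp hs ⟨j', hj', he⟩
  · exact absurd he (hno x y p hp hs)

theorem mono (h : LinesRecorded nm n st E j k N lim s) (hh : HeapLe lim s s')
    (h10 : s'.arr 10 = s.arr 10) (h11 : s'.arr 11 = s.arr 11) :
    LinesRecorded nm n st E j k N lim s' :=
  ⟨h10 ▸ h.holds, fun i hi => h11 ▸ (h.sound i hi).mono le_rfl hh le_rfl, h.inj, h.complete⟩

/-- No edge is recorded twice, because a recorded line with the same ends would have the same first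
edge, whereas earlier ones have numbers below `j`. Completeness for `j` holds because all lines with
this first edge have the same ends. -/
theorem push (h : LinesRecorded nm n st E j k N lim s) (ht : TreeOn st.live st.graph)
    (hG : EdgesOf st.graph E m) (hj : j < m) {a y : S} {p : st.graph.Walk a y}
    (hp : IsLine st.graph p) (hps : Selected nm p) (he : edge E j = s(a, p.snd)) {q : ℕ}
    {T : SearchTree S} (hh : HeapLe lim s s') (hl : lim ≤ lim')
    (h10 : s'.arr 10 = Function.update (Function.update (s.arr 10) (2 * k) (nm a)) (2 * k + 1) (nm y))
    (h11 : s'.arr 11 = Function.update (s.arr 11) k q)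
    (hT : Stored nm (s'.arr 15) (30 * n) lim' q T) (hT' : IsLineTree st p T) :
    LinesRecorded nm n st E (j + 1) (k + 1) (Function.update N k (a, y)) lim' s' := by
  have hold : ∀ i < k, Function.update N k (a, y) i = N i := fun i hi =>
    Function.update_of_ne hi.ne _ _
  have hold' : ∀ i < k, edge (Function.update N k (a, y)) i = edge N i := fun i hi => by
    rw [edge, hold i hi, edge]
  have hnew : edge (Function.update N k (a, y)) k = s(a, y) := by simp [edge]
  have hne : ∀ i < k, edge N i ≠ s(a, y) := by
    intro i hi hc
    obtain ⟨x', y', q, hN, hq, hqs, ⟨j', hj', he'⟩, _⟩ := h.sound i hi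
    rw [edge, hN] at hc
    have := hp.first_edge_eq ht hq hps hqs hc
    rw [← he, ← he'] at this
    exact hj'.ne (hG.inj _ (hj'.trans hj) _ hj this)
  refine ⟨fun i hi => ?_, fun i hi => ?_, fun i hi i' hi' hii => ?_, ?_⟩
  · rw [h10]
    rcases Nat.lt_succ_iff_lt_or_eq.1 hi with hi | rfl
    · rw [hold i hi]
      simp [show 2 * i ≠ 2 * k by omega, show 2 * i ≠ 2 * k + 1 by omega,
        show 2 * i + 1 ≠ 2 * k by omega, h.holds i hi]
    · simp
  · rw [h11]
    rcases Nat.lt_succ_iff_lt_or_eq.1 hi with hi | rfl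
    · rw [hold i hi, Function.update_of_ne hi.ne]
      exact (h.sound i hi).mono (Nat.le_succ j) hh hl
    · rw [Function.update_self, Function.update_self]
      exact ⟨a, y, p, rfl, hp, hps, ⟨j, Nat.lt_succ_self j, he⟩, T, hT, hT'⟩
  · rcases Nat.lt_succ_iff_lt_or_eq.1 hi with hi | rfl
    · rw [hold' i hi] at hii
      rcases Nat.lt_succ_iff_lt_or_eq.1 hi' with hi' | rfl
      · rw [hold' i' hi'] at hii
        exact h.inj i hi i' hi' hii
      · rw [hnew] at hii
        exact absurd hii (hne i hi)
    · rw [hnew] at hii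
      rcases Nat.lt_succ_iff_lt_or_eq.1 hi' with hi' | rfl
      · rw [hold' i' hi'] at hii
        exact absurd hii.symm (hne i' hi')
      · rfl
  · rintro x' y' q hq hs ⟨j', hj', he'⟩
    rcases Nat.lt_succ_iff_lt_or_eq.1 hj' with hj' | rfl
    · obtain ⟨i, hi, hie⟩ := h.complete x' y' q hq hs ⟨j', hj', he'⟩
      exact ⟨i, by omega, by rw [hold' i hi, hie]⟩
    · refine ⟨k, Nat.lt_succ_self k, ?_⟩
      rw [hnew]
      exact ((hp.ends_eq (nm := nm) ht hq (he'.symm.trans he)).1).symm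

/-- Either the line or its reverse starts at the end with the smaller name and is therefore
selected. -/
theorem exists_of_isLine (h : LinesRecorded nm n st E m k N lim s)
    (hinj : Function.Injective nm) (hG : EdgesOf st.graph E m) {x y : S} {p : st.graph.Walk x y}
    (hp : IsLine st.graph p) : ∃ i < k, edge N i = s(x, y) := by
  rcases lt_trichotomy (nm x) (nm y) with hxy | hxy | hxy
  · exact h.complete x y p hp (Or.inr hxy) ((hG.adj_iff _ _).1 hp.adj_snd)
  · exact absurd (hinj hxy) hp.2.1
  · obtain ⟨i, hi, he⟩ := h.complete y x p.reverse hp.reverse (Or.inr hxy)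
      ((hG.adj_iff _ _).1 hp.reverse.adj_snd)
    exact ⟨i, hi, by rw [he, Sym2.eq_swap]⟩

/-- The recorded lines are the edges of the tree after the line contraction. -/
theorem exists_lineContraction [Finite S] (h : LinesRecorded nm n st E m k N lim s)
    (hinj : Function.Injective nm) (hS : StageStored nm n 0 1 m E st lim s) :
    ∃ st', LineContraction st st' ∧ StageStored nm n 10 11 k N st' lim s := by
  classical
  have ht := hS.tree
  have hsound : ∀ i : ℕ, ∃ T : SearchTree S, i < k → ∃ (x y : S) (p : st.graph.Walk x y),
      N i = (x, y) ∧ IsLine st.graph p ∧ Stored nm (s.arr 15) (30 * n) lim (s.arr 11 i) T ∧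
      IsLineTree st p T := by
    intro i
    by_cases hi : i < k
    · obtain ⟨x, y, p, h1, h2, _, _, T, h3, h4⟩ := h.sound i hi
      exact ⟨T, fun _ => ⟨x, y, p, h1, h2, h3, h4⟩⟩
    · exact ⟨SearchTree.nil, fun hc => absurd hc hi⟩
  choose T hT using hsound
  -- The recorded edges are pairwise different, so the stored trees define a function on edges.
  obtain ⟨f, hf⟩ : ∃ f : Sym2 S → SearchTree S, ∀ i < k, f (edge N i) = T i := by
    refine ⟨fun e => if he : ∃ i < k, edge N i = e then T (Classical.choose he) else
      SearchTree.nil, fun i hi => ?_⟩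
    have he : ∃ i' < k, edge N i' = edge N i := ⟨i, hi, rfl⟩
    have hc := Classical.choose_spec he
    change (if he : ∃ i' < k, edge N i' = edge N i then T (Classical.choose he) else _) = T i
    rw [dif_pos he, h.inj _ hc.1 _ hi hc.2]
  have hpath : ∀ (x y : S) (p : st.graph.Walk x y), IsLine st.graph p →
      IsLineTree st p (f s(x, y)) ∨ IsLineTree st p.reverse (f s(x, y)) := by
    intro x y p hp
    obtain ⟨i, hi, he⟩ := h.exists_of_isLine hinj hS.edges hp
    obtain ⟨x', y', q, hN, hq, _, hq'⟩ := hT i hi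
    rw [← he, hf i hi]
    rw [edge, hN] at he
    rcases Sym2.eq_iff.1 he with ⟨rfl, rfl⟩ | ⟨rfl, rfl⟩
    · rw [ht.path_unique hp.1 hq.1]
      exact Or.inl hq'
    · rw [ht.path_unique hp.reverse.1 hq.1]
      exact Or.inr hq'
  have hlc : LineContraction st
      ⟨{x ∈ st.live | deg st.graph x ≠ 2}, lineGraph st.graph, st.lst, f⟩ := by
    refine ⟨rfl, fun x y => Iff.rfl, rfl, fun x y p hp hl => ?_, fun x y p hp hl => ?_⟩
    · rcases hpath x y p hp with h1 | h1
      · exact h1.1 hl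
      · rw [Sym2.eq_swap (a := x) (b := y)] at h1 ⊢
        exact h1.1 (by simpa using hl)
    · rcases hpath x y p hp with h1 | h1
      · exact Or.inl (h1.2 hl)
      · right
        have := h1.2 (by simpa using hl)
        rw [SimpleGraph.Walk.support_reverse] at this
        exact IsPathBST.swap this
  refine ⟨_, hlc, hlc.treeOn ht, ⟨fun x y => ⟨?_, ?_⟩, h.inj⟩, h.holds, ?_, ?_, hS.nil_stored⟩
  · rintro ⟨p, hp⟩
    exact h.exists_of_isLine hinj hS.edges hp
  · rintro ⟨i, hi, he⟩
    obtain ⟨x', y', q, hN, hq, _⟩ := hT i hi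
    rw [edge, hN] at he
    rw [← SimpleGraph.mem_edgeSet, ← he, SimpleGraph.mem_edgeSet]
    exact ⟨q, hq⟩
  · intro i hi
    obtain ⟨x', y', q, _, _, hq, _⟩ := hT i hi
    change Stored nm (s.arr 15) (30 * n) lim (s.arr 11 i) (f (edge N i))
    rw [hf i hi]
    exact hq
  · intro x hx
    exact hS.lst x hx.1

end LinesRecorded

end Stages

end LineLeaf
namespace LineLeaf

/-! ## The line contraction program -/

/-- Appends the edge between the nodes in the registers `6` and `7` to the new edges; the address of
its search tree is in register `10`. -/
def pushLine : Cmd := .block [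
  .st 10 (twice 4 0) (.reg 6),
  .st 10 (twice 4 1) (.reg 7),
  .st 11 (.reg 4) (.reg 10),
  .asg 4 (.add (.reg 4) (.const 1))]

/-- Records the line that has been followed. -/
def recordLine : Cmd := .ite (.eq (.reg 9) (.const 1))
  (.block [.ld 10 1 (.reg 3), pushLine])
  -- A line with several edges is met twice, at the first and at the last of them; comparing names
  -- records it once. A single edge is met only once.
  (.ite (.lt (.reg 6) (.reg 7)) (.block [buildBST, .ld 10 8 (.const 1), pushLine]) .nop)

/-- Orients the edge in register `3` away from an end of degree other than two, if there is one. -/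
def orient : Cmd := .block [
  .ld 6 0 (twice 3 0),
  .ld 7 0 (twice 3 1),
  .ld 10 2 (.reg 6),
  .ite (.eq (.reg 10) (.const 2))
    (.block [.asg 11 (.reg 6), .asg 6 (.reg 7), .asg 7 (.reg 11), .ld 10 2 (.reg 6)]) .nop]

/-- Replaces the lines by edges. -/
def contractLines : Cmd := .block [
  .asg 4 (.const 0),
  .asg 3 (.const 0),
  .loop (.lt (.reg 3) (.reg 2)) (.block [
    orient,
    .ite (.eq (.reg 10) (.const 2)) .nop (.block [walk, recordLine]),
    .asg 3 (.add (.reg 3) (.const 1))])]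

section LinePhase

variable {S : Type*} {nm : S → ℕ} {n B m : ℕ} {E : ℕ → S × S} {st : Stage S}

theorem orient_spec [Finite S] {G : SimpleGraph S} (hG : EdgesOf G E m) (hnm : ∀ x, nm x < n)
    (hmn : m < n) {s : Mach} (hE : HoldsEdges nm (s.arr 0) E m)
    (hd : DegreesKnown nm G E m s) {j : ℕ} (hj : j < m) (h3 : s.reg 3 = j)
    {Q : ℕ → Mach → Prop}
    (hQ : ∀ t s' a b, t ≤ 20 → Frame [6, 7, 10, 11] [] s s' → edge E j = s(a, b) →
      s'.reg 6 = nm a → s'.reg 7 = nm b → s'.reg 10 = deg G a →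
      (deg G a = 2 → deg G b = 2) → Q t s') :
    orient.vc n B Q s := by
  have he := hE j hj
  have hadj := hG.adj hj
  have e1 : j + j = 2 * j := by ring
  have ha := hnm (E j).1
  have hb := hnm (E j).2
  have hda := (hd _ (deg_pos_iff.2 ⟨_, hadj⟩)).1
  have hdb := (hd _ (deg_pos_iff.2 ⟨_, hadj.symm⟩)).1
  simp [orient, twice, Expr.eval, h3, e1, he, hda, hdb]
  refine ⟨by omega, fun _ => ⟨by omega, fun _ => ⟨by omega, fun _ => ⟨fun h2 => ⟨by omega, by omega,
    by omega, by omega, fun _ => ?_⟩, fun h2 => ?_⟩⟩⟩⟩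
  · refine hQ _ _ (E j).2 (E j).1 (by omega) ?_ Sym2.eq_swap (by simp) (by simp) (by simp) ?_
    · exact (((((((Frame.refl _ _ s).set_reg (by decide)).set_reg (by decide)).set_reg
        (by decide)).set_reg (by decide)).set_reg (by decide)).set_reg (by decide)).set_reg (by decide)
    · exact fun _ => h2
  · refine hQ _ _ (E j).1 (E j).2 (by omega) ?_ rfl (by simp) (by simp) (by simp)
      (fun h => absurd h h2)
    exact (((Frame.refl _ _ s).set_reg (by decide)).set_reg (by decide)).set_reg (by decide)

open Classical in
/-- The search trees of the nodes of a line between `x` and `y`. -/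
noncomputable def interiorLst (st : Stage S) (x y z : S) : SearchTree S :=
  if z = x ∨ z = y then SearchTree.nil else st.lst z

theorem pathStored_of_walkStored {lim : ℕ} {s : Mach} (hS : StageStored nm n 0 1 m E st lim s)
    (hmn : m < n) {x y : S} {p : st.graph.Walk x y} (hp : IsLine st.graph p)
    (hW : WalkStored nm E m p s) :
    PathStored nm n p.getVert p.length (interiorLst st x y) st.bst lim s := by
  refine ⟨hW.node, fun l hl => ?_, fun l h0 hl => ?_, ?_, ?_, hS.nil_stored⟩
  · obtain ⟨h1, h2⟩ := hW.edge l hl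
    exact ⟨h1.trans hmn, h2 ▸ hS.bst _ h1⟩
  · have h1 : ¬ (p.getVert l = x ∨ p.getVert l = y) := by
      rw [hp.1.getVert_eq_start_iff hl.le, hp.1.getVert_eq_end_iff hl.le]
      omega
    rw [interiorLst, if_neg h1]
    exact hS.lst _ (hS.tree.support_subset (hp.mem_live hS.tree) p _ (p.getVert_mem_support l))
  · simp [interiorLst]
  · simp [interiorLst]

theorem pushLine_spec (hB : 30 * n ≤ B) {s : Mach} {k a b q : ℕ} (h4 : s.reg 4 = k)
    (h6 : s.reg 6 = a) (h7 : s.reg 7 = b) (h10 : s.reg 10 = q) (hk : k + 1 < n) (ha : a < n)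
    (hb : b < n) (hq : q ≤ B) {Q : ℕ → Mach → Prop}
    (hQ : ∀ s', Frame [4] [10, 11] s s' → s'.reg 4 = k + 1 →
      s'.arr 10 = Function.update (Function.update (s.arr 10) (2 * k) a) (2 * k + 1) b →
      s'.arr 11 = Function.update (s.arr 11) k q → Q 5 s') : pushLine.vc n B Q s := by
  have e1 : k + k = 2 * k := by ring
  simp [pushLine, twice, Expr.eval, h4, h6, h7, h10, e1]
  refine ⟨by omega, by omega, by omega, by omega, by omega, hq, by omega, hQ _ ?_ (by simp)
    (by simp) (by simp)⟩
  exact (((Frame.refl _ _ s).set_arr (by decide)).set_arr (by decide)).set_reg (by decide)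

theorem recordLine_spec (hnm : ∀ x, nm x < n) (hmn : m < n)
    (hB : 30 * n + 6 ≤ B) {s : Mach} {lim j k : ℕ} {N : ℕ → S × S}
    (hS : StageStored nm n 0 1 m E st lim s) (hL : LinesRecorded nm n st E j k N lim s)
    (h0 : s.reg 0 = n)
    (h3 : s.reg 3 = j) (hj : j < m) (h4 : s.reg 4 = k) (hkj : k ≤ j) (h5 : s.reg 5 = lim) {a y : S}
    {p : st.graph.Walk a y} (hp : IsLine st.graph p) (he : edge E j = s(a, p.snd))
    (hW : WalkStored nm E m p s) (hpn : p.length < n)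
    (h6 : s.reg 6 = nm a) (h7 : s.reg 7 = nm y) (h9 : s.reg 9 = p.length)
    (hlim : lim + 6 * p.length ≤ B) {Q : ℕ → Mach → Prop}
    (hQ : ∀ t s' k' N', t ≤ 80 * p.length + 100 →
      Frame [4, 5, 10, 11, 13, 14, 15, 16, 17, 18, 19] [8, 9, 10, 11, 15] s s' →
      s'.reg 4 = k' → k' ≤ j + 1 → lim ≤ s'.reg 5 → s'.reg 5 ≤ lim + 6 * p.length →
      HeapLe lim s s' → LinesRecorded nm n st E (j + 1) k' N' (s'.reg 5) s' → Q t s') :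
    recordLine.vc n B Q s := by
  have ht := hS.tree
  have hG := hS.edges
  rw [recordLine, Cmd.vc_ite]
  simp only [Expr.eval, h9]
  refine ⟨fun h => ?_, fun h => ?_⟩
  · have h1 : p.length = 1 := by by_contra hc; simp [hc] at h
    have hb := hS.bst j hj
    have hbb := hb.bounds
    rw [Cmd.vc_block_cons, Cmd.vc_ld]
    simp only [Expr.eval, h3]
    refine ⟨by decide, by omega, fun hv => ?_⟩
    rw [Cmd.vc_block_cons]
    refine pushLine_spec (by omega) (k := k) (a := nm a) (b := nm y) (q := s.arr 1 j) (by simp [h4])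
      (by simp [h6]) (by simp [h7]) (by simp) (by omega) (hnm a) (hnm y) hv fun s₁ hf g4 g10 g11 => ?_
    rw [Cmd.vc_block_nil]
    have hf' : Frame [4, 5, 10, 11, 13, 14, 15, 16, 17, 18, 19] [8, 9, 10, 11, 15] s s₁ :=
      ((Frame.refl _ _ s).set_reg (by decide)).trans (hf.mono (by decide) (by decide))
    have h15 : s₁.arr 15 = s.arr 15 := hf.2 15 (by decide)
    have hh : HeapLe lim s s₁ := fun q _ => by rw [h15]
    have g5 : s₁.reg 5 = lim := by rw [hf.1 5 (by decide)]; simp [h5]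
    refine hQ _ _ (k + 1) (Function.update N k (a, y)) (by omega) hf' g4 (by omega) g5.ge (by omega) hh ?_
    rw [g5]
    refine hL.push ht hG hj hp (Or.inl h1) he hh le_rfl g10 g11
      (T := st.bst (edge E j)) (hb.heapLe hh le_rfl) ⟨fun _ => ?_, fun h => absurd h (by omega)⟩
    rw [he, IsLine.snd_eq h1]
  · have h1 : 2 ≤ p.length := by
      have := hp.length_pos
      by_contra hc
      simp [show p.length = 1 by omega] at h
    rw [Cmd.vc_ite]
    simp only [Expr.eval, h6, h7]
    refine ⟨fun h' => ?_, fun h' => ?_⟩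
    · have hlt : nm a < nm y := by by_contra hc; simp [hc] at h'
      rw [Cmd.vc_block_cons]
      refine buildBST_spec hnm h1 hpn h0 h9 h5 hlim hB
        (pathStored_of_walkStored hS hmn hp hW) fun t₁ s₁ ht₁ hf₁ g5 hh ⟨T, hT, d, hd⟩ => ?_
      have hTb := hT.bounds
      rw [Cmd.vc_block_cons, Cmd.vc_ld]
      refine ⟨by decide, by simp only [Expr.eval]; omega, fun hv => ?_⟩
      simp only [Expr.eval] at hv ⊢
      rw [Cmd.vc_block_cons]
      refine pushLine_spec (by omega) (k := k) (a := nm a) (b := nm y) (q := s₁.arr 8 1)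
        (by simp [hf₁.1 4 (by decide), h4]) (by simp [hf₁.1 6 (by decide), h6])
        (by simp [hf₁.1 7 (by decide), h7]) (by simp) (by omega) (hnm a) (hnm y) hv
        fun s₂ hf₂ g4 g10 g11 => ?_
      rw [Cmd.vc_block_nil]
      have hf' : Frame [4, 5, 10, 11, 13, 14, 15, 16, 17, 18, 19] [8, 9, 10, 11, 15] s s₂ :=
        ((hf₁.mono (by decide) (by decide)).set_reg (by decide)).trans
          (hf₂.mono (by decide) (by decide))
      have h15 : s₂.arr 15 = s₁.arr 15 := hf₂.2 15 (by decide)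
      have hh' : HeapLe lim s s₂ := fun q hq => by rw [h15, hh q hq]
      have k5 : s₂.reg 5 = lim + 6 * p.length := by rw [hf₂.1 5 (by decide)]; simp [g5]
      refine hQ _ _ (k + 1) (Function.update N k (a, y)) (by omega) hf' g4 (by omega) (by omega) (by omega) hh' ?_
      rw [k5]
      refine hL.push ht hG hj hp (Or.inr hlt) he hh' (by omega) ?_ ?_
        (hT.mono (fun q _ _ => by rw [h15]) le_rfl) ⟨fun h => by omega, fun _ => ⟨d, ?_⟩⟩
      · rw [g10]
        simp [hf₁.2 10 (by decide)]
      · rw [g11]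
        simp only [hf₁.2 11 (by decide)]
      · rw [support_eq_slice]
        exact hd
    · have hns : ¬ Selected nm p := by
        rintro (hc | hc)
        · omega
        · simp [hc] at h'
      rw [Cmd.vc_nop]
      refine hQ _ _ k N (by omega) (Frame.refl _ _ s) h4 (by omega) h5.ge (by omega)
        (HeapLe.refl _ _) ?_
      rw [h5]
      refine hL.skip (HeapLe.refl _ _) le_rfl rfl rfl fun x' y' q hq hqs hc => hns ?_
      exact (hp.ends_eq ht hq (hc.symm.trans he)).2 hqs

theorem contractLines_spec [Finite S] (hnm : ∀ x, nm x < n) (hinj : Function.Injective nm)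
    (hcard : Nat.card S ≤ n) (hmn : m < n) (hB : 30 * n + 6 ≤ B) {s : Mach} {lim : ℕ}
    (hS : StageStored nm n 0 1 m E st lim s) (hd : DegreesKnown nm st.graph E m s)
    (h0 : s.reg 0 = n) (h2 : s.reg 2 = m) (h5 : s.reg 5 = lim) (hlim : lim + 12 * m ≤ B)
    {Q : ℕ → Mach → Prop}
    (hQ : ∀ t s' k N st', t ≤ 600 * m + 10 →
      Frame [3, 4, 5, 6, 7, 8, 9, 10, 11, 13, 14, 15, 16, 17, 18, 19] [6, 7, 8, 9, 10, 11, 15] s s' →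
      s'.reg 4 = k → lim ≤ s'.reg 5 → s'.reg 5 ≤ lim + 12 * m → HeapLe lim s s' →
      LineContraction st st' → StageStored nm n 10 11 k N st' (s'.reg 5) s' → Q t s') :
    contractLines.vc n B Q s := by
  have ht := hS.tree
  have hG := hS.edges
  rw [contractLines]
  rw [Cmd.vc_block_cons, Cmd.vc_asg]
  refine ⟨by decide, by simp [Expr.eval], ?_⟩
  rw [Cmd.vc_block_cons, Cmd.vc_asg]
  refine ⟨by decide, by simp [Expr.eval], ?_⟩
  rw [Cmd.vc_block_cons]
  -- The darts `D` of the lines followed so far serve as an amortised measure of heap and time. At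
  -- the end `D.card ≤ 2 * m`, which gives `12 * m` heap cells and linear time although a single
  -- round may be long.
  refine Cmd.vc_rounds m (fun j t s' => ∃ k N D,
    Frame [3, 4, 5, 6, 7, 8, 9, 10, 11, 13, 14, 15, 16, 17, 18, 19] [6, 7, 8, 9, 10, 11, 15] s s' ∧
    s'.reg 3 = j ∧ j ≤ m ∧ s'.reg 4 = k ∧ k ≤ j ∧ lim ≤ s'.reg 5 ∧ s'.reg 5 ≤ lim + 6 * D.card ∧
    HeapLe lim s s' ∧ LinesRecorded nm n st E j k N (s'.reg 5) s' ∧ DartsBelow st.graph E j D ∧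
    t ≤ 180 * j + 110 * D.card) ?_ ?_ ?_ ?_
  · rintro j t s' ⟨k, N, D, hf, h3, hj, _⟩
    have g2 := hf.1 2 (by decide)
    refine ⟨hj, ?_⟩
    simp only [Expr.eval, h3, g2, h2]
    split <;> simp_all
  · rintro j hj t s' ⟨k, N, D, hf, h3, _, h4, hkj, hlo, hhi, hh, hL, hD, htime⟩
    have hcardD := hD.card_le hG
    have g0 := (hf.1 0 (by decide)).trans h0
    have hS' : StageStored nm n 0 1 m E st (s'.reg 5) s' := hS.mono hh hlo
      (hf.2 0 (by decide)) (hf.2 1 (by decide)) (hf.2 5 (by decide))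
    have hd' : DegreesKnown nm st.graph E m s' := by
      intro z hz
      rw [hf.2 2 (by decide), hf.2 3 (by decide), hf.2 4 (by decide)]
      exact hd z hz
    rw [Cmd.vc_block_cons]
    refine orient_spec hG hnm hmn hS'.holds hd' hj h3 fun t₁ s₁ a b ht₁ hf₁ hab k6 k7 k10
      himp => ?_
    have k15 : s₁.arr 15 = s'.arr 15 := hf₁.2 15 (by simp)
    have k3 := (hf₁.1 3 (by decide)).trans h3
    have k4 := (hf₁.1 4 (by decide)).trans h4
    have k5 := hf₁.1 5 (by decide)
    have hh₁ : ∀ l, HeapLe l s' s₁ := fun l q _ => by rw [k15]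
    have hf' := hf.trans (hf₁.mono (rs' := [3, 4, 5, 6, 7, 8, 9, 10, 11, 13, 14, 15, 16, 17, 18, 19])
      (ks' := [6, 7, 8, 9, 10, 11, 15]) (by decide) (by simp))
    rw [Cmd.vc_block_cons, Cmd.vc_ite]
    simp only [Expr.eval, k10]
    refine ⟨fun h => ?_, fun h => ?_⟩
    -- Both ends have degree two, so no line starts with this edge.
    · have hda : deg st.graph a = 2 := by by_contra hc; simp [hc] at h
      simp only [Cmd.vc_nop, Cmd.vc_block_cons, Cmd.vc_block_nil, Cmd.vc_asg, Expr.eval, k3]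
      refine ⟨by decide, by omega, k, N, D, hf'.set_reg (by decide), by simp, by omega, by simp [k4], by omega,
        by simp [k5, hlo], by simp [k5, hhi], fun q hq => by simp [k15, hh q hq], ?_,
        hD.mono (Nat.le_succ j), by omega⟩
      refine hL.skip (fun q _ => by simp [k15]) (by simp [k5]) (by simp [hf₁.2 10 (by simp)])
        (by simp [hf₁.2 11 (by simp)]) fun x y p hp _ hc => ?_
      have hx : x = a ∨ x = b := by
        have : x ∈ s(a, b) := by rw [← hab, hc]; simp
        simpa using this
      rcases hx with rfl | rfl
      · exact hp.2.2.1 hda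
      · exact hp.2.2.1 (himp hda)
    · have hda : deg st.graph a ≠ 2 := by intro hc; simp [hc] at h
      have hS₁ : StageStored nm n 0 1 m E st (s'.reg 5) s₁ := hS'.mono (hh₁ _) le_rfl
        (hf₁.2 0 (by simp)) (hf₁.2 1 (by simp)) (hf₁.2 5 (by simp))
      have hd₁ : DegreesKnown nm st.graph E m s₁ := by
        intro z hz
        rw [hf₁.2 2 (by simp), hf₁.2 3 (by simp), hf₁.2 4 (by simp)]
        exact hd' z hz
      rw [Cmd.vc_block_cons]
      refine walk_spec ht hG hnm hcard (by omega) hmn hS₁.holds hd₁ hj k3 k6 k7 hab hda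
        fun t₂ s₂ y p ht₂ hf₂ hp hsnd l7 l9 hpn hW => ?_
      have l15 : s₂.arr 15 = s₁.arr 15 := hf₂.2 15 (by decide)
      have hh₂ : ∀ l, HeapLe l s₁ s₂ := fun l q _ => by rw [l15]
      have hS₂ : StageStored nm n 0 1 m E st (s'.reg 5) s₂ := hS₁.mono (hh₂ _) le_rfl
        (hf₂.2 0 (by decide)) (hf₂.2 1 (by decide)) (hf₂.2 5 (by decide))
      have hL₂ : LinesRecorded nm n st E j k N (s'.reg 5) s₂ :=
        hL.mono ((hh₁ _).trans (hh₂ _) le_rfl)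
          ((hf₂.2 10 (by decide)).trans (hf₁.2 10 (by simp)))
          ((hf₂.2 11 (by decide)).trans (hf₁.2 11 (by simp)))
      have he : edge E j = s(a, p.snd) := by rw [hsnd, hab]
      obtain ⟨D', hD', hcard'⟩ := hD.add ht hG hj hp he
      have hcardD' := hD'.card_le hG
      rw [Cmd.vc_block_cons]
      refine recordLine_spec hnm hmn hB hS₂ hL₂
        ((hf₂.1 0 (by decide)).trans ((hf₁.1 0 (by decide)).trans g0))
        ((hf₂.1 3 (by decide)).trans k3) hj ((hf₂.1 4 (by decide)).trans k4) hkj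
        ((hf₂.1 5 (by decide)).trans k5) hp he hW hpn ((hf₂.1 6 (by decide)).trans k6) l7 l9
        (by omega) fun t₃ s₃ k' N' ht₃ hf₃ m4 hk' hlo' hhi' hh₃ hL₃ => ?_
      have m3 : s₃.reg 3 = j := (hf₃.1 3 (by decide)).trans ((hf₂.1 3 (by decide)).trans k3)
      simp only [Cmd.vc_block_cons, Cmd.vc_block_nil, Cmd.vc_asg, Expr.eval, m3]
      have hh' : HeapLe (s'.reg 5) s' s₃ :=
        ((hh₁ _).trans (hh₂ _) le_rfl).trans hh₃ le_rfl
      refine ⟨by decide, by omega, k', N', D', ((hf'.trans (hf₂.mono (by decide) (by decide))).trans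
        (hf₃.mono (by decide) (by decide))).set_reg (by decide), by simp, by omega, by simp [m4], hk',
        by simp; omega, by simp; omega, hh.trans hh' hlo, ?_, hD', by omega⟩
      rw [show Function.update s₃.reg 3 (j + 1) 5 = s₃.reg 5 by simp]
      exact hL₃.mono (HeapLe.refl _ _) rfl rfl
  · refine ⟨0, E, ∅, ((Frame.refl _ _ s).set_reg (by decide)).set_reg (by decide), by simp [Expr.eval],
      by omega, by simp [Expr.eval], le_rfl, by simp [h5], by simp [h5], HeapLe.refl _ _,
      ⟨fun i hi => by omega, fun i hi => by omega, fun i hi => by omega, ?_⟩,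
      fun d hd => by simp at hd, by simp⟩
    rintro x y p _ _ ⟨j, hj, _⟩
    omega
  · rintro t s' ⟨k, N, D, hf, h3, _, h4, hkj, hlo, hhi, hh, hL, hD, htime⟩
    have hcardD := hD.card_le hG
    have hS' : StageStored nm n 0 1 m E st (s'.reg 5) s' := hS.mono hh hlo
      (hf.2 0 (by decide)) (hf.2 1 (by decide)) (hf.2 5 (by decide))
    obtain ⟨st', hc, hS''⟩ := hL.exists_lineContraction hinj hS'
    rw [Cmd.vc_block_nil]
    exact hQ _ _ k N st' (by omega) hf h4 hlo (by omega) hh hc hS''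

end LinePhase

end LineLeaf
namespace LineLeaf

/-! ## Bookkeeping of leaf contractions -/

section Leaves

variable {S : Type*} {nm : S → ℕ} {n k : ℕ} {M : ℕ → S × S} {st : Stage S} {G : SimpleGraph S}
  {live : Set S}

/-- If two neighbours both have degree one, then there are no other nodes. -/
theorem TreeOn.eq_or_eq_of_deg_one (h : TreeOn live G) [Finite S] {a b z : S} (hab : G.Adj a b)
    (ha : deg G a = 1) (hb : deg G b = 1) (hz : z ∈ live) : z = a ∨ z = b := by
  classical
  obtain ⟨q⟩ := h.reachable (h.left_mem hab) hz
  have hp := q.bypass_isPath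
  set p := q.bypass
  by_contra hc
  push Not at hc
  have hl : 0 < p.length := by
    by_contra h0
    exact hc.1 (SimpleGraph.Walk.eq_of_length_eq_zero (by omega : p.length = 0)).symm
  -- A path from `a` to a third node passes through `b`, which would then have degree at least two.
  have hs : p.snd = b := eq_of_deg_one ha (by simpa using p.adj_getVert_succ hl) hab
  have := two_le_deg_of_interior hp (z := b) (hs ▸ p.getVert_mem_support 1) hab.ne' hc.2.symm
  omega

/-- Every edge with a leaf is directed towards a leaf. -/
def Leafward (G : SimpleGraph S) (M : ℕ → S × S) (k : ℕ) : Prop :=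
  ∀ j < k, deg G (M j).1 = 1 → deg G (M j).2 = 1

/-- The nodes that are not absorbed by a neighbour. -/
def remaining (live : Set S) (G : SimpleGraph S) (M : ℕ → S × S) (k : ℕ) : Set S :=
  {x ∈ live | ∀ j < k, deg G (M j).2 = 1 → x ≠ (M j).2}

open Classical in
/-- The leaves that `x` has absorbed after `j` edges. -/
noncomputable def absorbed (G : SimpleGraph S) (M : ℕ → S × S) (x : S) : ℕ → List S
  | 0 => []
  | j + 1 => if deg G (M j).2 = 1 ∧ (M j).1 = x then (M j).2 :: absorbed G M x j
      else absorbed G M x j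

theorem absorbed_succ_of_eq {j : ℕ} (h : deg G (M j).2 = 1) :
    absorbed G M (M j).1 (j + 1) = (M j).2 :: absorbed G M (M j).1 j := by
  rw [absorbed, if_pos ⟨h, rfl⟩]

theorem absorbed_succ_of_ne {j : ℕ} {x : S} (h : ¬ (deg G (M j).2 = 1 ∧ (M j).1 = x)) :
    absorbed G M x (j + 1) = absorbed G M x j := by
  rw [absorbed, if_neg h]

theorem mem_absorbed {x y : S} {j : ℕ} :
    y ∈ absorbed G M x j ↔ ∃ i < j, deg G (M i).2 = 1 ∧ M i = (x, y) := by
  induction j with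
  | zero => simp [absorbed]
  | succ j ih =>
    by_cases h : deg G (M j).2 = 1 ∧ (M j).1 = x
    · obtain ⟨h1, rfl⟩ := h
      rw [absorbed_succ_of_eq h1, List.mem_cons, ih]
      constructor
      · rintro (rfl | ⟨i, hi, h2⟩)
        · exact ⟨j, Nat.lt_succ_self j, h1, rfl⟩
        · exact ⟨i, by omega, h2⟩
      · rintro ⟨i, hi, h2, h3⟩
        rcases Nat.lt_succ_iff_lt_or_eq.1 hi with hi | rfl
        · exact Or.inr ⟨i, hi, h2, h3⟩
        · exact Or.inl (by rw [h3])
    · rw [absorbed_succ_of_ne h, ih]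
      constructor
      · rintro ⟨i, hi, h2⟩
        exact ⟨i, by omega, h2⟩
      · rintro ⟨i, hi, h2, h3⟩
        rcases Nat.lt_succ_iff_lt_or_eq.1 hi with hi | rfl
        · exact ⟨i, hi, h2, h3⟩
        · exact absurd ⟨h2, by rw [h3]⟩ h

theorem nodup_absorbed (hG : EdgesOf G M k) {x : S} {j : ℕ} (hj : j ≤ k) :
    (absorbed G M x j).Nodup := by
  induction j with
  | zero => simp [absorbed]
  | succ j ih =>
    by_cases h : deg G (M j).2 = 1 ∧ (M j).1 = x
    · obtain ⟨h1, rfl⟩ := h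
      rw [absorbed_succ_of_eq h1, List.nodup_cons]
      refine ⟨fun hc => ?_, ih (by omega)⟩
      obtain ⟨i, hi, _, h2⟩ := mem_absorbed.1 hc
      exact hi.ne (hG.inj i (by omega) j (by omega) (by rw [edge, edge, h2]))
    · rw [absorbed_succ_of_ne h]
      exact ih (by omega)

/-- A leaf is an end of one edge only. -/
theorem EdgesOf.eq_of_leaf (hG : EdgesOf G M k) {x : S} (hx : deg G x = 1) {i j : ℕ} (hi : i < k)
    (hj : j < k) (hxi : x ∈ edge M i) (hxj : x ∈ edge M j) : i = j := by
  obtain ⟨y, hy, he⟩ := (hG.mem_edge_iff hi).1 hxi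
  obtain ⟨z, hz, he'⟩ := (hG.mem_edge_iff hj).1 hxj
  refine hG.inj i hi j hj ?_
  rw [he, he', eq_of_deg_one hx hy hz]

/-- A node that absorbs a leaf remains. -/
theorem EdgesOf.fst_mem_remaining (hG : EdgesOf G M k) (ht : TreeOn live G) {j : ℕ} (hj : j < k)
    (h : deg G (M j).2 = 1) : (M j).1 ∈ remaining live G M k := by
  refine ⟨ht.left_mem (hG.adj hj), fun i hi h1 he => ?_⟩
  have : i = j := hG.eq_of_leaf h1 hi hj (Sym2.mem_mk_right _ _) (he ▸ Sym2.mem_mk_left _ _)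
  subst this
  exact (hG.adj hi).ne he

/-- The only edge at a leaf is the one through which it is absorbed. So the tree stored for the leaf
at that moment is still the original `LST`. -/
theorem EdgesOf.absorbed_snd (hG : EdgesOf G M k) {j : ℕ} (hj : j < k) (h : deg G (M j).2 = 1) :
    absorbed G M (M j).2 j = [] := by
  rw [List.eq_nil_iff_forall_not_mem]
  intro y hy
  obtain ⟨i, hi, _, h2⟩ := mem_absorbed.1 hy
  have : i = j := hG.eq_of_leaf h (hi.trans hj) hj (by rw [edge, h2]; simp) (Sym2.mem_mk_right _ _)
  omega

/-- A leaf in the first place of its edge has, by `Leafward`, a leaf in the second place as well.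
Then the tree is a single edge, contrary to `hne`; so every leaf is in the second place and is
absorbed. -/
theorem remaining_eq (ht : TreeOn live G) [Finite S] (hG : EdgesOf G M k) (hM : Leafward G M k)
    (hn : live.Nontrivial) (hne : {x ∈ live | deg G x ≠ 1}.Nonempty) :
    remaining live G M k = {x ∈ live | deg G x ≠ 1} := by
  ext x
  constructor
  · rintro ⟨hx, hrem⟩
    refine ⟨hx, fun hx1 => ?_⟩
    obtain ⟨y, hy⟩ := deg_pos_iff.1 (ht.deg_pos hn hx)
    obtain ⟨j, hj, he⟩ := (hG.adj_iff x y).1 hy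
    rcases Sym2.eq_iff.1 he with ⟨h1, h2⟩ | ⟨h1, h2⟩
    · have hy1 := hM j hj (by rw [h1]; exact hx1)
      rw [h2] at hy1
      obtain ⟨z, hz, hz1⟩ := hne
      rcases ht.eq_or_eq_of_deg_one hy hx1 hy1 hz with rfl | rfl
      · exact hz1 hx1
      · exact hz1 hy1
    · exact hrem j hj (by rw [h2]; exact hx1) h2.symm
  · rintro ⟨hx, hx1⟩
    exact ⟨hx, fun j _ h he => hx1 (he ▸ h)⟩

/-- The stage after the leaf contraction. -/
noncomputable def leafStage (st : Stage S) (M : ℕ → S × S) (k : ℕ) : Stage S where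
  live := remaining st.live st.graph M k
  graph :=
    { Adj := fun x y => st.graph.Adj x y ∧ x ∈ remaining st.live st.graph M k ∧
        y ∈ remaining st.live st.graph M k
      symm := ⟨fun _ _ h => ⟨h.1.symm, h.2.2, h.2.1⟩⟩
      loopless := ⟨fun _ h => h.1.ne rfl⟩ }
  lst := by
    classical
    exact fun x => if x ∈ remaining st.live st.graph M k then
      addQueries st x (absorbed st.graph M x k) else st.lst x
  bst := st.bst

theorem leafContraction_leafStage (ht : TreeOn st.live st.graph) [Finite S]
    (hG : EdgesOf st.graph M k) (hM : Leafward st.graph M k) (hn : st.live.Nontrivial) :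
    LeafContraction st (leafStage st M k) where
  live_eq hne := remaining_eq ht hG hM hn hne
  live_root hne := by
    -- The tree is a single edge here; its first end absorbs the second and becomes the root.
    have h1 : ∀ x ∈ st.live, deg st.graph x = 1 := fun x hx => by
      by_contra hc
      exact hne ⟨x, hx, hc⟩
    obtain ⟨x, hx⟩ := hn.nonempty
    obtain ⟨y, hy⟩ := deg_pos_iff.1 (ht.deg_pos hn hx)
    obtain ⟨j, hj, he⟩ := (hG.adj_iff x y).1 hy
    have ha := hG.adj hj
    have ha1 := h1 _ (ht.left_mem ha)
    have hb1 := h1 _ (ht.right_mem ha)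
    refine ⟨(M j).1, ht.left_mem ha, Set.eq_singleton_iff_unique_mem.2
      ⟨hG.fst_mem_remaining ht hj hb1, ?_⟩⟩
    rintro z ⟨hz, hrem⟩
    exact (ht.eq_or_eq_of_deg_one ha ha1 hb1 hz).resolve_right (hrem j hj hb1)
  adj_iff _ _ := Iff.rfl
  bst_eq := rfl
  lst_live x hx := by
    refine ⟨absorbed st.graph M x k, nodup_absorbed hG le_rfl, fun y => ?_, if_pos hx⟩
    rw [mem_absorbed]
    constructor
    · rintro ⟨j, hj, h1, h2⟩
      have ha := hG.adj hj
      rw [h2] at ha h1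
      exact ⟨ha, fun hy => hy.2 j hj (by rw [h2]; exact h1) (by rw [h2])⟩
    · rintro ⟨hxy, hy⟩
      have : ∃ j < k, deg st.graph (M j).2 = 1 ∧ y = (M j).2 := by
        by_contra hc
        push Not at hc
        exact hy ⟨ht.right_mem hxy, hc⟩
      obtain ⟨j, hj, h1, rfl⟩ := this
      exact ⟨j, hj, h1, Prod.ext (eq_of_deg_one h1 (hG.adj hj).symm hxy.symm) rfl⟩
  lst_dead x hx := if_neg hx

/-- The edges below `j` without leaves are listed in `E`. -/
structure KeptEdges (G : SimpleGraph S) (M : ℕ → S × S) (j : ℕ) (E : ℕ → S × S) (m : ℕ) : Prop where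
  iff : ∀ e, (∃ i < m, edge E i = e) ↔ ∃ i < j, deg G (M i).2 ≠ 1 ∧ edge M i = e
  inj : ∀ i < m, ∀ i' < m, edge E i = edge E i' → i = i'

theorem KeptEdges.skip {j m : ℕ} {E : ℕ → S × S} (h : KeptEdges G M j E m)
    (hj : deg G (M j).2 = 1) : KeptEdges G M (j + 1) E m := by
  refine ⟨fun e => (h.iff e).trans ⟨?_, ?_⟩, h.inj⟩
  · rintro ⟨i, hi, h1⟩
    exact ⟨i, by omega, h1⟩
  · rintro ⟨i, hi, h1⟩
    rcases Nat.lt_succ_iff_lt_or_eq.1 hi with hi | rfl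
    · exact ⟨i, hi, h1⟩
    · exact absurd hj h1.1

theorem KeptEdges.push {j m : ℕ} {E : ℕ → S × S} (h : KeptEdges G M j E m) (hG : EdgesOf G M k)
    (hjk : j < k) (hj : deg G (M j).2 ≠ 1) :
    KeptEdges G M (j + 1) (Function.update E m (M j)) (m + 1) := by
  have hold : ∀ i < m, edge (Function.update E m (M j)) i = edge E i := fun i hi => by
    rw [edge, Function.update_of_ne hi.ne, edge]
  have hnew : edge (Function.update E m (M j)) m = edge M j := by simp [edge]
  have hne : ∀ i < m, edge E i ≠ edge M j := by
    intro i hi hc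
    obtain ⟨i', hi', _, h2⟩ := (h.iff _).1 ⟨i, hi, hc⟩
    exact hi'.ne (hG.inj _ (hi'.trans hjk) _ hjk h2)
  refine ⟨fun e => ⟨?_, ?_⟩, fun i hi i' hi' hii => ?_⟩
  · rintro ⟨i, hi, he⟩
    rcases Nat.lt_succ_iff_lt_or_eq.1 hi with hi | rfl
    · obtain ⟨i', hi', h1⟩ := (h.iff e).1 ⟨i, hi, by rw [← hold i hi, he]⟩
      exact ⟨i', by omega, h1⟩
    · exact ⟨j, Nat.lt_succ_self j, hj, by rw [← hnew, he]⟩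
  · rintro ⟨i, hi, h1⟩
    rcases Nat.lt_succ_iff_lt_or_eq.1 hi with hi | rfl
    · obtain ⟨i', hi', h2⟩ := (h.iff e).2 ⟨i, hi, h1⟩
      exact ⟨i', by omega, by rw [hold i' hi', h2]⟩
    · exact ⟨m, Nat.lt_succ_self m, by rw [hnew, h1.2]⟩
  · rcases Nat.lt_succ_iff_lt_or_eq.1 hi with hi | rfl <;>
      rcases Nat.lt_succ_iff_lt_or_eq.1 hi' with hi' | rfl
    · rw [hold i hi, hold i' hi'] at hii
      exact h.inj i hi i' hi' hii
    · rw [hold i hi, hnew] at hii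
      exact absurd hii (hne i hi)
    · rw [hnew, hold i' hi'] at hii
      exact absurd hii.symm (hne i' hi')
    · rfl

/-- If the second end of an edge is not a leaf, then by `Leafward` neither is the first, so both
ends remain. -/
theorem KeptEdges.edgesOf {m : ℕ} {E : ℕ → S × S} (h : KeptEdges st.graph M k E m)
    (ht : TreeOn st.live st.graph) (hG : EdgesOf st.graph M k) (hM : Leafward st.graph M k) :
    EdgesOf (leafStage st M k).graph E m := by
  refine ⟨fun x y => ?_, h.inj⟩
  rw [h.iff]
  constructor
  · rintro ⟨hxy, hx, hy⟩
    obtain ⟨j, hj, he⟩ := (hG.adj_iff x y).1 hxy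
    refine ⟨j, hj, fun h1 => ?_, he⟩
    rcases Sym2.eq_iff.1 he with ⟨h2, h3⟩ | ⟨h2, h3⟩
    · exact hy.2 j hj h1 h3.symm
    · exact hx.2 j hj h1 h3.symm
  · rintro ⟨j, hj, h1, he⟩
    have hxy : st.graph.Adj x y := (hG.adj_iff x y).2 ⟨j, hj, he⟩
    have h2 : deg st.graph (M j).1 ≠ 1 := fun hc => h1 (hM j hj hc)
    have key : ∀ z ∈ st.live, z ∈ edge M j → z ∈ remaining st.live st.graph M k := by
      intro z hz hzj
      refine ⟨hz, fun i _ hi1 hi2 => ?_⟩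
      rw [← hi2] at hi1
      rcases Sym2.mem_iff.1 hzj with rfl | rfl
      · exact h2 hi1
      · exact h1 hi1
    exact ⟨hxy, key x (ht.left_mem hxy) (by rw [he]; simp),
      key y (ht.right_mem hxy) (by rw [he]; simp)⟩

end Leaves

end LineLeaf
namespace LineLeaf

/-! ## The leaf contraction program -/

/-- Orients the edge in register `3` towards a leaf, if there is one. -/
def orientLeaf : Cmd := .block [
  .ld 6 10 (twice 3 0),
  .ld 7 10 (twice 3 1),
  .ld 17 11 (.reg 3),
  .ld 10 2 (.reg 7),
  .ite (.eq (.reg 10) (.const 1)) .nop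
    (.block [.asg 11 (.reg 6), .asg 6 (.reg 7), .asg 7 (.reg 11), .ld 10 2 (.reg 7)])]

/-- Absorbs the leaf in register `7` into its neighbour in register `6`. -/
def absorbLeaf : Cmd := .block [
  .ld 16 5 (.reg 6),
  .ld 18 5 (.reg 7),
  newQuery (.reg 6) (.reg 7) (.reg 16) (.reg 17) (.reg 18),
  .st 5 (.reg 6) (.sub (.reg 5) (.const 6)),
  .asg 12 (.reg 6)]

/-- Keeps the edge in the registers `6`, `7` and `17`. -/
def keepEdge : Cmd := .block [
  .st 0 (twice 2 0) (.reg 6),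
  .st 0 (twice 2 1) (.reg 7),
  .st 1 (.reg 2) (.reg 17),
  .asg 2 (.add (.reg 2) (.const 1))]

/-- Contracts the leaves. -/
def contractLeaves : Cmd := .block [
  .asg 2 (.const 0),
  .asg 3 (.const 0),
  .loop (.lt (.reg 3) (.reg 4)) (.block [
    orientLeaf,
    .ite (.eq (.reg 10) (.const 1)) absorbLeaf keepEdge,
    .asg 3 (.add (.reg 3) (.const 1))])]

section LeafPhase

variable {S : Type*} {nm : S → ℕ} {n B k : ℕ} {N M : ℕ → S × S} {st : Stage S}

/-- The edge `e`, with a leaf in the second place if it has one. -/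
noncomputable def towardsLeaf (G : SimpleGraph S) (e : S × S) : S × S :=
  if deg G e.2 = 1 then e else e.swap

theorem edge_towardsLeaf (G : SimpleGraph S) (N : ℕ → S × S) (j : ℕ) :
    edge (fun j => towardsLeaf G (N j)) j = edge N j := by
  rw [edge, edge, towardsLeaf]
  split
  · rfl
  · exact Sym2.eq_swap

theorem leafward_towardsLeaf (G : SimpleGraph S) (N : ℕ → S × S) (k : ℕ) :
    Leafward G (fun j => towardsLeaf G (N j)) k := by
  intro j _
  change deg G (towardsLeaf G (N j)).1 = 1 → deg G (towardsLeaf G (N j)).2 = 1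
  rw [towardsLeaf]
  split
  · exact fun _ => by assumption
  · exact fun h => absurd h (by assumption)

theorem EdgesOf.orient {G : SimpleGraph S} (h : EdgesOf G N k) :
    EdgesOf G (fun j => towardsLeaf G (N j)) k :=
  ⟨fun x y => by simpa only [edge_towardsLeaf] using h.adj_iff x y,
    fun i hi j hj hij => h.inj i hi j hj (by simpa only [edge_towardsLeaf] using hij)⟩

theorem orientLeaf_spec [Finite S] {G : SimpleGraph S} (hG : EdgesOf G N k) (hnm : ∀ x, nm x < n)
    (hkn : k < n) {s : Mach} (hE : HoldsEdges nm (s.arr 10) N k)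
    (hd : ∀ x, 0 < deg G x → s.arr 2 (nm x) = deg G x) {j : ℕ} (hj : j < k) (h3 : s.reg 3 = j)
    (hM : M = fun j => towardsLeaf G (N j)) {Q : ℕ → Mach → Prop}
    (hQ : ∀ t s', t ≤ 20 → Frame [6, 7, 10, 11, 17] [] s s' → s'.reg 6 = nm (M j).1 →
      s'.reg 7 = nm (M j).2 → s'.reg 10 = deg G (M j).2 → s'.reg 17 = s.arr 11 j → Q t s') :
    orientLeaf.vc n B Q s := by
  have he := hE j hj
  have hadj := hG.adj hj
  have e1 : j + j = 2 * j := by ring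
  have ha := hnm (N j).1
  have hb := hnm (N j).2
  have hda := hd _ (deg_pos_iff.2 ⟨_, hadj⟩)
  have hdb := hd _ (deg_pos_iff.2 ⟨_, hadj.symm⟩)
  have hMj : M j = towardsLeaf G (N j) := by rw [hM]
  simp [orientLeaf, twice, Expr.eval, h3, e1, he, hda, hdb]
  refine ⟨by omega, fun _ => ⟨by omega, fun _ => ⟨by omega, fun _ => ⟨by omega, fun _ =>
    ⟨fun h1 => ?_, fun h1 => ⟨by omega, by omega, by omega, by omega, fun _ => ?_⟩⟩⟩⟩⟩⟩
  · rw [towardsLeaf, if_pos h1] at hMj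
    refine hQ _ _ (by omega) ?_ (by simp [hMj]) (by simp [hMj]) (by simp [hMj]) (by simp)
    exact ((((Frame.refl _ _ s).set_reg (by decide)).set_reg (by decide)).set_reg
      (by decide)).set_reg (by decide)
  · rw [towardsLeaf, if_neg h1] at hMj
    refine hQ _ _ (by omega) ?_ (by simp [hMj]) (by simp [hMj]) (by simp [hMj]) (by simp)
    exact ((((((((Frame.refl _ _ s).set_reg (by decide)).set_reg (by decide)).set_reg
      (by decide)).set_reg (by decide)).set_reg (by decide)).set_reg (by decide)).set_reg
        (by decide)).set_reg (by decide)

/-- The state of the leaf contraction after `j` edges. -/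
structure LeavesDone (nm : S → ℕ) (n : ℕ) (st : Stage S) (M : ℕ → S × S) (j : ℕ) (E : ℕ → S × S)
    (m lim : ℕ) (s : Mach) : Prop where
  le : m ≤ j
  holds : HoldsEdges nm (s.arr 0) E m
  kept : KeptEdges st.graph M j E m
  bst : ∀ i < m, Stored nm (s.arr 15) (30 * n) lim (s.arr 1 i) (st.bst (edge E i))
  lst : ∀ x ∈ st.live, Stored nm (s.arr 15) (30 * n) lim (s.arr 5 (nm x))
    (addQueries st x (absorbed st.graph M x j))
  -- If all edges so far led to leaves, register `12` names the last node that absorbed one; this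
  -- finds the root when no edge is kept.
  root : 0 < j → m = 0 → ∃ i < j, deg st.graph (M i).2 = 1 ∧ s.reg 12 = nm (M i).1

theorem LeavesDone.mono {j m lim : ℕ} {E : ℕ → S × S} {s s' : Mach}
    (h : LeavesDone nm n st M j E m lim s) (h0 : s'.arr 0 = s.arr 0) (h1 : s'.arr 1 = s.arr 1)
    (h5 : s'.arr 5 = s.arr 5) (h15 : s'.arr 15 = s.arr 15) (h12 : s'.reg 12 = s.reg 12) :
    LeavesDone nm n st M j E m lim s' := by
  refine ⟨h.le, h0 ▸ h.holds, h.kept, ?_, ?_, h12 ▸ h.root⟩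
  · rw [h15, h1]; exact h.bst
  · rw [h15, h5]; exact h.lst

theorem absorbLeaf_spec (hnm : ∀ x, nm x < n) (hinj : Function.Injective nm)
    (hB : 30 * n + 6 ≤ B) {s : Mach} {lim j m : ℕ} {E : ℕ → S × S}
    (ht : TreeOn st.live st.graph) (hG : EdgesOf st.graph M k) (hj : j < k)
    (hL : LeavesDone nm n st M j E m lim s) (h5 : s.reg 5 = lim) (hlim : lim + 6 ≤ B)
    (h6 : s.reg 6 = nm (M j).1) (h7 : s.reg 7 = nm (M j).2) (h1 : deg st.graph (M j).2 = 1)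
    (hq : Stored nm (s.arr 15) (30 * n) lim (s.reg 17) (st.bst (edge M j)))
    {Q : ℕ → Mach → Prop}
    (hQ : ∀ t s', t ≤ 20 → Frame [5, 12, 16, 18] [5, 15] s s' → s'.reg 5 = lim + 6 → HeapLe lim s s' →
      LeavesDone nm n st M (j + 1) E m (lim + 6) s' → Q t s') : absorbLeaf.vc n B Q s := by
  have hadj := hG.adj hj
  have ha := hL.lst _ (ht.left_mem hadj)
  have hb := hL.lst _ (ht.right_mem hadj)
  rw [hG.absorbed_snd hj h1] at hb
  have hna := hnm (M j).1
  have hnb := hnm (M j).2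
  rw [absorbLeaf, Cmd.vc_block_cons, Cmd.vc_ld]
  simp only [Expr.eval, h6]
  refine ⟨by decide, by omega, fun _ => ?_⟩
  have g7 : Function.update s.reg 16 (s.arr 5 (nm (M j).1)) 7 = nm (M j).2 := by simp [h7]
  rw [Cmd.vc_block_cons, Cmd.vc_ld]
  simp only [Expr.eval, g7]
  refine ⟨by decide, by omega, fun _ => ?_⟩
  rw [Cmd.vc_block_cons]
  refine newQuery_spec (x := (M j).1) (y := (M j).2) (p := lim) (by simp [h5]) hlim hB
    (by simp [Expr.eval, h6]) (by simp [Expr.eval, h7]) hna hnb (by simpa [Expr.eval] using ha)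
    (by simpa [Expr.eval] using hq) (by simpa [Expr.eval] using hb) fun s₁ hf₁ k5 hh hT => ?_
  have k6 : s₁.reg 6 = nm (M j).1 := by rw [hf₁.1 6 (by decide)]; simp [h6]
  have ka : ∀ i ≠ 15, s₁.arr i = s.arr i := fun i hi => hf₁.2 i (by simpa using hi)
  have hh' : HeapLe lim s s₁ := hh
  simp [Expr.eval, k6, k5]
  refine ⟨by omega, by omega, by omega, hQ _ _ (by omega) ?_ (by simp [k5])
    (fun q hq => by simpa using hh' q hq) ⟨by have := hL.le; omega, ?_, hL.kept.skip h1, fun i hi => ?_,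
      fun x hx => ?_, fun _ _ => ⟨j, Nat.lt_succ_self j, h1, by simp⟩⟩⟩
  · have h0 : Frame [5, 12, 16, 18] [5, 15] s s₁ := Frame.trans (((Frame.refl _ _ s).set_reg
      (by decide)).set_reg (by decide)) (hf₁.mono (by decide) (by decide))
    exact (h0.set_arr (by decide)).set_reg (by decide)
  · simpa [ka 0 (by decide)] using hL.holds
  · simpa [ka 1 (by decide)] using (hL.bst i hi).heapLe hh' (by omega)
  · by_cases hxa : x = (M j).1
    · subst hxa
      rw [absorbed_succ_of_eq h1]
      simpa [addQueries, edge] using hT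
    · rw [absorbed_succ_of_ne fun h => hxa h.2.symm]
      have : nm x ≠ nm (M j).1 := fun h => hxa (hinj h)
      simpa [this, ka 5 (by decide)] using (hL.lst x hx).heapLe hh' (by omega)

theorem keepEdge_spec (hnm : ∀ x, nm x < n) (hkn : k < n) (hB : 30 * n + 6 ≤ B) {s : Mach}
    {lim j m : ℕ} {E : ℕ → S × S} (hG : EdgesOf st.graph M k) (hj : j < k)
    (hL : LeavesDone nm n st M j E m lim s) (h2 : s.reg 2 = m) (hlim : lim ≤ B)
    (h6 : s.reg 6 = nm (M j).1) (h7 : s.reg 7 = nm (M j).2) (h1 : deg st.graph (M j).2 ≠ 1)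
    (hq : Stored nm (s.arr 15) (30 * n) lim (s.reg 17) (st.bst (edge M j)))
    {Q : ℕ → Mach → Prop}
    (hQ : ∀ t s', t ≤ 20 → Frame [2] [0, 1] s s' → s'.reg 2 = m + 1 →
      LeavesDone nm n st M (j + 1) (Function.update E m (M j)) (m + 1) lim s' → Q t s') :
    keepEdge.vc n B Q s := by
  have hna := hnm (M j).1
  have hnb := hnm (M j).2
  have hle := hL.le
  have hqb := hq.bounds
  have e1 : m + m = 2 * m := by ring
  simp [keepEdge, twice, Expr.eval, h2, h6, h7, e1]
  refine ⟨by omega, by omega, by omega, by omega, by omega, by omega, by omega, hQ _ _ (by omega) ?_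
    (by simp) ⟨by omega, fun i hi => ?_, hL.kept.push hG hj h1, fun i hi => ?_, fun x hx => ?_,
      fun _ h => absurd h (by omega)⟩⟩
  · exact (((Frame.refl _ _ s).set_arr (by decide)).set_arr (by decide)).set_reg (by decide)
  · rcases Nat.lt_succ_iff_lt_or_eq.1 hi with hi | rfl
    · rw [Function.update_of_ne hi.ne]
      simp [show 2 * i ≠ 2 * m by omega, show 2 * i ≠ 2 * m + 1 by omega,
        show 2 * i + 1 ≠ 2 * m by omega, hL.holds i hi]
    · simp
  · rcases Nat.lt_succ_iff_lt_or_eq.1 hi with hi | rfl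
    · rw [show edge (Function.update E m (M j)) i = edge E i by
        rw [edge, Function.update_of_ne hi.ne, edge]]
      simpa [hi.ne] using hL.bst i hi
    · simpa [edge] using hq
  · rw [absorbed_succ_of_ne fun h => h1 h.1]
    simpa using hL.lst x hx

theorem contractLeaves_spec [Finite S] (hnm : ∀ x, nm x < n) (hinj : Function.Injective nm)
    (hkn : k < n) (hB : 30 * n + 6 ≤ B) {s : Mach} {lim : ℕ}
    (hS : StageStored nm n 10 11 k N st lim s)
    (hd : ∀ x, 0 < deg st.graph x → s.arr 2 (nm x) = deg st.graph x)
    (hn : st.live.Nontrivial) (h4 : s.reg 4 = k) (h5 : s.reg 5 = lim) (hlim : lim + 6 * k ≤ B)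
    {Q : ℕ → Mach → Prop}
    (hQ : ∀ t s' m E st', t ≤ 60 * k + 10 →
      Frame [2, 3, 5, 6, 7, 10, 11, 12, 16, 17, 18] [0, 1, 5, 15] s s' →
      s'.reg 2 = m → lim ≤ s'.reg 5 → s'.reg 5 ≤ lim + 6 * k → HeapLe lim s s' →
      LeafContraction st st' → StageStored nm n 0 1 m E st' (s'.reg 5) s' →
      (m = 0 → ∃ r, st'.live = {r} ∧ s'.reg 12 = nm r) → Q t s') :
    contractLeaves.vc n B Q s := by
  have ht := hS.tree
  obtain ⟨M, hM⟩ : ∃ M : ℕ → S × S, M = fun j => towardsLeaf st.graph (N j) := ⟨_, rfl⟩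
  have hGM : EdgesOf st.graph M k := hM ▸ hS.edges.orient
  have hlw : Leafward st.graph M k := hM ▸ leafward_towardsLeaf _ _ _
  have hedge : ∀ j, edge M j = edge N j := fun j => by rw [hM, edge_towardsLeaf]
  have hk0 : 0 < k := by
    obtain ⟨x, hx⟩ := hn.nonempty
    obtain ⟨y, hy⟩ := deg_pos_iff.1 (ht.deg_pos hn hx)
    obtain ⟨j, hj, _⟩ := (hS.edges.adj_iff x y).1 hy
    omega
  rw [contractLeaves, Cmd.vc_block_cons, Cmd.vc_asg]
  refine ⟨by decide, by simp [Expr.eval], ?_⟩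
  rw [Cmd.vc_block_cons, Cmd.vc_asg]
  refine ⟨by decide, by simp [Expr.eval], ?_⟩
  rw [Cmd.vc_block_cons]
  refine Cmd.vc_for k 50 (fun j s' => ∃ m E,
    Frame [2, 3, 5, 6, 7, 10, 11, 12, 16, 17, 18] [0, 1, 5, 15] s s' ∧ s'.reg 3 = j ∧ j ≤ k ∧
    s'.reg 2 = m ∧ lim ≤ s'.reg 5 ∧ s'.reg 5 ≤ lim + 6 * j ∧ HeapLe lim s s' ∧
    LeavesDone nm n st M j E m (s'.reg 5) s') ?_ ?_ ?_ ?_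
  · rintro j s' ⟨m, E, hf, h3, hj, _⟩
    have g4 := hf.1 4 (by decide)
    refine ⟨hj, ?_⟩
    simp only [Expr.eval, h3, g4, h4]
    split <;> simp_all
  · rintro j hj s' ⟨m, E, hf, h3, _, h2, hlo, hhi, hh, hL⟩
    rw [Cmd.vc_block_cons]
    refine orientLeaf_spec hS.edges hnm hkn (by rw [hf.2 10 (by decide)]; exact hS.holds)
      (by rw [hf.2 2 (by decide)]; exact hd) hj h3 hM fun t₁ s₁ ht₁ hf₁ k6 k7 k10 k17 => ?_
    have ka : ∀ i, s₁.arr i = s'.arr i := fun i => hf₁.2 i (by simp)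
    have k3 := (hf₁.1 3 (by decide)).trans h3
    have k2 := (hf₁.1 2 (by decide)).trans h2
    have k5 := hf₁.1 5 (by decide)
    have hL₁ : LeavesDone nm n st M j E m (s'.reg 5) s₁ :=
      hL.mono (ka 0) (ka 1) (ka 5) (ka 15) (hf₁.1 12 (by decide))
    have hq : Stored nm (s₁.arr 15) (30 * n) (s'.reg 5) (s₁.reg 17) (st.bst (edge M j)) := by
      rw [ka 15, k17, hedge, hf.2 11 (by decide)]
      exact (hS.bst j hj).heapLe hh hlo
    have hf' := hf.trans (hf₁.mono (rs' := [2, 3, 5, 6, 7, 10, 11, 12, 16, 17, 18])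
      (ks' := [0, 1, 5, 15]) (by decide) (by simp))
    rw [Cmd.vc_block_cons, Cmd.vc_ite]
    simp only [Expr.eval, k10]
    refine ⟨fun h => ?_, fun h => ?_⟩
    · have h1 : deg st.graph (M j).2 = 1 := by by_contra hc; simp [hc] at h
      refine absorbLeaf_spec hnm hinj hB ht hGM hj hL₁ k5 (by omega) k6 k7 h1 hq
        fun t₂ s₂ ht₂ hf₂ l5 hh₂ hL₂ => ?_
      have l3 := (hf₂.1 3 (by decide)).trans k3
      have l2 := (hf₂.1 2 (by decide)).trans k2
      simp only [Cmd.vc_block_cons, Cmd.vc_block_nil, Cmd.vc_asg, Expr.eval, l3]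
      have hh' : HeapLe (s'.reg 5) s' s₂ := fun q hq => by rw [hh₂ q hq, ka 15]
      refine ⟨by decide, by omega, by omega, m, E, (hf'.trans (hf₂.mono (by decide)
        (by decide))).set_reg (by decide), by simp, by omega, by simp [l2], by simp; omega,
        by simp; omega, hh.trans hh' hlo, ?_⟩
      rw [show Function.update s₂.reg 3 (j + 1) 5 = s'.reg 5 + 6 by simp [l5]]
      exact hL₂.mono rfl rfl rfl rfl (by simp)
    · have h1 : deg st.graph (M j).2 ≠ 1 := by intro hc; simp [hc] at h
      refine keepEdge_spec hnm hkn hB hGM hj hL₁ k2 (by omega) k6 k7 h1 hq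
        fun t₂ s₂ ht₂ hf₂ l2 hL₂ => ?_
      have l3 := (hf₂.1 3 (by decide)).trans k3
      have l5 := (hf₂.1 5 (by decide)).trans k5
      simp only [Cmd.vc_block_cons, Cmd.vc_block_nil, Cmd.vc_asg, Expr.eval, l3]
      refine ⟨by decide, by omega, by omega, m + 1, Function.update E m (M j), (hf'.trans (hf₂.mono (by decide)
        (by decide))).set_reg (by decide), by simp, by omega, by simp [l2], by simp; omega,
        by simp; omega, fun q hq => ?_, ?_⟩
      · simp [hf₂.2 15 (by decide), ka 15, hh q hq]
      · rw [show Function.update s₂.reg 3 (j + 1) 5 = s'.reg 5 by simp [l5]]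
        exact hL₂.mono rfl rfl rfl rfl (by simp)
  · refine ⟨0, M, ((Frame.refl _ _ s).set_reg (by decide)).set_reg (by decide), by simp [Expr.eval],
      by omega, by simp [Expr.eval], by simp [h5], by simp [h5], HeapLe.refl _ _,
      ⟨le_rfl, fun i hi => by omega, ⟨fun e => by simp, fun i hi => by omega⟩, fun i hi => by omega,
        fun x hx => ?_, fun h => by omega⟩⟩
    simpa [h5, absorbed, addQueries] using hS.lst x hx
  · rintro t s' htime ⟨m, E, hf, h3, _, h2, hlo, hhi, hh, hL⟩
    rw [Cmd.vc_block_nil]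
    have hlc := leafContraction_leafStage ht hGM hlw hn
    have hE := hL.kept.edgesOf ht hGM hlw
    refine hQ _ _ m E _ (by omega) hf h2 hlo hhi hh hlc
      ⟨hlc.treeOn ht, hE, hL.holds, hL.bst, fun x hx => ?_, hS.nil_stored.heapLe hh hlo⟩ fun hm => ?_
    · have : (leafStage st M k).lst x = addQueries st x (absorbed st.graph M x k) := if_pos hx
      rw [this]
      exact hL.lst x hx.1
    -- A tree without edges has one node, and the node in register `12` remains, so it is this one.
    · obtain ⟨i, hi, h1, h12⟩ := hL.root hk0 hm
      refine ⟨_, ?_, h12⟩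
      have hc := (hlc.treeOn ht).card_edges
      rw [hE.card_eq, hm] at hc
      obtain ⟨r, hr⟩ := Set.ncard_eq_one.1 hc.symm
      have := hGM.fst_mem_remaining ht hi h1
      rw [hr, Set.mem_singleton_iff.1 (show (M i).1 ∈ ({r} : Set S) from hr ▸ this)]

end LeafPhase

end LineLeaf
namespace LineLeaf

/-! ## The whole program -/

/-- One iteration. -/
def iterate : Cmd := .block [resetDegrees, countDegrees, contractLines, contractLeaves]

/-- Creates the search trees of the nodes and edges of the Hasse diagram. -/
def setUp : Cmd := .block [
  .asg 2 (.sub (.reg 0) (.const 1)),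
  .asg 5 (.add nilAddr (.const 6)),
  .asg 3 (.const 0),
  .loop (.lt (.reg 3) (.reg 0)) (.block [
    .hst (.reg 5) (.const 1),
    .hst (.add (.reg 5) (.const 1)) (.reg 3),
    .st 5 (.reg 3) (.reg 5),
    .st 1 (.reg 3) nilAddr,
    .asg 5 (.add (.reg 5) (.const 6)),
    .asg 3 (.add (.reg 3) (.const 1))])]

/-- Builds a Line-Leaf Tree. -/
def buildLineLeafTree : Cmd := .block [setUp, .loop (.reg 2) iterate, .ld 1 5 (.reg 12)]

/-! ### The cost of all iterations. -/

section Main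

variable {S : Type*} {nm : S → ℕ} {n B : ℕ}

/-- A leaf starts a line, whose two ends both survive. -/
theorem LineContraction.nontrivial [Finite S] {st st' : Stage S} (hc : LineContraction st st')
    (ht : TreeOn st.live st.graph) (hn : st.live.Nontrivial) : st'.live.Nontrivial := by
  obtain ⟨x, hx, h1⟩ := ht.exists_deg_one hn
  obtain ⟨b, hb⟩ := deg_pos_iff.1 (by omega : 0 < deg st.graph x)
  obtain ⟨y, p, hp, _⟩ := ht.exists_line (by omega) hb
  have hadj : st'.graph.Adj x y := (hc.adj_iff x y).2 ⟨p, hp⟩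
  exact ⟨x, (hc.treeOn ht).left_mem hadj, y, (hc.treeOn ht).right_mem hadj, hadj.ne⟩

theorem LineContraction.deg_eq [Finite S] {st st' : Stage S} (hc : LineContraction st st')
    (ht : TreeOn st.live st.graph) {x : S} (hx : 0 < deg st'.graph x) :
    deg st'.graph x = deg st.graph x := by
  rw [hc.graph_eq] at hx ⊢
  by_cases h2 : deg st.graph x = 2
  · rw [deg_lineGraph_of_two h2] at hx
    omega
  · exact ht.deg_lineGraph h2

/-- At least half of the nodes disappear in an iteration. -/
theorem ncard_iteration [Finite S] {st st₁ st₂ : Stage S} (ht : TreeOn st.live st.graph)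
    (hn : st.live.Nontrivial) (hc : LineContraction st st₁) (hc' : LeafContraction st₁ st₂) :
    2 * st₂.live.ncard ≤ st.live.ncard := by
  have ht₁ := hc.treeOn ht
  have hn₁ := hc.nontrivial ht hn
  have h1 : st₁.live.ncard ≤ st.live.ncard :=
    Set.ncard_le_ncard (by rw [hc.live_eq]; exact fun x hx => hx.1) (Set.toFinite _)
  have h2 := Set.one_lt_ncard_iff_nontrivial.2 hn₁
  by_cases hne : {x ∈ st₁.live | deg st₁.graph x ≠ 1}.Nonempty
  -- After the line contraction no node has degree two, so the inner nodes, which are those kept,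
  -- are fewer than the leaves.
  · have h3 := ht₁.internal_add_two_le hn₁ fun x _ => by
      rw [hc.graph_eq]; exact ht.deg_lineGraph_ne_two x
    have h4 : {x ∈ st₁.live | deg st₁.graph x ≠ 1}.ncard +
        {x ∈ st₁.live | deg st₁.graph x = 1}.ncard = st₁.live.ncard := by
      rw [← Set.ncard_union_eq]
      · congr 1
        ext x
        simp only [Set.mem_union, Set.mem_sep_iff]
        tauto
      · rw [Set.disjoint_left]
        exact fun x hx hx' => hx.2 hx'.2
    rw [hc'.live_eq hne]
    omega
  · obtain ⟨r, _, hr⟩ := hc'.live_root hne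
    rw [hr, Set.ncard_singleton]
    omega

/-- A tree with `m` edges has `m + 1` nodes, so halving the nodes gives `2 * (m' + 1) ≤ m + 1`. The
heap grows by at most `12 * m` cells for the lines and `6 * m` for the leaves. -/
theorem iterate_spec [Finite S] (hnm : ∀ x, nm x < n) (hinj : Function.Injective nm)
    (hcard : Nat.card S ≤ n) {m : ℕ} (hmn : m < n) (hm : 0 < m) (hB : 30 * n + 6 ≤ B) {s : Mach}
    {lim : ℕ} {E : ℕ → S × S} {st : Stage S} (hS : StageStored nm n 0 1 m E st lim s)
    (h0 : s.reg 0 = n) (h2 : s.reg 2 = m) (h5 : s.reg 5 = lim) (hlim : lim + 18 * m ≤ B)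
    {Q : ℕ → Mach → Prop}
    (hQ : ∀ t s' m' E' st', t ≤ 740 * m → s'.reg 0 = n → s'.reg 2 = m' → 2 * m' + 1 ≤ m →
      s'.reg 5 ≤ lim + 18 * m → Iteration st st' → StageStored nm n 0 1 m' E' st' (s'.reg 5) s' →
      (m' = 0 → ∃ r, st'.live = {r} ∧ s'.reg 12 = nm r) → Q t s') :
    iterate.vc n B Q s := by
  have ht := hS.tree
  have hn : st.live.Nontrivial :=
    ⟨_, ht.left_mem (hS.edges.adj hm), _, ht.right_mem (hS.edges.adj hm), (hS.edges.adj hm).ne⟩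
  rw [iterate, Cmd.vc_block_cons]
  refine resetDegrees_spec hnm (by omega) hmn hS.holds h2 fun t₁ s₁ ht₁ hf₁ hz => ?_
  rw [Cmd.vc_block_cons]
  refine countDegrees_spec hnm hinj (by omega) hmn hS.edges (by rw [hf₁.2 0 (by decide)]; exact hS.holds)
    ((hf₁.1 2 (by decide)).trans h2) hz fun t₂ s₂ ht₂ hf₂ hd => ?_
  have hf : Frame [3, 6, 10, 11] [2, 3, 4] s s₂ :=
    (hf₁.mono (by decide) (by decide)).trans hf₂
  have hS₂ : StageStored nm n 0 1 m E st lim s₂ := hS.mono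
    (fun q _ => by rw [hf.2 15 (by decide)]) le_rfl (hf.2 0 (by decide)) (hf.2 1 (by decide))
    (hf.2 5 (by decide))
  have g0 := (hf.1 0 (by decide)).trans h0
  rw [Cmd.vc_block_cons]
  refine contractLines_spec hnm hinj hcard hmn hB hS₂ hd g0
    ((hf.1 2 (by decide)).trans h2) ((hf.1 5 (by decide)).trans h5) (by omega)
    fun t₃ s₃ k N st₁ ht₃ hf₃ h4 hlo hhi _ hc hS₃ => ?_
  have hc1 := hS.tree.card_edges
  have hc2 := hS₃.tree.card_edges
  have hsub : st₁.live.ncard ≤ st.live.ncard :=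
    Set.ncard_le_ncard (by rw [hc.live_eq]; exact fun x hx => hx.1) (Set.toFinite _)
  rw [hS.edges.card_eq] at hc1
  rw [hS₃.edges.card_eq] at hc2
  rw [Cmd.vc_block_cons]
  refine contractLeaves_spec hnm hinj (by omega) hB hS₃ (fun x hx => ?_) (hc.nontrivial ht hn) h4 rfl
    (by omega) fun t₄ s₄ m' E' st₂ ht₄ hf₄ k2 _ khi _ hc' hS₄ hroot => ?_
  -- The degrees need not be counted again: a line contraction preserves those of the remaining
  -- nodes.
  · have h1 := hc.deg_eq ht hx
    rw [hf₃.2 2 (by decide), h1]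
    exact (hd x (by omega)).1
  · have hhalf := ncard_iteration ht hn hc hc'
    have hc3 := hS₄.tree.card_edges
    rw [hS₄.edges.card_eq] at hc3
    rw [Cmd.vc_block_nil]
    exact hQ _ _ m' E' st₂ (by omega) ((hf₄.1 0 (by decide)).trans ((hf₃.1 0 (by decide)).trans g0))
      k2 (by omega) (by omega) ⟨hn, st₁, hc, hc'⟩ hS₄ hroot

theorem setUp_spec (hnm : ∀ x, nm x < n) (hB : 40 * n + 6 ≤ B) {s : Mach}
    (h0 : s.reg 0 = n) (hnil : s.arr 15 (30 * n) = 0) {Q : ℕ → Mach → Prop}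
    (hQ : ∀ t s', t ≤ 20 * n + 10 → Frame [2, 3, 5] [1, 5, 15] s s' → s'.reg 2 = n - 1 →
      s'.reg 5 = 36 * n + 6 → (∀ i < n, s'.arr 1 i = 30 * n) →
      Stored nm (s'.arr 15) (30 * n) (36 * n + 6) (30 * n) SearchTree.nil →
      (∀ x, Stored nm (s'.arr 15) (30 * n) (36 * n + 6) (s'.arr 5 (nm x)) (SearchTree.found x)) →
      Q t s') : setUp.vc n B Q s := by
  rw [setUp, Cmd.vc_block_cons, Cmd.vc_asg]
  refine ⟨by decide, by simp [Expr.eval, h0]; omega, ?_⟩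
  rw [Cmd.vc_block_cons, Cmd.vc_asg]
  refine ⟨by decide, by simp [Expr.eval, nilAddr, Expr.eval_mulc, h0]; omega, ?_⟩
  rw [Cmd.vc_block_cons, Cmd.vc_asg]
  refine ⟨by decide, by simp [Expr.eval], ?_⟩
  rw [Cmd.vc_block_cons]
  refine Cmd.vc_for n 10 (fun j s' => Frame [2, 3, 5] [1, 5, 15] s s' ∧ s'.reg 3 = j ∧ j ≤ n ∧
    s'.reg 2 = n - 1 ∧ s'.reg 5 = 30 * n + 6 + 6 * j ∧ (∀ i < j, s'.arr 1 i = 30 * n) ∧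
    s'.arr 15 (30 * n) = 0 ∧ ∀ x, nm x < j →
      Stored nm (s'.arr 15) (30 * n) (30 * n + 6 + 6 * j) (s'.arr 5 (nm x)) (SearchTree.found x))
    ?_ ?_ ?_ ?_
  · rintro j s' ⟨hf, h3, hj, _⟩
    have g0 := hf.1 0 (by decide)
    refine ⟨hj, ?_⟩
    simp only [Expr.eval, h3, g0, h0]
    split <;> simp_all
  · rintro j hj s' ⟨hf, h3, _, h2, h5, h1, h15, hst⟩
    have g0 := (hf.1 0 (by decide)).trans h0
    simp [Expr.eval, nilAddr, Expr.eval_mulc, h3, h5, g0]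
    refine ⟨⟨by omega, by omega⟩, by omega, ⟨by omega, by omega⟩, by omega, by omega, by omega,
      by omega, by omega, by omega, by omega, ?_, by omega, h2, by omega, ?_, ?_, ?_⟩
    · exact (((((hf.set_arr (by decide)).set_arr (by decide)).set_arr (by decide)).set_reg
        (by decide)).set_reg (by decide))
    · intro i hi
      rcases Nat.lt_or_eq_of_le hi with hi | rfl
      · rw [Function.update_of_ne hi.ne, h1 i hi]
      · rw [Function.update_self]
    · rw [Function.update_of_ne (by omega), Function.update_of_ne (by omega), h15]
    · intro x hx
      rcases Nat.lt_or_eq_of_le hx with hx | rfl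
      · rw [Function.update_of_ne hx.ne]
        refine (hst x hx).mono (fun q _ hq => ?_) (by omega)
        rw [Function.update_of_ne (by omega), Function.update_of_ne (by omega)]
      · rw [Function.update_self]
        exact Stored.found _ x (by omega) (by omega) (by simp) (by simp)
  · refine ⟨(((Frame.refl _ _ s).set_reg (by decide)).set_reg (by decide)).set_reg (by decide),
      by simp [Expr.eval], Nat.zero_le _, by simp [Expr.eval, h0],
      by simp [Expr.eval, nilAddr, Expr.eval_mulc, h0], fun i hi => by omega, by simpa using hnil,
      fun x hx => by omega⟩
  · rintro t s' htime ⟨hf, h3, _, h2, h5, h1, h15, hst⟩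
    rw [show 30 * n + 6 + 6 * n = 36 * n + 6 by omega] at h5 hst
    rw [Cmd.vc_block_nil]
    exact hQ _ _ (by omega) hf h2 h5 h1 (Stored.nil _ le_rfl (by omega) h15)
      fun x => hst x (hnm x)

theorem buildLineLeafTree_spec [PartialOrder S] (hS : TreeLike S) (hnm : ∀ x, nm x < n)
    (hinj : Function.Injective nm) (hcard : Nat.card S = n) (hB : 80 * n ≤ B) {s : Mach}
    {E : ℕ → S × S} (hG : EdgesOf (SimpleGraph.hasse S) E (n - 1))
    (hE : HoldsEdges nm (s.arr 0) E (n - 1)) (h0 : s.reg 0 = n) (h12 : s.reg 12 = 0)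
    (hnil : s.arr 15 (30 * n) = 0) :
    buildLineLeafTree.vc n B (fun t s' => t ≤ 1600 * n ∧ ∃ T lim, IsLineLeafTree T ∧
      Stored nm (s'.arr 15) (30 * n) lim (s'.reg 1) T) s := by
  have := hS.finite
  obtain ⟨ν, _⟩ := hS.exists_least
  have hn : 0 < n := (Nat.zero_le _).trans_lt (hnm ν)
  rw [buildLineLeafTree, Cmd.vc_block_cons]
  refine setUp_spec hnm (by omega) h0 hnil fun t₀ s₀ ht₀ hf₀ g2 g5 g1 gnil gst => ?_
  rw [Cmd.vc_block_cons]
  have hS₀ : StageStored nm n 0 1 (n - 1) E (initial S) (36 * n + 6) s₀ := by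
    refine ⟨hS.treeOn, hG, by rw [hf₀.2 0 (by decide)]; exact hE, fun j hj => ?_, fun x _ => gst x,
      gnil⟩
    rw [g1 j (by omega)]
    exact gnil
  -- The geometric series as a potential: since `2 * m' + 1 ≤ m`, the terms `36 * k` and `1500 * k`
  -- drop by at least `18 * m` and `750 * m`, which pays for the heap and the time of an iteration.
  refine Cmd.vc_loop (fun k t s' => ∃ E st lim, Relation.ReflTransGen Iteration (initial S) st ∧
    StageStored nm n 0 1 k E st lim s' ∧ s'.reg 0 = n ∧ s'.reg 2 = k ∧ s'.reg 5 = lim ∧ k < n ∧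
    lim + 36 * k ≤ 72 * n + 6 ∧ t + 1500 * k ≤ 1500 * n ∧
    (k = 0 → ∃ r, st.live = {r} ∧ s'.reg 12 = nm r)) (k := n - 1) ?_ ?_
  · rintro m t s' ⟨E, st, lim, hrel, hst, k0, k2, k5, hmn, hlim, htime, hroot⟩
    simp only [Expr.eval, k2]
    refine ⟨fun hm => ?_, fun hm => ?_⟩
    · subst hm
      obtain ⟨r, hr, k12⟩ := hroot rfl
      have hr' := hst.lst r (by rw [hr]; exact rfl)
      have := hnm r
      simp [Expr.eval, k12]
      exact ⟨by omega, fun _ => ⟨by omega, st.lst r, ⟨st, r, hrel, hr, rfl⟩, lim, hr'⟩⟩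
    · refine iterate_spec hnm hinj hcard.le hmn (by omega) (by omega) hst k0 k2 k5 (by omega)
        fun t₁ s₁ m' E' st' ht₁ l0 l2 hhalf hlim' hit hst' hroot' => ?_
      exact ⟨m', by omega, E', st', _, hrel.tail hit, hst', l0, l2, rfl, by omega, by omega,
        by omega, hroot'⟩
  · refine ⟨E, initial S, _, Relation.ReflTransGen.refl, hS₀, (hf₀.1 0 (by decide)).trans h0, g2, g5,
      by omega, by omega, by omega, fun h => ?_⟩
    -- For `n = 1` there is no iteration, and the initial value `0` of register `12` is the name of
    -- the only node.
    have hsub : ∀ x : S, x = ν := fun x => hinj (by have := hnm x; have := hnm ν; omega)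
    refine ⟨ν, Set.eq_singleton_iff_unique_mem.2 ⟨Set.mem_univ _, fun x _ => hsub x⟩, ?_⟩
    rw [hf₀.1 12 (by decide), h12]
    have := hnm ν
    omega

end Main

/-! ## The input -/

section Input

variable {S : Type*}

theorem getD_flatMap_pair (nm : S → ℕ) (d : S × S) (L : List (S × S)) :
    ∀ j < L.length, (L.flatMap fun e => [nm e.1, nm e.2]).getD (2 * j) 0 = nm (L.getD j d).1 ∧
      (L.flatMap fun e => [nm e.1, nm e.2]).getD (2 * j + 1) 0 = nm (L.getD j d).2 := by
  induction L with
  | nil => simp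
  | cons e L ih =>
    intro j hj
    rcases j with _ | j
    · simp
    · have := ih j (by simpa using hj)
      rw [show 2 * (j + 1) + 1 = (2 * j + 1) + 2 by ring, show 2 * (j + 1) = 2 * j + 2 by ring]
      simpa using this

theorem getD_flatMap_le (nm : S → ℕ) {B : ℕ} (h : ∀ x, nm x ≤ B) (L : List (S × S)) (i : ℕ) :
    (L.flatMap fun e => [nm e.1, nm e.2]).getD i 0 ≤ B := by
  rw [List.getD_eq_getElem?_getD]
  cases hc : (L.flatMap fun e => [nm e.1, nm e.2])[i]? with
  | none => simp
  | some v =>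
    have := List.mem_of_getElem? hc
    simp only [List.mem_flatMap, List.mem_cons, List.not_mem_nil, or_false] at this
    obtain ⟨e, _, rfl | rfl⟩ := this
    · exact h _
    · exact h _

theorem IsEdgeList.edgesOf [PartialOrder S] {L : List (S × S)} (hL : IsEdgeList L) (d : S × S) :
    EdgesOf (SimpleGraph.hasse S) (fun j => L.getD j d) L.length := by
  have hget : ∀ j < L.length, L.getD j d ∈ L := fun j hj => by
    rw [List.getD_eq_getElem _ _ hj]
    exact List.getElem_mem hj
  have hinj : ∀ i < L.length, ∀ j < L.length, L.getD i d = L.getD j d → i = j := by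
    intro i hi j hj h
    rw [List.getD_eq_getElem _ _ hi, List.getD_eq_getElem _ _ hj] at h
    exact (hL.1.getElem_inj_iff).1 h
  have hex : ∀ x y : S, x ⋖ y → ∃ j < L.length, L.getD j d = (x, y) := by
    intro x y h
    obtain ⟨j, hj, he⟩ := List.getElem_of_mem ((hL.2 x y).2 h)
    exact ⟨j, hj, by rw [List.getD_eq_getElem _ _ hj, he]⟩
  have hcov : ∀ j < L.length, ((fun j => L.getD j d) j).1 ⋖ ((fun j => L.getD j d) j).2 :=
    fun j hj => (hL.2 _ _).1 (hget j hj)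
  refine ⟨fun x y => ?_, fun i hi j hj h => ?_⟩
  · rw [SimpleGraph.hasse_adj]
    constructor
    · rintro (h | h)
      · obtain ⟨j, hj, he⟩ := hex x y h
        exact ⟨j, hj, by simp only [edge, he]⟩
      · obtain ⟨j, hj, he⟩ := hex y x h
        exact ⟨j, hj, by simp only [edge, he]; exact Sym2.eq_swap⟩
    · rintro ⟨j, hj, he⟩
      have h1 := hcov j hj
      rcases Sym2.eq_iff.1 he with ⟨h2, h3⟩ | ⟨h2, h3⟩
      · rw [h2, h3] at h1
        exact Or.inl h1
      · rw [h2, h3] at h1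
        exact Or.inr h1
  · have h1 := hcov i hi
    have h2 := hcov j hj
    rcases Sym2.eq_iff.1 h with ⟨h3, h4⟩ | ⟨h3, h4⟩
    · exact hinj i hi j hj (Prod.ext h3 h4)
    -- The same pair cannot be listed in both directions, because covering is asymmetric.
    · rw [h3, h4] at h1
      exact absurd h1.lt h2.lt.asymm

end Input

theorem exists_exec_buildLineLeafTree {S : Type*} [PartialOrder S] (hS : TreeLike S) {n : ℕ}
    {nm : S → ℕ} (hnm : ∀ x, nm x < n) (hinj : Function.Injective nm) (hn : n = Nat.card S)
    {L : List (S × S)} (hL : IsEdgeList L) :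
    ∃ (t : ℕ) (c : Config) (T : SearchTree S),
      Exec (2000 * n) buildLineLeafTree.compile (input n nm L) t c ∧ t ≤ 2000 * n ∧
      IsLineLeafTree T ∧ StoredAt nm c.mem (c.reg 1) T := by
  have := hS.finite
  obtain ⟨ν, _⟩ := hS.exists_least
  have hG := hL.edgesOf (ν, ν)
  have hlen : L.length = n - 1 := by
    have := hS.treeOn.card_edges
    rw [hG.card_eq, Set.ncard_univ] at this
    omega
  rw [hlen] at hG
  have hpos : 0 < n := (Nat.zero_le _).trans_lt (hnm ν)
  obtain ⟨mem, hmem⟩ : ∃ mem : ℕ → ℕ, mem = fun i => (L.flatMap fun e => [nm e.1, nm e.2]).getD i 0 :=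
    ⟨_, rfl⟩
  have hinput : input n nm L = ⟨fun i => if i = 0 then n else 0, mem⟩ := by rw [input, hmem]
  have hrep : Cmd.Rep n (2000 * n) mem ⟨fun i => if i = 0 then n else 0,
      fun k i => if k < 15 then mem (2 * k * n + i) else mem i⟩ := by
    refine ⟨by simp, fun p => ?_, fun k hk i _ => by simp [hk], fun p _ => by simp⟩
    rw [hmem]
    exact getD_flatMap_le nm (fun x => by have := hnm x; omega) L p
  -- The input occupies only `2 * (n - 1)` cells. So the first heap cell is `0` and represents the
  -- empty leaf shared by all trees.
  have hnil : mem (30 * n) = 0 := by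
    have hl : (L.flatMap fun e => [nm e.1, nm e.2]).length ≤ 30 * n := by
      rw [List.length_flatMap]
      simp
      omega
    rw [hmem]
    exact List.getD_eq_default _ _ hl
  have hpair := getD_flatMap_pair nm (ν, ν) L
  obtain ⟨t, s', mem', hexec, hrep', ht, T, lim, hT, hst⟩ := Cmd.exec_of_vc (by omega)
    (buildLineLeafTree_spec hS hnm hinj hn.symm (B := 2000 * n) (by omega) hG
      (s := ⟨fun i => if i = 0 then n else 0, fun k i => if k < 15 then mem (2 * k * n + i) else mem i⟩)
      (fun j hj => by simpa [hmem] using hpair j (by omega)) (by simp) (by simp) (by simpa using hnil)) hrep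
  refine ⟨t, ⟨s'.reg, mem'⟩, T, ?_, by omega, hT, hst.storedAt hrep'.heap⟩
  rw [hinput]
  exact hexec

theorem buildsLineLeafTrees : BuildsLineLeafTrees buildLineLeafTree.compile 2000 :=
  fun _ _ hS e _ hL => exists_exec_buildLineLeafTree hS (fun x => (e x).2)
    (Fin.val_injective.comp e.injective) rfl hL

end LineLeaf

theorem theorem1 :
    (∃ C : ℝ, 0 < C ∧ ∀ (S : Type*) [PartialOrder S], LineLeaf.TreeLike S →
      ∀ T : LineLeaf.SearchTree S, LineLeaf.IsLineLeafTree T →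
        (T.height : ℝ) ≤ C * max 1 (Real.logb 2 (LineLeaf.width S)) * LineLeaf.opt S) ∧
    (∃ c : ℝ, 0 < c ∧ ∀ W : ℕ, ∃ (S : Type) (_ : PartialOrder S), LineLeaf.TreeLike S ∧
      W ≤ LineLeaf.width S ∧
      ∀ T : LineLeaf.SearchTree S, LineLeaf.IsLineLeafTree T →
        c * Real.logb 2 (LineLeaf.width S) * LineLeaf.opt S ≤ (T.height : ℝ)) ∧
    (∃ (P : LineLeaf.Program) (C : ℕ), LineLeaf.BuildsLineLeafTrees P C) := by
  exact ⟨⟨18, by norm_num, fun S _ hS T hT => hT.height_le hS⟩,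
    ⟨1 / 72, by norm_num, LineLeaf.exists_high_lineLeafTrees⟩,
    LineLeaf.buildLineLeafTree.compile, 2000, LineLeaf.buildsLineLeafTrees⟩
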